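/- Let $D\ge 1$ be an integer, $\lambda>0$, and let $B$ be a probability law on $(0,\infty)$. For $N\ge 1$ consider $N$ servers of unit speed which use the same work-conserving service discipline. Jobs arrive in a Poisson process of rate $\lambda N$ and have i.i.d. service requirements of law $B$. Each job samples $\min(D,N)$ of the servers uniformly at random and at once joins one with the shortest queue among these, ties being broken uniformly at random. Arrival times, samples, tie-breaking and service requirements are independent of each other and of the initial server states. Here the state of a server records the residual service requirements of the jobs present and whatever else the discipline uses; the initial states of the $N$ servers have an arbitrary joint law $\mu_N$ such that the law $\nu$ of the initial state of server $1$ does not depend on $N$. Let $X^N_t(i)$ be the number of jobs at server $i$ at time $t$. For $x\in\mathbb Z_+^N$ put $\pi_k(x)=\#\{i: x(i)\ge k\}$ and let $$\lambda^N(x,k)=1_{\{x(1)=k\}}\,\lambda N\sum_{i=1}^D\frac1i\,\frac{\binom{\pi_k(x)-\pi_{k+1}(x)-1}{i-1}\binom{\pi_{k+1}(x)}{D-i}}{\binom ND}\qquad(N\ge D)$$ be the arrival rate of server $1$ on the event that its queue has length $k$. Let $T\in\mathbb R$. A bounded function $(t,k)\mapsto\lambda^k_t\ge 0$, measurable in $t$,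 is called a limiting rate on $[0,T]$ if for every $t\in[0,T]$ and $k\in\mathbb Z_+$ the rates $\lambda^N(X^N_t,k)$ converge in $L^2$ to the constant $\lambda^k_t$ on the event $\{X^N_t(1)=k\}$, that is, $$\lim_{N\to\infty}\mathbb E\Big[1_{\{X^N_t(1)=k\}}\big(\lambda^N(X^N_t,k)-\lambda^k_t\big)^2\Big]=0 .$$ (i) If the initial server states are independent, server $i$ having initial law $\nu_i$ (not depending on $N$), and if $\frac1N\sum_{i=1}^N\nu_i$ converges in total variation to a probability measure as $N\to\infty$ (for instance, if the initial states are i.i.d.), then there is a limiting rate with values in $[0,\lambda D]$. (ii) Whenever $(\lambda^k_t)$ is a limiting rate on $[0,T]$, let $Q_t$ be the queue length at time $t$ of a single server with the same service discipline, service requirement law $B$ and initial law $\nu$, whose jobs arrive with time- and state-dependent Poisson intensity $\lambda^k_t$ at time $t$ when the queue has length $k$. Then for each fixed $t\in[0,T]$, $$\lim_{N\to\infty}\big\|\mathbb P_{X^N_t(1)}-\mathbb P_{Q_t}\big\|_{TV}=0 .$$ -/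

import Mathlib

open MeasureTheory ProbabilityTheory Set Filter Topology

noncomputable section

namespace LoadBalancing

/-- A work-conserving service discipline of a single server of unit speed, with server states in `E`.
A state records the jobs present together with everything the discipline needs to schedule them
(order of arrival, attained service, a random seed drawn at time `0`, ...).
`jobs e` is the multiset of the residual service requirements of the jobs present in state `e`,
`serve t e` is the state reached from `e` after a time `t ≥ 0` without arrivals, and
`arrive e s` is the state right after a job with service requirement `s` has joined. -/
structure ServiceDiscipline (E : Type*) [MeasurableSpace E] where
  jobs : E → Multiset ℝ
  serve : ℝ → E → E
  arrive : E → ℝ → E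
  /-- Completed jobs leave at once. -/
  jobs_pos : ∀ e, ∀ r ∈ jobs e, 0 < r
  /-- An arriving job is added; the others keep their residual requirements. -/
  jobs_arrive : ∀ e s, 0 < s → jobs (arrive e s) = s ::ₘ jobs e
  serve_zero : ∀ e, serve 0 e = e
  serve_add : ∀ s t e, 0 ≤ s → 0 ≤ t → serve (s + t) e = serve t (serve s e)
  /-- Work conservation. Each pair in `p` consists of the residual requirements of one job before
  and after a service period of length `t`. No residual requirement increases, the jobs whose
  requirement has reached `0` have left, and the server works at rate `1` as long as there is work. -/
  jobs_serve : ∀ t e, 0 ≤ t → ∃ p : Multiset (ℝ × ℝ),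
    p.map Prod.fst = jobs e ∧
    (p.map Prod.snd).filter (fun r => 0 < r) = jobs (serve t e) ∧
    (∀ q ∈ p, 0 ≤ q.2 ∧ q.2 ≤ q.1) ∧
    (p.map (fun q => q.1 - q.2)).sum = min t (jobs e).sum
  measurable_card_jobs : Measurable (fun e => (jobs e).card)
  measurable_serve : Measurable (fun q : ℝ × E => serve q.1 q.2)
  measurable_arrive : Measurable (fun q : E × ℝ => arrive q.1 q.2)

/-- The queue length: the number of jobs present at the server. -/
def ServiceDiscipline.queueLength {E : Type*} [MeasurableSpace E] (S : ServiceDiscipline E)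
    (e : E) : ℕ := (S.jobs e).card

/-! ### Arrival epochs of a Poisson process -/

/-- The `m`-th epoch (the `0`-th one being `0`) of the point process with interarrival times
`ξ 0 / c, ξ 1 / c, …`; for i.i.d. standard exponential `ξ` this is a Poisson process of rate `c`. -/
def epoch (c : ℝ) (ξ : ℕ → ℝ) (m : ℕ) : ℝ := (∑ j ∈ Finset.range m, ξ j) / c

/-- The number of arrivals in the time interval `[0, t]`. -/
def arrivalCount (c : ℝ) (ξ : ℕ → ℝ) (t : ℝ) : ℕ := {m : ℕ | epoch c ξ (m + 1) ≤ t}.ncard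

instance : IsProbabilityMeasure (expMeasure 1) := isProbabilityMeasure_expMeasure one_pos

/-! ### The system of `n` queues under JSQ(D) -/

instance (n : ℕ) : MeasurableSpace (Equiv.Perm (Fin n)) := ⊤

/-- The data driving the system of `n` servers: the initial states of the servers and, for each
arrival, the standardized interarrival time, the service requirement, and a ranking of the servers
(`σ i` is the rank of server `i`). -/
abbrev SystemPath (E : Type*) (n : ℕ) := (Fin n → E) × (ℕ → ℝ × ℝ × Equiv.Perm (Fin n))

/-- The law of the driving data: the initial states have joint law `μ`; independently of them and of
each other, the interarrival times are exponential, the service requirements have law `B` and the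
rankings are uniformly distributed. -/
def systemMeasure {E : Type*} [MeasurableSpace E] (B : Measure ℝ) [IsProbabilityMeasure B] {n : ℕ}
    (μ : Measure (Fin n → E)) : Measure (SystemPath E n) :=
  μ.prod (Measure.infinitePi fun _ : ℕ =>
    (expMeasure 1).prod (B.prod (PMF.uniformOfFintype (Equiv.Perm (Fin n))).toMeasure))

/-- The JSQ(D) rule. The `D` sampled servers are those with rank less than `D` in the ranking `σ`,
which is a uniformly random set of `D` servers if `D ≤ n`. The job joins a sampled server with the
shortest queue among the sampled ones, and ties are broken by the ranking, so uniformly. -/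
def Receives {n : ℕ} (D : ℕ) (x : Fin n → ℕ) (σ : Equiv.Perm (Fin n)) (i : Fin n) : Prop :=
  (σ i : ℕ) < D ∧ ∀ j, (σ j : ℕ) < D → x i < x j ∨ (x i = x j ∧ σ i ≤ σ j)

open Classical in
/-- The states of the `n` servers right after the `m`-th arrival (for `m = 0`: at time `0`);
`c` is the total arrival rate. -/
def stateAfter {E : Type*} [MeasurableSpace E] (S : ServiceDiscipline E) (D : ℕ) (c : ℝ) {n : ℕ}
    (ω : SystemPath E n) : ℕ → Fin n → E
  | 0 => ω.1
  | m + 1 =>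
    let y : Fin n → E := fun i => S.serve ((ω.2 m).1 / c) (stateAfter S D c ω m i)
    fun i => if Receives D (fun j => S.queueLength (y j)) (ω.2 m).2.2 i
      then S.arrive (y i) (ω.2 m).2.1 else y i

/-- The states of the `n` servers at time `t`, if jobs arrive at total rate `lam * n`. -/
def systemState {E : Type*} [MeasurableSpace E] (S : ServiceDiscipline E) (D : ℕ) (lam : ℝ) {n : ℕ}
    (ω : SystemPath E n) (t : ℝ) (i : Fin n) : E :=
  let c : ℝ := lam * n
  let ξ : ℕ → ℝ := fun j => (ω.2 j).1
  let m := arrivalCount c ξ t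
  S.serve (t - epoch c ξ m) (stateAfter S D c ω m i)

/-- The vector `X_t` of the queue lengths at time `t`. -/
def queueLengths {E : Type*} [MeasurableSpace E] (S : ServiceDiscipline E) (D : ℕ) (lam : ℝ) {n : ℕ}
    (ω : SystemPath E n) (t : ℝ) (i : Fin n) : ℕ :=
  S.queueLength (systemState S D lam ω t i)

/-! ### The arrival rate of the tagged queue

The systems are indexed so that system `N` has the `N + 1` servers `Fin (N + 1)`; the tagged server
is server `0`. -/

/-- The number of servers with queue length at least `k`. -/
def numGE {n : ℕ} (x : Fin n → ℕ) (k : ℕ) : ℕ := (Finset.univ.filter fun i => k ≤ x i).card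

/-- The arrival rate of the tagged server in a system with `n = N + 1` servers and queue lengths
`x`, on the event that the tagged queue has length `k` (and `0` off that event). -/
def taggedRate (lam : ℝ) (D : ℕ) {N : ℕ} (x : Fin (N + 1) → ℕ) (k : ℕ) : ℝ :=
  if x 0 = k then
    lam * ((N + 1 : ℕ) : ℝ) * ∑ i ∈ Finset.Icc 1 D, (1 / (i : ℝ)) *
      (((numGE x k - numGE x (k + 1) - 1).choose (i - 1) * (numGE x (k + 1)).choose (D - i) : ℕ) : ℝ)
        / ((N + 1).choose D : ℝ)
  else 0

/-- `rate t k`, with values in `[0, R]`, is the limiting arrival rate of the tagged queue on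
`[0, T]` for systems with joint initial laws `μ N`: for every `t ∈ [0, T]` and every `k`, the random
rate of the tagged server at time `t` converges in `L²` to the constant `rate t k` on the event that
the tagged queue has length `k`. -/
structure IsLimitRate {E : Type*} [MeasurableSpace E] (S : ServiceDiscipline E) (B : Measure ℝ)
    [IsProbabilityMeasure B] (D : ℕ) (lam T : ℝ) (μ : (N : ℕ) → Measure (Fin (N + 1) → E)) (R : ℝ)
    (rate : ℝ → ℕ → ℝ) : Prop where
  measurable : ∀ k, Measurable fun t => rate t k
  nonneg : ∀ t k, 0 ≤ rate t k
  le : ∀ t k, rate t k ≤ R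
  tendsto : ∀ t ∈ Icc 0 T, ∀ k, Tendsto
    (fun N => ∫ ω in {ω | queueLengths S D lam ω t 0 = k},
      (taggedRate lam D (queueLengths S D lam ω t) k - rate t k) ^ 2 ∂(systemMeasure B (μ N)))
    atTop (𝓝 0)

/-- The law of the queue length of the tagged server at time `t`. -/
def taggedLaw {E : Type*} [MeasurableSpace E] (S : ServiceDiscipline E) (B : Measure ℝ)
    [IsProbabilityMeasure B] (D : ℕ) (lam : ℝ) {N : ℕ} (μ : Measure (Fin (N + 1) → E)) (t : ℝ) :
    Measure ℕ :=
  (systemMeasure B μ).map fun ω => queueLengths S D lam ω t 0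

/-! ### A single queue with time- and state-dependent arrival rate -/

/-- The data driving a single queue with an arrival rate bounded by `R`: the initial state and, for
each point of a Poisson process of rate `R` of potential arrivals, the standardized interarrival
time, the service requirement, and a mark in `[0, 1]`. -/
abbrev QueuePath (E : Type*) := E × (ℕ → ℝ × ℝ × unitInterval)

/-- The law of the driving data of the single queue; the marks are uniform on `[0, 1]`. -/
def queueMeasure {E : Type*} [MeasurableSpace E] (B : Measure ℝ) [IsProbabilityMeasure B]
    (ν : Measure E) : Measure (QueuePath E) :=
  ν.prod (Measure.infinitePi fun _ : ℕ => (expMeasure 1).prod (B.prod volume))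

open Classical in
/-- The state of the single queue right after the `m`-th potential arrival. A potential arrival at
time `s` that finds `k` jobs is an actual arrival with probability `rate s k / R`, so that jobs
arrive with intensity `rate s k` at time `s` when the queue has length `k`. -/
def queueAfter {E : Type*} [MeasurableSpace E] (S : ServiceDiscipline E) (R : ℝ)
    (rate : ℝ → ℕ → ℝ) (ω : QueuePath E) : ℕ → E
  | 0 => ω.1
  | m + 1 =>
    let y : E := S.serve ((ω.2 m).1 / R) (queueAfter S R rate ω m)
    if ((ω.2 m).2.2 : ℝ) * R < rate (epoch R (fun j => (ω.2 j).1) (m + 1)) (S.queueLength y)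
      then S.arrive y (ω.2 m).2.1 else y

/-- The queue length `Q_t` of the single queue with arrival rate `rate`, where `rate ≤ R`. -/
def singleQueue {E : Type*} [MeasurableSpace E] (S : ServiceDiscipline E) (R : ℝ)
    (rate : ℝ → ℕ → ℝ) (ω : QueuePath E) (t : ℝ) : ℕ :=
  let ξ : ℕ → ℝ := fun j => (ω.2 j).1
  let m := arrivalCount R ξ t
  S.queueLength (S.serve (t - epoch R ξ m) (queueAfter S R rate ω m))

/-- The law of `Q_t`, if the initial state of the queue has law `ν`. -/
def singleQueueLaw {E : Type*} [MeasurableSpace E] (S : ServiceDiscipline E) (B : Measure ℝ)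
    [IsProbabilityMeasure B] (R : ℝ) (rate : ℝ → ℕ → ℝ) (ν : Measure E) (t : ℝ) : Measure ℕ :=
  (queueMeasure B ν).map fun ω => singleQueue S R rate ω t

/-! ### Total variation -/

/-- The total variation distance `sup_A |μ(A) - ν(A)|` of two probability measures. -/
def tvDist {α : Type*} [MeasurableSpace α] (μ ν : Measure α) : ℝ :=
  ⨆ A : {A : Set α // MeasurableSet A}, |μ.real A - ν.real A|

end LoadBalancing

end

namespace LoadBalancing

/-! ### The standard exponential law -/

/-! Fix a time `t` and a set `A` of queue lengths, and let `u s e` (`queueProb`) be the probability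
that the single queue with arrival rate `rate`, started at time `s` from the server state `e`, has
length in `A` at time `t`. Along the service flow `u` solves a backward equation (`queueProb_flow`):
its derivative is minus `rate` times the mean gain of `u` at an arrival (`arrivalGain`). Now
evaluate `u` at the servers of the large system. In the drift of a weighted sum of the values `u s
(Z_s i)` the flow contributes `-rate` times the gain of each server and the arrivals contribute its
true arrival rate times the same gain. Only the difference of the two rates survives, and a gain is
at most `1` in absolute value. This is `lintegral_comp_systemState_le`; the two parts of the theorem
come from two choices of weights. No coupling is needed, and the discipline enters only through its
deterministic measurable flow and the fact that service never lengthens a queue.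

Part (ii). All weight on the tagged server gives `tvDist_taggedLaw_le`: the total variation distance
is at most the time integral over `[0, t]` of the expected gap between the tagged arrival rate and
`rate`. That gap is bounded. On short queues it vanishes by the assumed `L²` convergence, and long
queues are unlikely uniformly in the number of servers (`lintegral_truncQueue_systemState_le`).
Dominated convergence in time finishes the argument.

Part (i). Equal weights `1/n` and a smoothed absolute value show that the fraction of servers with
length in `A` stays within order `1/√n` of a deterministic prediction, up to the averaged gap of the
arrival rates (`lintegral_abs_frac_sub_le`). By combinatorics the true arrival rate of a server of
length `k` is, up to a vanishing error, a Lipschitz function `lam * jsqPoly D` of the fractions of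
servers with length at least `k` and at least `k + 1`. As reference rate take the same function of
the expected fractions in a system `M`. The deviation of system `N` from the expected fractions of
system `M` then satisfies a Grönwall inequality (`fluct_add_fluct_le`). Hence the expected fractions
form a Cauchy sequence and the random ones concentrate. The limit is obtained by completeness, so no
limiting equation has to be solved. Fractions are controlled on the cells `{0}, …, {K - 1}, [K, ∞)`;
the Grönwall constant does not depend on `K`, because the gains over disjoint cells add up to at
most `2` (`sum_abs_arrivalGain_cell_le`), so `K` can be chosen first to make the tail small.

The single queue and the large system are both handled as processes that move deterministically
between the points of a Poisson process and jump at them. A Dynkin-type inequality for such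
processes (`lintegral_comp_stateAt_le`) follows from a one-step computation with an exponential
waiting time, summed over the points. -/

theorem expMeasure_one_eq :
    expMeasure 1 = (volume.restrict (Ioi 0)).withDensity fun x => ENNReal.ofReal (Real.exp (-x)) := by
  have h : expMeasure 1 = volume.withDensity (exponentialPDF 1) := rfl
  rw [h, Measure.restrict_congr_set (Ioi_ae_eq_Ici (a := (0 : ℝ))), ← withDensity_indicator measurableSet_Ici]
  congr 1
  ext x
  rw [exponentialPDF_eq]
  by_cases hx : 0 ≤ x
  · simp [hx]
  · simp [hx]

theorem lintegral_expMeasure_one {f : ℝ → ENNReal} (hf : Measurable f) :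
    ∫⁻ x, f x ∂expMeasure 1 = ∫⁻ x in Ioi 0, ENNReal.ofReal (Real.exp (-x)) * f x := by
  rw [expMeasure_one_eq, lintegral_withDensity_eq_lintegral_mul _ (by fun_prop) hf]
  rfl

theorem integral_expMeasure_one (f : ℝ → ℝ) :
    ∫ x, f x ∂expMeasure 1 = ∫ x in Ioi 0, Real.exp (-x) * f x := by
  rw [expMeasure_one_eq, integral_withDensity_eq_integral_toReal_smul (by fun_prop) (by simp)]
  refine integral_congr_ae (Eventually.of_forall fun x => ?_)
  simp [ENNReal.toReal_ofReal (Real.exp_pos _).le]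

theorem integral_expMeasure_one_comp_div {c : ℝ} (hc : 0 < c) (f : ℝ → ℝ) :
    ∫ x, f (x / c) ∂expMeasure 1 = ∫ x in Ioi 0, c * Real.exp (-(c * x)) * f x := by
  rw [integral_expMeasure_one]
  have h := integral_comp_mul_left_Ioi (fun x => Real.exp (-x) * f (x / c)) 0 hc
  simp only [mul_zero, smul_eq_mul] at h
  have h2 : ∫ x in Ioi 0, Real.exp (-x) * f (x / c)
      = c * ∫ x in Ioi 0, Real.exp (-(c * x)) * f (c * x / c) := by
    rw [h]; field_simp
  rw [h2, ← integral_const_mul]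
  refine integral_congr_ae (Eventually.of_forall fun x => ?_)
  simp only
  rw [mul_div_cancel_left₀ _ hc.ne']
  ring

theorem expMeasure_one_Iic_zero : expMeasure 1 (Iic 0) = 0 := by
  rw [expMeasure_one_eq, withDensity_apply _ measurableSet_Iic,
    Measure.restrict_restrict measurableSet_Iic]
  simp [show Iic (0 : ℝ) ∩ Ioi 0 = ∅ by ext; simp]

theorem ae_expMeasure_one_pos : ∀ᵐ x ∂expMeasure 1, 0 < x := by
  rw [ae_iff]
  simpa [Iic] using expMeasure_one_Iic_zero

theorem expMeasure_one_Ioi {x : ℝ} (hx : 0 ≤ x) :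
    expMeasure 1 (Ioi x) = ENNReal.ofReal (Real.exp (-x)) := by
  rw [expMeasure_one_eq, withDensity_apply _ measurableSet_Ioi,
    Measure.restrict_restrict measurableSet_Ioi,
    inter_eq_left.2 (Ioi_subset_Ioi hx), ← ofReal_integral_eq_lintegral_ofReal]
  · rw [integral_exp_neg_Ioi]
  · exact integrableOn_exp_neg_Ioi x
  · exact Eventually.of_forall fun _ => (Real.exp_pos _).le

theorem lintegral_expMeasure_one_sq :
    ∫⁻ x, ENNReal.ofReal ((1 + x) ^ 2) ∂expMeasure 1 = 5 := by
  rw [lintegral_expMeasure_one (by fun_prop)]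
  have hG : ∀ n : ℕ, ∫ x in Ioi (0 : ℝ), Real.exp (-x) * x ^ n = n.factorial := by
    intro n
    rw [← Real.Gamma_nat_eq_factorial, Real.Gamma_eq_integral (by positivity)]
    refine setIntegral_congr_fun measurableSet_Ioi fun x hx => ?_
    simp
  have hI : ∀ n : ℕ, IntegrableOn (fun x => Real.exp (-x) * x ^ n) (Ioi (0 : ℝ)) := by
    intro n
    by_contra h
    have h2 := hG n
    rw [integral_undef h] at h2
    have := Nat.factorial_ne_zero n
    exact this (by exact_mod_cast h2.symm)
  have h5 : ∫ x in Ioi (0 : ℝ), Real.exp (-x) * (1 + x) ^ 2 = 5 := by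
    have : ∀ x : ℝ, Real.exp (-x) * (1 + x) ^ 2 = Real.exp (-x) * x ^ 0
        + 2 * (Real.exp (-x) * x ^ 1) + Real.exp (-x) * x ^ 2 := fun x => by ring
    simp_rw [this]
    rw [integral_add, integral_add, integral_const_mul, hG, hG, hG]
    · norm_num [Nat.factorial]
    · exact hI 0
    · exact (hI 1).const_mul 2
    · exact (hI 0).add ((hI 1).const_mul 2)
    · exact hI 2
  have hi : IntegrableOn (fun x => Real.exp (-x) * (1 + x) ^ 2) (Ioi (0 : ℝ)) := by
    by_contra h
    rw [integral_undef h] at h5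
    norm_num at h5
  have := ofReal_integral_eq_lintegral_ofReal hi
    (Eventually.of_forall fun x => mul_nonneg (Real.exp_pos _).le (sq_nonneg _))
  rw [h5] at this
  rw [show (5 : ENNReal) = ENNReal.ofReal 5 by simp, this]
  refine lintegral_congr fun x => ?_
  rw [ENNReal.ofReal_mul (Real.exp_pos _).le]

/-- The mean of `(1 + x - ξ)⁺`-type residual: the one-step decrement used for counting arrivals. -/
theorem lintegral_expMeasure_one_residual {x : ℝ} (hx : 0 ≤ x) :
    ∫⁻ y, (if y ≤ x then ENNReal.ofReal (1 + x - y) else 0) ∂expMeasure 1 = ENNReal.ofReal x := by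
  rw [lintegral_expMeasure_one (Measurable.ite measurableSet_Iic (by fun_prop) (by fun_prop))]
  have h1 : ∀ y : ℝ, ENNReal.ofReal (Real.exp (-y)) *
      (if y ≤ x then ENNReal.ofReal (1 + x - y) else 0)
      = (Iic x).indicator (fun y => ENNReal.ofReal (Real.exp (-y) * (1 + x - y))) y := by
    intro y
    by_cases hy : y ≤ x
    · simp [hy, ENNReal.ofReal_mul (Real.exp_pos _).le]
    · simp [hy]
  rw [lintegral_congr h1, lintegral_indicator measurableSet_Iic, Measure.restrict_restrict measurableSet_Iic,
    show Iic x ∩ Ioi 0 = Ioc 0 x by ext; simp [and_comm],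
    ← ofReal_integral_eq_lintegral_ofReal]
  · rw [← intervalIntegral.integral_of_le hx]
    congr 1
    have hd : ∀ y ∈ uIcc 0 x, HasDerivAt (fun y => -Real.exp (-y) * (x - y))
        (Real.exp (-y) * (1 + x - y)) y := by
      intro y _
      have h2 : HasDerivAt (fun y : ℝ => Real.exp (-y)) (Real.exp (-y) * (-1)) y :=
        (hasDerivAt_neg y).exp
      have h3 : HasDerivAt (fun y : ℝ => x - y) (-1) y := by
        simpa using (hasDerivAt_id y).const_sub x
      refine (h2.neg.mul h3).congr_deriv ?_
      simp only [Pi.neg_apply]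
      ring
    rw [intervalIntegral.integral_eq_sub_of_hasDerivAt hd]
    · simp
    · exact Continuous.intervalIntegrable (by fun_prop) _ _
  · exact (Continuous.integrableOn_Icc (by fun_prop)).mono_set Ioc_subset_Icc_self
  · refine (ae_restrict_iff' measurableSet_Ioc).2 (Eventually.of_forall fun y hy => ?_)
    exact mul_nonneg (Real.exp_pos _).le (by linarith [hy.2])

/-! ### Functions of the past are independent of the next coordinate -/

theorem lintegral_infinitePi_past {X : Type*} [MeasurableSpace X] (q : Measure X)
    [IsProbabilityMeasure q] (m : ℕ) {Y : Type*} [MeasurableSpace Y] {Z : (ℕ → X) → Y}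
    (hZm : Measurable Z) (hZ : ∀ y y' : ℕ → X, (∀ j < m, y j = y' j) → Z y = Z y')
    {G : Y × X → ENNReal} (hG : Measurable G) :
    ∫⁻ y, G (Z y, y m) ∂(Measure.infinitePi fun _ : ℕ => q)
      = ∫⁻ y, ∫⁻ x, G (Z y, x) ∂q ∂(Measure.infinitePi fun _ : ℕ => q) := by
  set P := Measure.infinitePi fun _ : ℕ => q with hP
  have hind : iIndepFun (fun (i : ℕ) (y : ℕ → X) => y i) P :=
    iIndepFun_infinitePi (X := fun _ x => x) (fun _ => measurable_id)
  have h1 := hind.indepFun_finset (Finset.range m) {m} (by simp) (fun i => measurable_pi_apply i)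
  obtain ⟨x₀⟩ : Nonempty X := q.nonempty_of_neZero
  -- Filling the coordinates from `m` on with a fixed point makes `Z` a measurable function of the
  -- first `m` coordinates alone.
  let ext : (Finset.range m → X) → ℕ → X := fun r j =>
    if h : j ∈ Finset.range m then r ⟨j, h⟩ else x₀
  have hext : Measurable ext := by
    refine measurable_pi_lambda _ fun j => ?_
    by_cases h : j ∈ Finset.range m
    · simp only [ext, h, dif_pos]
      exact measurable_pi_apply _
    · simp only [ext, h, dif_neg, not_false_eq_true]
      exact measurable_const
  have hp : Measurable fun r : ({m} : Finset ℕ) → X => r ⟨m, Finset.mem_singleton_self m⟩ :=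
    measurable_pi_apply _
  have h2 : IndepFun Z (fun y => y m) P := by
    have h3 := h1.comp (φ := fun r => Z (ext r))
      (ψ := fun r : (({m} : Finset ℕ) → X) => r ⟨m, Finset.mem_singleton_self m⟩)
      (hZm.comp hext) hp
    have h4 : (fun r => Z (ext r)) ∘ (fun (y : ℕ → X) (i : Finset.range m) => y i) = Z := by
      funext y
      refine hZ _ _ fun j hj => ?_
      simp [ext, hj]
    rw [h4] at h3
    exact h3
  have h5 := h2.map_prod_eq_prod_map_map hZm.aemeasurable (measurable_pi_apply m).aemeasurable
  have h6 : P.map (fun y => y m) = q := Measure.infinitePi_map_eval _ m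
  rw [h6] at h5
  calc ∫⁻ y, G (Z y, y m) ∂P = ∫⁻ p, G p ∂(P.map fun y => (Z y, y m)) := by
        rw [lintegral_map hG (hZm.prodMk (measurable_pi_apply m))]
    _ = ∫⁻ z, ∫⁻ x, G (z, x) ∂q ∂(P.map Z) := by
        rw [h5, lintegral_prod _ hG.aemeasurable]
    _ = _ := by rw [lintegral_map hG.lintegral_prod_right' hZm]

/-! ### Processes with deterministic motion between the points of a Poisson process -/

section Chain

variable {F Θ : Type*} {φ : ℝ → F → F} {J : ℝ → F → Θ → F} {c : ℝ}

/-- The time of the `m`-th point. -/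
noncomputable def arrivalTime (c : ℝ) (ω : F × (ℕ → ℝ × Θ)) (m : ℕ) : ℝ := epoch c (fun j => (ω.2 j).1) m

/-- The state right after the `m`-th point of a process which follows `φ` between the points and
jumps at a point at time `s` with mark `θ` from `z` to `J s z θ`. -/
noncomputable def chainState (φ : ℝ → F → F) (J : ℝ → F → Θ → F) (c : ℝ) (ω : F × (ℕ → ℝ × Θ)) : ℕ → F
  | 0 => ω.1
  | m + 1 => J (arrivalTime c ω (m + 1)) (φ ((ω.2 m).1 / c) (chainState φ J c ω m)) (ω.2 m).2

/-- The state at time `t`. -/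
noncomputable def stateAt (φ : ℝ → F → F) (J : ℝ → F → Θ → F) (c : ℝ) (ω : F × (ℕ → ℝ × Θ)) (t : ℝ) : F :=
  let m := arrivalCount c (fun j => (ω.2 j).1) t
  φ (t - arrivalTime c ω m) (chainState φ J c ω m)

theorem arrivalTime_zero (ω : F × (ℕ → ℝ × Θ)) : arrivalTime c ω 0 = 0 := by
  simp [arrivalTime, epoch]

theorem arrivalTime_succ (ω : F × (ℕ → ℝ × Θ)) (m : ℕ) :
    arrivalTime c ω (m + 1) = arrivalTime c ω m + (ω.2 m).1 / c := by
  simp [arrivalTime, epoch, Finset.sum_range_succ, add_div]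

theorem arrivalTime_congr (x : F) {y y' : ℕ → ℝ × Θ} {m : ℕ} (h : ∀ j < m, y j = y' j) :
    arrivalTime c (x, y) m = arrivalTime c (x, y') m := by
  unfold arrivalTime epoch
  congr 1
  exact Finset.sum_congr rfl fun j hj => by simp [h j (Finset.mem_range.1 hj)]

theorem chainState_congr (x : F) {y y' : ℕ → ℝ × Θ} {m : ℕ} (h : ∀ j < m, y j = y' j) :
    chainState φ J c (x, y) m = chainState φ J c (x, y') m := by
  induction m with
  | zero => rfl
  | succ m ih =>
    simp only [chainState]
    rw [arrivalTime_congr x h, ih fun j hj => h j (hj.trans m.lt_succ_self), h m m.lt_succ_self]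

theorem arrivalTime_mono (hc : 0 < c) {ω : F × (ℕ → ℝ × Θ)} (h : ∀ j, 0 < (ω.2 j).1) :
    StrictMono (arrivalTime c ω) := by
  refine strictMono_nat_of_lt_succ fun m => ?_
  rw [arrivalTime_succ]
  have := div_pos (h m) hc
  linarith

theorem arrivalTime_nonneg (hc : 0 < c) {ω : F × (ℕ → ℝ × Θ)} (h : ∀ j, 0 < (ω.2 j).1) (m : ℕ) :
    0 ≤ arrivalTime c ω m := by
  have := (arrivalTime_mono hc h).monotone (Nat.zero_le m)
  rwa [arrivalTime_zero] at this

theorem arrivalCount_eq (hc : 0 < c) {ω : F × (ℕ → ℝ × Θ)} (h : ∀ j, 0 < (ω.2 j).1) {t : ℝ} {m : ℕ}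
    (h1 : arrivalTime c ω m ≤ t) (h2 : t < arrivalTime c ω (m + 1)) :
    arrivalCount c (fun j => (ω.2 j).1) t = m := by
  have : {k : ℕ | epoch c (fun j => (ω.2 j).1) (k + 1) ≤ t} = Finset.range m := by
    ext k
    simp only [mem_ofPred_eq, Finset.coe_range, mem_Iio]
    change arrivalTime c ω (k + 1) ≤ t ↔ _
    constructor
    · intro hk
      by_contra hkm
      have := (arrivalTime_mono hc h).monotone (show m + 1 ≤ k + 1 by omega)
      linarith
    · intro hk
      exact ((arrivalTime_mono hc h).monotone (show k + 1 ≤ m by omega)).trans h1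
  rw [arrivalCount, this, ncard_coe_finset, Finset.card_range]

theorem existsUnique_arrivalTime {ω : F × (ℕ → ℝ × Θ)}
    {t : ℝ} (ht : 0 ≤ t) (h2 : ∃ m, t < arrivalTime c ω m) :
    ∃ m, arrivalTime c ω m ≤ t ∧ t < arrivalTime c ω (m + 1) := by
  classical
  have h0 : Nat.find h2 ≠ 0 := by
    intro h0
    have := Nat.find_spec h2
    rw [h0, arrivalTime_zero] at this
    linarith
  obtain ⟨k, hk⟩ := Nat.exists_eq_succ_of_ne_zero h0
  refine ⟨k, ?_, ?_⟩
  · exact not_lt.1 (Nat.find_min h2 (show k < Nat.find h2 by omega))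
  · have := Nat.find_spec h2
    rwa [hk] at this

/-- Turns a count into a series of indicators, from which measurability of `arrivalCount` can be
read off. For infinite `S` both sides are `0`, since `ENNReal.toReal ⊤ = 0`. -/
theorem ncard_eq_floor_tsum (S : Set ℕ) :
    S.ncard = ⌊(∑' m, S.indicator (1 : ℕ → ENNReal) m).toReal⌋₊ := by
  rw [← tsum_subtype S (1 : ℕ → ENNReal)]
  simp only [Pi.one_apply, ENNReal.tsum_set_one]
  by_cases h : S.Finite
  · rw [← h.cast_ncard_eq]
    simp
  · rw [(show S.Infinite from h).encard_eq, (show S.Infinite from h).ncard]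
    simp

variable [MeasurableSpace F] [MeasurableSpace Θ]

/-- The law of the driving data, with i.i.d. exponential times and marks of law `Q`. -/
noncomputable def drivingLaw (μ : Measure F) (Q : Measure Θ) [IsProbabilityMeasure Q] :
    Measure (F × (ℕ → ℝ × Θ)) :=
  μ.prod (Measure.infinitePi fun _ : ℕ => (expMeasure 1).prod Q)

instance (μ : Measure F) [IsProbabilityMeasure μ] (Q : Measure Θ) [IsProbabilityMeasure Q] :
    IsProbabilityMeasure (drivingLaw μ Q) := by
  unfold drivingLaw; infer_instance

@[fun_prop]
theorem measurable_arrivalTime (m : ℕ) :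
    Measurable fun ω : F × (ℕ → ℝ × Θ) => arrivalTime c ω m := by
  unfold arrivalTime epoch
  fun_prop

theorem measurable_chainState (hφ : Measurable fun p : ℝ × F => φ p.1 p.2)
    (hJ : Measurable fun p : ℝ × F × Θ => J p.1 p.2.1 p.2.2) (m : ℕ) :
    Measurable fun ω : F × (ℕ → ℝ × Θ) => chainState φ J c ω m := by
  induction m with
  | zero => exact measurable_fst
  | succ m ih =>
    have h1 : Measurable fun ω : F × (ℕ → ℝ × Θ) => φ ((ω.2 m).1 / c) (chainState φ J c ω m) :=
      hφ.comp (Measurable.prodMk (by fun_prop) ih)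
    exact hJ.comp (Measurable.prodMk (measurable_arrivalTime (m + 1))
      (Measurable.prodMk h1 (by fun_prop)))

/-- The Markov property at the points: time and state at the `m`-th point are functions of the
initial state and the first `m` coordinates, so the next waiting time and mark can be integrated out
as a fresh independent pair. -/
theorem lintegral_chain (hφ : Measurable fun p : ℝ × F => φ p.1 p.2)
    (hJ : Measurable fun p : ℝ × F × Θ => J p.1 p.2.1 p.2.2) (μ : Measure F) [SFinite μ]
    (Q : Measure Θ) [IsProbabilityMeasure Q] (m : ℕ)
    {G : (ℝ × F) × (ℝ × Θ) → ENNReal} (hG : Measurable G) :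
    ∫⁻ ω, G ((arrivalTime c ω m, chainState φ J c ω m), ω.2 m) ∂(drivingLaw μ Q)
      = ∫⁻ ω, ∫⁻ w, G ((arrivalTime c ω m, chainState φ J c ω m), w) ∂((expMeasure 1).prod Q)
        ∂(drivingLaw μ Q) := by
  have hZ : Measurable fun ω : F × (ℕ → ℝ × Θ) => (arrivalTime c ω m, chainState φ J c ω m) :=
    (measurable_arrivalTime m).prodMk (measurable_chainState hφ hJ m)
  unfold drivingLaw
  rw [lintegral_prod, lintegral_prod]
  · refine lintegral_congr fun x => ?_
    exact lintegral_infinitePi_past ((expMeasure 1).prod Q) m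
      (Z := fun y => (arrivalTime c (x, y) m, chainState φ J c (x, y) m))
      (hZ.comp measurable_prodMk_left)
      (fun y y' h => by rw [arrivalTime_congr x h, chainState_congr x h]) hG
  · exact (hG.lintegral_prod_right'.comp hZ).aemeasurable
  · exact (hG.comp (hZ.prodMk (by fun_prop))).aemeasurable

/-! ### The number of points -/

theorem ae_interarrival_pos (μ : Measure F) [SFinite μ] (Q : Measure Θ) [IsProbabilityMeasure Q] :
    ∀ᵐ ω ∂(drivingLaw μ Q), ∀ j, 0 < (ω.2 j).1 := by
  rw [ae_all_iff]
  intro j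
  have h1 : ∀ᵐ w ∂((expMeasure 1).prod Q), 0 < w.1 :=
    Measure.quasiMeasurePreserving_fst.ae ae_expMeasure_one_pos
  have h2 : ∀ᵐ y ∂(Measure.infinitePi fun _ : ℕ => (expMeasure 1).prod Q), 0 < (y j).1 := by
    have := (measurePreserving_eval_infinitePi (fun _ : ℕ => (expMeasure 1).prod Q) j)
    exact this.quasiMeasurePreserving.ae h1
  exact Measure.quasiMeasurePreserving_snd.ae h2

/-- The expected number of points in `[0, t]`, counting also time `0`, is at most `1 + c t`. -/
theorem tsum_arrivalTime_le (hφ : Measurable fun p : ℝ × F => φ p.1 p.2)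
    (hJ : Measurable fun p : ℝ × F × Θ => J p.1 p.2.1 p.2.2) (hc : 0 < c)
    (μ : Measure F) [IsProbabilityMeasure μ]
    (Q : Measure Θ) [IsProbabilityMeasure Q] {t : ℝ} (ht : 0 ≤ t) :
    ∑' m, drivingLaw μ Q {ω | arrivalTime c ω m ≤ t} ≤ ENNReal.ofReal (1 + c * t) := by
  set P := drivingLaw μ Q with hP
  -- From a point at time `τ ≤ t`, the expected number of points up to `t`, this one included, is `1
  -- + c (t - τ)`. Passing to the next point lowers its expectation by exactly the probability that
  -- the current point lies in `[0, t]`, so the sum telescopes.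
  let α : ℕ → ENNReal := fun m =>
    ∫⁻ ω, (if arrivalTime c ω m ≤ t then ENNReal.ofReal (1 + c * (t - arrivalTime c ω m)) else 0) ∂P
  have hstep : ∀ m, α (m + 1) + P {ω | arrivalTime c ω m ≤ t} = α m := by
    intro m
    have hm : MeasurableSet {ω : F × (ℕ → ℝ × Θ) | arrivalTime c ω m ≤ t} :=
      measurableSet_le (measurable_arrivalTime m) measurable_const
    let G : (ℝ × F) × (ℝ × Θ) → ENNReal := fun p =>
      if p.1.1 + p.2.1 / c ≤ t then ENNReal.ofReal (1 + c * (t - (p.1.1 + p.2.1 / c))) else 0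
    have hG : Measurable G := by
      refine Measurable.ite (measurableSet_le (by fun_prop) (by fun_prop)) (by fun_prop)
        (by fun_prop)
    have h1 : α (m + 1) = ∫⁻ ω, ∫⁻ w, G ((arrivalTime c ω m, chainState φ J c ω m), w)
        ∂((expMeasure 1).prod Q) ∂P := by
      rw [← lintegral_chain hφ hJ μ Q m hG]
      simp only [α, G, arrivalTime_succ, ← hP]
    have h2 : ∀ τ z, ∫⁻ w, G ((τ, z), w) ∂((expMeasure 1).prod Q)
        = if τ ≤ t then ENNReal.ofReal (c * (t - τ)) else 0 := by
      intro τ z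
      have h3 : ∫⁻ w, G ((τ, z), w) ∂((expMeasure 1).prod Q)
          = ∫⁻ y, (if y ≤ c * (t - τ) then ENNReal.ofReal (1 + c * (t - τ) - y) else 0)
            ∂expMeasure 1 := by
        rw [lintegral_prod (fun w => G ((τ, z), w)) (hG.comp measurable_prodMk_left).aemeasurable]
        refine lintegral_congr fun y => ?_
        simp only [G, lintegral_const, measure_univ, mul_one]
        have e1 : τ + y / c ≤ t ↔ y ≤ c * (t - τ) := by
          rw [← le_sub_iff_add_le', div_le_iff₀ hc, mul_comm]
        have e2 : 1 + c * (t - (τ + y / c)) = 1 + c * (t - τ) - y := by field_simp; ring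
        rw [e2]
        by_cases h : y ≤ c * (t - τ)
        · rw [if_pos h, if_pos (e1.2 h)]
        · rw [if_neg h, if_neg (mt e1.1 h)]
      rw [h3]
      split_ifs with h
      · exact lintegral_expMeasure_one_residual (mul_nonneg hc.le (by linarith))
      · rw [lintegral_eq_zero_iff' (Measurable.ite measurableSet_Iic (by fun_prop)
          (by fun_prop)).aemeasurable]
        filter_upwards [ae_expMeasure_one_pos] with y hy
        rw [if_neg]
        · rfl
        · intro h4
          nlinarith [not_le.1 h]
    rw [h1, ← lintegral_indicator_one hm, ← lintegral_add_right _ (measurable_one.indicator hm)]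
    refine lintegral_congr fun ω => ?_
    rw [h2]
    by_cases h : arrivalTime c ω m ≤ t
    · simp only [h, if_true, indicator, mem_ofPred_eq, Pi.one_apply]
      rw [add_comm 1, ENNReal.ofReal_add (mul_nonneg hc.le (by linarith)) zero_le_one]
      simp
    · simp [h, indicator]
  have h0 : α 0 = ENNReal.ofReal (1 + c * t) := by
    simp [α, arrivalTime_zero, ht]
  refine ENNReal.tsum_le_of_sum_range_le fun n => ?_
  have : α n + ∑ m ∈ Finset.range n, P {ω | arrivalTime c ω m ≤ t} = α 0 := by
    induction n with
    | zero => simp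
    | succ n ih => rw [Finset.sum_range_succ, ← ih, ← hstep n]; ring
  rw [← h0, ← this]
  exact le_add_self

theorem ae_exists_lt_arrivalTime (hφ : Measurable fun p : ℝ × F => φ p.1 p.2)
    (hJ : Measurable fun p : ℝ × F × Θ => J p.1 p.2.1 p.2.2) (hc : 0 < c)
    (μ : Measure F) [IsProbabilityMeasure μ]
    (Q : Measure Θ) [IsProbabilityMeasure Q] {t : ℝ} (ht : 0 ≤ t) :
    ∀ᵐ ω ∂(drivingLaw μ Q), ∃ m, t < arrivalTime c ω m := by
  have h := (tsum_arrivalTime_le hφ hJ hc μ Q ht).trans_lt ENNReal.ofReal_lt_top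
  have h3 := ae_eventually_notMem h.ne
  filter_upwards [h3] with ω hω
  obtain ⟨m, hm⟩ := hω.exists
  exact ⟨m, by simpa using hm⟩

@[fun_prop]
theorem measurable_arrivalCount :
    Measurable fun p : (F × (ℕ → ℝ × Θ)) × ℝ => arrivalCount c (fun j => (p.1.2 j).1) p.2 := by
  unfold arrivalCount
  simp_rw [ncard_eq_floor_tsum]
  refine Nat.measurable_floor.comp (ENNReal.measurable_toReal.comp (Measurable.tsum fun m => ?_))
  have h : MeasurableSet {p : (F × (ℕ → ℝ × Θ)) × ℝ | arrivalTime c p.1 (m + 1) ≤ p.2} :=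
    measurableSet_le ((measurable_arrivalTime (m + 1)).comp measurable_fst) measurable_snd
  exact (measurable_one (α := ENNReal)).indicator h

theorem measurable_stateAt (hφ : Measurable fun p : ℝ × F => φ p.1 p.2)
    (hJ : Measurable fun p : ℝ × F × Θ => J p.1 p.2.1 p.2.2) :
    Measurable fun p : (F × (ℕ → ℝ × Θ)) × ℝ => stateAt φ J c p.1 p.2 := by
  have h1 : Measurable fun r : ((F × (ℕ → ℝ × Θ)) × ℝ) × ℕ =>
      φ (r.1.2 - arrivalTime c r.1.1 r.2) (chainState φ J c r.1.1 r.2) := by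
    refine measurable_from_prod_countable_left fun m => ?_
    refine hφ.comp (Measurable.prodMk ?_ ?_)
    · exact measurable_snd.sub ((measurable_arrivalTime m).comp measurable_fst)
    · exact (measurable_chainState hφ hJ m).comp measurable_fst
  exact h1.comp (measurable_id.prodMk measurable_arrivalCount)

end Chain

/-! ### Comparison of expectations over one step, summed over all points. -/

section Chain

variable {F Θ : Type*} {φ : ℝ → F → F} {J : ℝ → F → Θ → F} {c : ℝ}

/-- The value of `Ψ` at the point following a point at time `τ` with state `z` after it, or at
time `t` if the next point comes after time `t`. -/
noncomputable def nextValue {β : Type*} (φ : ℝ → F → F) (J : ℝ → F → Θ → F) (c : ℝ)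
    (Ψ : ℝ → F → β) (t τ : ℝ) (z : F) (w : ℝ × Θ) : β :=
  if τ + w.1 / c ≤ t then Ψ (τ + w.1 / c) (J (τ + w.1 / c) (φ (w.1 / c) z) w.2)
  else Ψ t (φ (t - τ) z)

variable [MeasurableSpace F] [MeasurableSpace Θ]

theorem measurable_nextValue {β : Type*} [MeasurableSpace β]
    (hφ : Measurable fun p : ℝ × F => φ p.1 p.2)
    (hJ : Measurable fun p : ℝ × F × Θ => J p.1 p.2.1 p.2.2) {Ψ : ℝ → F → β}
    (hΨ : Measurable fun p : ℝ × F => Ψ p.1 p.2) (t : ℝ) :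
    Measurable fun p : (ℝ × F) × (ℝ × Θ) => nextValue φ J c Ψ t p.1.1 p.1.2 p.2 := by
  have h1 : Measurable fun p : (ℝ × F) × (ℝ × Θ) => φ (p.2.1 / c) p.1.2 :=
    hφ.comp (Measurable.prodMk (by fun_prop) (by fun_prop))
  have h2 : Measurable fun p : (ℝ × F) × (ℝ × Θ) => φ (t - p.1.1) p.1.2 :=
    hφ.comp (Measurable.prodMk (by fun_prop) (by fun_prop))
  have h3 : Measurable fun p : (ℝ × F) × (ℝ × Θ) =>
      J (p.1.1 + p.2.1 / c) (φ (p.2.1 / c) p.1.2) p.2.2 :=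
    hJ.comp (Measurable.prodMk (by fun_prop) (Measurable.prodMk h1 (by fun_prop)))
  exact Measurable.ite (measurableSet_le (by fun_prop) measurable_const)
    (hΨ.comp (Measurable.prodMk (by fun_prop) h3)) (hΨ.comp (Measurable.prodMk (by fun_prop) h2))

variable (hφ : Measurable fun p : ℝ × F => φ p.1 p.2)
  (hJ : Measurable fun p : ℝ × F × Θ => J p.1 p.2.1 p.2.2) (hc : 0 < c)
  (μ : Measure F) [IsProbabilityMeasure μ] (Q : Measure Θ) [IsProbabilityMeasure Q]

include hφ hJ hc

theorem ae_stateAt_eq {t : ℝ} (ht : 0 ≤ t) :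
    ∀ᵐ ω ∂(drivingLaw μ Q), ∃ m, arrivalTime c ω m ≤ t ∧ t < arrivalTime c ω (m + 1) ∧
      stateAt φ J c ω t = φ (t - arrivalTime c ω m) (chainState φ J c ω m) ∧
      ∀ k, arrivalTime c ω k ≤ t ∧ t < arrivalTime c ω (k + 1) → k = m := by
  filter_upwards [ae_interarrival_pos μ Q, ae_exists_lt_arrivalTime hφ hJ hc μ Q ht] with ω h1 h2
  obtain ⟨m, hm1, hm2⟩ := existsUnique_arrivalTime ht h2
  have hm := arrivalCount_eq hc h1 hm1 hm2
  refine ⟨m, hm1, hm2, ?_, fun k hk => ?_⟩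
  · simp only [stateAt, hm]
  · rw [← arrivalCount_eq hc h1 hk.1 hk.2, hm]

/-- Almost surely exactly one of the intervals between consecutive points contains `t`, so the sum
has a single nonzero term. -/
theorem lintegral_stateAt {t : ℝ} (ht : 0 ≤ t) {H : F → ENNReal} (hH : Measurable H) :
    ∫⁻ ω, H (stateAt φ J c ω t) ∂(drivingLaw μ Q)
      = ∑' m, ∫⁻ ω, (if arrivalTime c ω m ≤ t ∧ t < arrivalTime c ω (m + 1) then
          H (φ (t - arrivalTime c ω m) (chainState φ J c ω m)) else 0) ∂(drivingLaw μ Q) := by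
  rw [← lintegral_tsum]
  · refine lintegral_congr_ae ?_
    filter_upwards [ae_stateAt_eq hφ hJ hc μ Q ht] with ω ⟨m, h1, h2, h3, h4⟩
    rw [tsum_eq_single m, if_pos ⟨h1, h2⟩, h3]
    intro k hk
    rw [if_neg (mt (h4 k) hk)]
  · intro m
    refine (Measurable.ite ?_ (hH.comp (hφ.comp (Measurable.prodMk (by fun_prop)
      (measurable_chainState hφ hJ m)))) measurable_const).aemeasurable
    exact (measurableSet_le (measurable_arrivalTime m) measurable_const).inter
      (measurableSet_lt measurable_const (measurable_arrivalTime (m + 1)))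

/-- If the expected value of `Ψ` grows by at most `d` in each step, then the expected value of
`Ψ` at time `t` is bounded by the initial one and the total expected growth. -/
theorem lintegral_stateAt_le {t : ℝ} (ht : 0 ≤ t) {Ψ d : ℝ → F → ENNReal}
    (hΨ : Measurable fun p : ℝ × F => Ψ p.1 p.2)
    (hstep : ∀ τ z, 0 ≤ τ → τ ≤ t →
      ∫⁻ w, nextValue φ J c Ψ t τ z w ∂((expMeasure 1).prod Q) ≤ Ψ τ z + d τ z) :
    ∫⁻ ω, Ψ t (stateAt φ J c ω t) ∂(drivingLaw μ Q) ≤ ∫⁻ z, Ψ 0 z ∂μ +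
      ∑' m, ∫⁻ ω, (if arrivalTime c ω m ≤ t then d (arrivalTime c ω m) (chainState φ J c ω m)
        else 0) ∂(drivingLaw μ Q) := by
  set P := drivingLaw μ Q with hP
  have hZ : ∀ m, Measurable fun ω : F × (ℕ → ℝ × Θ) => (arrivalTime c ω m, chainState φ J c ω m) :=
    fun m => (measurable_arrivalTime m).prodMk (measurable_chainState hφ hJ m)
  have hτ : ∀ m, MeasurableSet {ω : F × (ℕ → ℝ × Θ) | arrivalTime c ω m ≤ t} := fun m =>
    measurableSet_le (measurable_arrivalTime m) measurable_const
  -- `a m` collects the paths whose `m`-th point comes before `t`, `b m` those for which `t` falls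
  -- right after the `m`-th point, and `e m` is the allowed growth. One step gives `a (m + 1) + b m
  -- ≤ a m + e m`, which telescopes; the sum of the `b m` is the expectation at time `t`.
  let a : ℕ → ENNReal := fun m => ∫⁻ ω, (if arrivalTime c ω m ≤ t then
    Ψ (arrivalTime c ω m) (chainState φ J c ω m) else 0) ∂P
  let b : ℕ → ENNReal := fun m => ∫⁻ ω, (if arrivalTime c ω m ≤ t ∧ t < arrivalTime c ω (m + 1) then
    Ψ t (φ (t - arrivalTime c ω m) (chainState φ J c ω m)) else 0) ∂P
  let e : ℕ → ENNReal := fun m => ∫⁻ ω, (if arrivalTime c ω m ≤ t then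
    d (arrivalTime c ω m) (chainState φ J c ω m) else 0) ∂P
  have hstep' : ∀ m, a (m + 1) + b m ≤ a m + e m := by
    intro m
    let G : (ℝ × F) × (ℝ × Θ) → ENNReal := fun p =>
      if p.1.1 ≤ t then nextValue φ J c Ψ t p.1.1 p.1.2 p.2 else 0
    have hG : Measurable G := Measurable.ite (measurableSet_le (by fun_prop) measurable_const)
      (measurable_nextValue hφ hJ hΨ t) measurable_const
    calc a (m + 1) + b m
        = ∫⁻ ω, G ((arrivalTime c ω m, chainState φ J c ω m), ω.2 m) ∂P := by
          simp only [a, b]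
          rw [← lintegral_add_left]
          · refine lintegral_congr_ae ?_
            filter_upwards [ae_interarrival_pos μ Q] with ω hω
            have h1 := arrivalTime_mono hc hω (Nat.lt_succ_self m)
            simp only [Nat.succ_eq_add_one] at h1
            simp only [G, nextValue, chainState, ← arrivalTime_succ]
            by_cases h2 : arrivalTime c ω (m + 1) ≤ t
            · simp [h2, h1.le.trans h2, not_lt.2 h2]
            · by_cases h3 : arrivalTime c ω m ≤ t
              · simp [h2, h3, not_le.1 h2]
              · simp [h2, h3]
          · exact Measurable.ite (hτ (m + 1)) (hΨ.comp (hZ (m + 1))) measurable_const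
      _ = ∫⁻ ω, ∫⁻ w, G ((arrivalTime c ω m, chainState φ J c ω m), w)
            ∂((expMeasure 1).prod Q) ∂P := lintegral_chain hφ hJ μ Q m hG
      _ ≤ ∫⁻ ω, ((if arrivalTime c ω m ≤ t then
              Ψ (arrivalTime c ω m) (chainState φ J c ω m) else 0)
            + (if arrivalTime c ω m ≤ t then
              d (arrivalTime c ω m) (chainState φ J c ω m) else 0)) ∂P := by
          refine lintegral_mono_ae ?_
          filter_upwards [ae_interarrival_pos μ Q] with ω hω
          by_cases h : arrivalTime c ω m ≤ t
          · simp only [G, h, if_true]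
            exact hstep _ _ (arrivalTime_nonneg hc hω m) h
          · simp [G, h]
      _ = a m + e m := by
          rw [lintegral_add_left]
          exact Measurable.ite (hτ m) (hΨ.comp (hZ m)) measurable_const
  have hsum : ∀ n, a n + ∑ m ∈ Finset.range n, b m ≤ a 0 + ∑ m ∈ Finset.range n, e m := by
    intro n
    induction n with
    | zero => simp
    | succ n ih =>
      rw [Finset.sum_range_succ, Finset.sum_range_succ]
      calc a (n + 1) + (∑ m ∈ Finset.range n, b m + b n)
          = (a (n + 1) + b n) + ∑ m ∈ Finset.range n, b m := by ring
        _ ≤ (a n + e n) + ∑ m ∈ Finset.range n, b m := by gcongr ?_ + _; exact hstep' n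
        _ = (a n + ∑ m ∈ Finset.range n, b m) + e n := by ring
        _ ≤ (a 0 + ∑ m ∈ Finset.range n, e m) + e n := by gcongr
        _ = _ := by ring
  have ha0 : a 0 = ∫⁻ z, Ψ 0 z ∂μ := by
    simp only [a, arrivalTime_zero, ht, if_true, chainState, hP]
    have h0 : Measurable (Ψ 0) := hΨ.comp measurable_prodMk_left
    unfold drivingLaw
    rw [lintegral_prod (fun ω => Ψ 0 ω.1) (h0.comp measurable_fst).aemeasurable]
    simp
  rw [lintegral_stateAt hφ hJ hc μ Q ht (H := Ψ t) (hΨ.comp measurable_prodMk_left), ← ha0]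
  refine ENNReal.tsum_le_of_sum_range_le fun n => ?_
  calc ∑ m ∈ Finset.range n, b m ≤ a n + ∑ m ∈ Finset.range n, b m := le_add_self
    _ ≤ a 0 + ∑ m ∈ Finset.range n, e m := hsum n
    _ ≤ _ := by gcongr; exact ENNReal.sum_le_tsum _

/-- The expected time integral of `H` along the path, as a sum over the points. -/
theorem tsum_occupation_le {t : ℝ} {H : ℝ → F → ENNReal}
    (hH : Measurable fun p : ℝ × F => H p.1 p.2) :
    ∑' m, ∫⁻ ω, (if arrivalTime c ω m ≤ t then ∫⁻ x in Ioc 0 (t - arrivalTime c ω m),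
        ENNReal.ofReal (Real.exp (-(c * x))) *
          H (arrivalTime c ω m + x) (φ x (chainState φ J c ω m)) else 0) ∂(drivingLaw μ Q)
      ≤ ∫⁻ s in Ioc 0 t, ∫⁻ ω, H s (stateAt φ J c ω s) ∂(drivingLaw μ Q) := by
  set P := drivingLaw μ Q with hP
  -- Given the `m`-th point, the exponential factor is the conditional probability that no further
  -- point has occurred by time `s`.
  let K : ℕ → ℝ → F × (ℕ → ℝ × Θ) → ENNReal := fun m s ω =>
    if arrivalTime c ω m ≤ s then ENNReal.ofReal (Real.exp (-(c * (s - arrivalTime c ω m)))) *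
      H s (φ (s - arrivalTime c ω m) (chainState φ J c ω m)) else 0
  have hK : ∀ m, Measurable fun p : ℝ × (F × (ℕ → ℝ × Θ)) => K m p.1 p.2 := by
    intro m
    have h1 : Measurable fun p : ℝ × (F × (ℕ → ℝ × Θ)) => arrivalTime c p.2 m :=
      (measurable_arrivalTime m).comp measurable_snd
    have h2 : Measurable fun p : ℝ × (F × (ℕ → ℝ × Θ)) => chainState φ J c p.2 m :=
      (measurable_chainState hφ hJ m).comp measurable_snd
    refine Measurable.ite (measurableSet_le h1 measurable_fst) (Measurable.mul ?_ ?_)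
      measurable_const
    · fun_prop
    · exact hH.comp (measurable_fst.prodMk (hφ.comp (Measurable.prodMk
        (measurable_fst.sub h1) h2)))
  have hfix : ∀ s, 0 ≤ s → ∫⁻ ω, H s (stateAt φ J c ω s) ∂P = ∑' m, ∫⁻ ω, K m s ω ∂P := by
    intro s hs
    rw [lintegral_stateAt hφ hJ hc μ Q hs (H := H s) (hH.comp measurable_prodMk_left)]
    refine tsum_congr fun m => ?_
    let G : (ℝ × F) × (ℝ × Θ) → ENNReal := fun p =>
      if p.1.1 ≤ s ∧ s < p.1.1 + p.2.1 / c then H s (φ (s - p.1.1) p.1.2) else 0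
    have hG : Measurable G := by
      have h1 : MeasurableSet {p : (ℝ × F) × (ℝ × Θ) | p.1.1 ≤ s} :=
        measurableSet_le (by fun_prop) measurable_const
      have h2 : MeasurableSet {p : (ℝ × F) × (ℝ × Θ) | s < p.1.1 + p.2.1 / c} :=
        measurableSet_lt measurable_const (by fun_prop)
      refine Measurable.ite (h1.inter h2) ?_ measurable_const
      exact hH.comp (measurable_const.prodMk (hφ.comp (Measurable.prodMk (by fun_prop)
        (by fun_prop))))
    have h1 := lintegral_chain hφ hJ μ Q m (c := c) hG
    simp only [G, ← arrivalTime_succ] at h1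
    rw [h1]
    refine lintegral_congr fun ω => ?_
    simp only [K]
    by_cases h : arrivalTime c ω m ≤ s
    · simp only [h, true_and, if_true]
      set τ := arrivalTime c ω m
      set V := H s (φ (s - τ) (chainState φ J c ω m))
      have h2 : ∀ w : ℝ × Θ, (if s < τ + w.1 / c then V else 0)
          = (Ioi (c * (s - τ)) ×ˢ univ).indicator (fun _ => V) w := by
        intro w
        have : s < τ + w.1 / c ↔ c * (s - τ) < w.1 := by
          rw [← sub_lt_iff_lt_add', lt_div_iff₀ hc, mul_comm]
        simp only [indicator, mem_prod, mem_Ioi, mem_univ, and_true, this]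
      rw [lintegral_congr h2, lintegral_indicator_const (measurableSet_Ioi.prod MeasurableSet.univ),
        Measure.prod_prod, expMeasure_one_Ioi (mul_nonneg hc.le (by linarith)), measure_univ,
        mul_one, mul_comm]
    · simp [h]
  have hR : ∫⁻ s in Ioc 0 t, ∫⁻ ω, H s (stateAt φ J c ω s) ∂P
      = ∑' m, ∫⁻ ω, (∫⁻ s in Ioc 0 t, K m s ω) ∂P := by
    rw [setLIntegral_congr_fun measurableSet_Ioc fun s hs => hfix s hs.1.le, lintegral_tsum]
    · refine tsum_congr fun m => ?_
      exact lintegral_lintegral_swap (hK m).aemeasurable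
    · exact fun m => (hK m).lintegral_prod_right'.aemeasurable
  rw [hR]
  refine ENNReal.tsum_le_tsum fun m => lintegral_mono_ae ?_
  filter_upwards [ae_interarrival_pos μ Q] with ω hω
  have h0 := arrivalTime_nonneg hc hω m
  set τ := arrivalTime c ω m with hτ
  by_cases h : τ ≤ t
  · rw [if_pos h, ← lintegral_indicator measurableSet_Ioc, ← lintegral_indicator measurableSet_Ioc,
      ← lintegral_add_left_eq_self (fun s => (Ioc 0 t).indicator (fun s => K m s ω) s) τ]
    refine lintegral_mono fun x => ?_
    by_cases hx : x ∈ Ioc 0 (t - τ)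
    · have h1 : τ + x ∈ Ioc 0 t := ⟨by linarith [hx.1], by linarith [hx.2]⟩
      rw [indicator_of_mem hx, indicator_of_mem h1]
      simp only [K, ← hτ, add_sub_cancel_left, le_add_iff_nonneg_right, hx.1.le, if_true]
      exact le_rfl
    · rw [indicator_of_notMem hx]
      exact zero_le
  · rw [if_neg h]
    exact zero_le

end Chain

/-- A running gain `η` is collected until the waiting time `ξ / c` or the horizon `L`, and a jump
gain `j` at the waiting time if it comes before `L`. The waiting time exceeds `x` with probability
`exp (-(c * x))` and has density `c * exp (-(c * x))`, which combines both into one integral. -/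
theorem integral_expMeasure_one_step {c L M : ℝ} (hc : 0 < c) {η j : ℝ → ℝ}
    (hη : Measurable η) (hj : Measurable j) (hηM : ∀ x, |η x| ≤ M) (hjM : ∀ x, |j x| ≤ M) :
    ∫ ξ, ((∫ y in Ioc 0 L, if y < ξ / c then η y else 0) + if ξ / c ≤ L then j (ξ / c) else 0)
        ∂expMeasure 1
      = ∫ x in Ioc 0 L, Real.exp (-(c * x)) * (η x + c * j x) := by
  have hM : 0 ≤ M := (abs_nonneg _).trans (hηM 0)
  have hK : Measurable fun p : ℝ × ℝ => if p.2 < p.1 / c then η p.2 else 0 :=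
    Measurable.ite (measurableSet_lt (by fun_prop) (by fun_prop)) (by fun_prop) (by fun_prop)
  have hKM : ∀ p : ℝ × ℝ, ‖(if p.2 < p.1 / c then η p.2 else 0)‖ ≤ M := by
    intro p
    split_ifs
    · exact hηM _
    · simpa using hM
  have hKi : Integrable (fun p : ℝ × ℝ => if p.2 < p.1 / c then η p.2 else 0)
      ((expMeasure 1).prod (volume.restrict (Ioc 0 L))) :=
    Integrable.of_bound hK.aestronglyMeasurable M (Eventually.of_forall hKM)
  have hB : Measurable fun ξ : ℝ => if ξ / c ≤ L then j (ξ / c) else 0 :=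
    Measurable.ite (measurableSet_le (by fun_prop) (by fun_prop)) (by fun_prop) (by fun_prop)
  have hBi : Integrable (fun ξ : ℝ => if ξ / c ≤ L then j (ξ / c) else 0) (expMeasure 1) := by
    refine Integrable.of_bound hB.aestronglyMeasurable M (Eventually.of_forall fun ξ => ?_)
    split_ifs
    · exact hjM _
    · simpa using hM
  rw [integral_add hKi.integral_prod_left hBi]
  have h1 : ∫ ξ, (∫ y in Ioc 0 L, if y < ξ / c then η y else 0) ∂expMeasure 1
      = ∫ y in Ioc 0 L, Real.exp (-(c * y)) * η y := by
    rw [integral_integral_swap hKi]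
    refine setIntegral_congr_fun measurableSet_Ioc fun y hy => ?_
    have h2 : ∀ ξ : ℝ, (if y < ξ / c then η y else 0) = (Ioi (c * y)).indicator (fun _ => η y) ξ := by
      intro ξ
      simp only [indicator, mem_Ioi, lt_div_iff₀ hc, mul_comm c y]
    simp only [h2]
    rw [integral_indicator_const _ measurableSet_Ioi, Measure.real,
      expMeasure_one_Ioi (mul_nonneg hc.le hy.1.le), ENNReal.toReal_ofReal (Real.exp_pos _).le,
      smul_eq_mul]
  have h3 : ∫ ξ, (if ξ / c ≤ L then j (ξ / c) else 0) ∂expMeasure 1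
      = ∫ x in Ioc 0 L, Real.exp (-(c * x)) * (c * j x) := by
    rw [integral_expMeasure_one_comp_div hc (fun x => if x ≤ L then j x else 0),
      show Ioc 0 L = Ioi 0 ∩ Iic L by ext; simp, ← setIntegral_indicator measurableSet_Iic]
    refine integral_congr_ae (Eventually.of_forall fun x => ?_)
    simp only [indicator, mem_Iic]
    split_ifs <;> ring
  have hexp : ∀ {f : ℝ → ℝ}, Measurable f → ∀ M', (∀ x, |f x| ≤ M') →
      IntegrableOn (fun x => Real.exp (-(c * x)) * f x) (Ioc 0 L) := by
    intro f hf M' hM'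
    refine Integrable.of_bound (by fun_prop) M' ?_
    refine (ae_restrict_iff' measurableSet_Ioc).2 (Eventually.of_forall fun x hx => ?_)
    rw [norm_mul, Real.norm_eq_abs, Real.norm_eq_abs, abs_of_pos (Real.exp_pos _)]
    have : Real.exp (-(c * x)) ≤ 1 := Real.exp_le_one_iff.2 (by nlinarith [hx.1])
    calc Real.exp (-(c * x)) * |f x| ≤ 1 * M' :=
          mul_le_mul this (hM' x) (abs_nonneg _) zero_le_one
      _ = M' := one_mul _
  rw [h1, h3, ← integral_add (hexp hη M hηM) (hexp (hj.const_mul c) (c * M) fun x => by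
    rw [abs_mul, abs_of_pos hc]; exact mul_le_mul_of_nonneg_left (hjM x) hc.le)]
  refine integral_congr_ae (Eventually.of_forall fun x => ?_)
  simp only; ring

/-! ### A Dynkin-type inequality for real functions of the process. -/

section Chain

variable {F Θ : Type*} {φ : ℝ → F → F} {J : ℝ → F → Θ → F} {c : ℝ}
  [MeasurableSpace F] [MeasurableSpace Θ]
  (hφ : Measurable fun p : ℝ × F => φ p.1 p.2)
  (hJ : Measurable fun p : ℝ × F × Θ => J p.1 p.2.1 p.2.2) (hc : 0 < c)
  (μ : Measure F) [IsProbabilityMeasure μ] (Q : Measure Θ) [IsProbabilityMeasure Q]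
  {g η : ℝ → F → ℝ} (hg : Measurable fun p : ℝ × F => g p.1 p.2)
  (hη : Measurable fun p : ℝ × F => η p.1 p.2) {t M a : ℝ} (hgM : ∀ s z, |g s z| ≤ M)
  (hηa : ∀ s z, |η s z| ≤ c * a)
  (hflow : ∀ τ z x, 0 ≤ τ → 0 ≤ x → τ + x ≤ t →
    g (τ + x) (φ x z) = g τ z + ∫ y in Ioc 0 x, η (τ + y) (φ y z))

include hJ hg

theorem measurable_jumpMean :
    Measurable fun p : ℝ × F => ∫ θ, g p.1 (J p.1 p.2 θ) ∂Q := by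
  have h1 : Measurable fun r : (ℝ × F) × Θ => g r.1.1 (J r.1.1 r.1.2 r.2) :=
    hg.comp ((by fun_prop : Measurable fun r : (ℝ × F) × Θ => r.1.1).prodMk
      (hJ.comp (Measurable.prodMk (by fun_prop) (Measurable.prodMk (by fun_prop) (by fun_prop)))))
  exact (h1.stronglyMeasurable.integral_prod_right').measurable

include hφ hc hη hgM hηa hflow

/-- The expected change of `g` in one step. -/
theorem integral_nextValue {τ : ℝ} (hτ : 0 ≤ τ) (hτt : τ ≤ t) (z : F) :
    ∫ w, nextValue φ J c g t τ z w ∂((expMeasure 1).prod Q) = g τ z +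
      ∫ x in Ioc 0 (t - τ), Real.exp (-(c * x)) * (η (τ + x) (φ x z) +
        c * ((∫ θ, g (τ + x) (J (τ + x) (φ x z) θ) ∂Q) - g (τ + x) (φ x z))) := by
  have hnv : Measurable fun w => nextValue φ J c g t τ z w :=
    (measurable_nextValue (c := c) hφ hJ hg t).comp (measurable_prodMk_left (x := (τ, z)))
  have hnM : ∀ w, ‖nextValue φ J c g t τ z w‖ ≤ M := by
    intro w
    unfold nextValue
    split_ifs <;> exact hgM _ _
  have hni : Integrable (fun w => nextValue φ J c g t τ z w) ((expMeasure 1).prod Q) :=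
    Integrable.of_bound hnv.aestronglyMeasurable M (Eventually.of_forall hnM)
  have hpath : Measurable fun x : ℝ => (τ + x, φ x z) :=
    Measurable.prodMk (by fun_prop) (hφ.comp measurable_prodMk_right)
  set j : ℝ → ℝ := fun x => (∫ θ, g (τ + x) (J (τ + x) (φ x z) θ) ∂Q) - g (τ + x) (φ x z) with hj
  have hjm : Measurable j :=
    ((measurable_jumpMean hJ Q hg).comp hpath).sub (hg.comp hpath)
  have hηm : Measurable fun x => η (τ + x) (φ x z) := hη.comp hpath
  have hjM : ∀ x, |j x| ≤ 2 * M + c * a := by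
    intro x
    have h1 : |∫ θ, g (τ + x) (J (τ + x) (φ x z) θ) ∂Q| ≤ M := by
      have := norm_integral_le_of_norm_le_const (μ := Q)
        (f := fun θ => g (τ + x) (J (τ + x) (φ x z) θ)) (C := M)
        (Eventually.of_forall fun θ => hgM _ _)
      simpa using this
    have h2 := abs_sub (∫ θ, g (τ + x) (J (τ + x) (φ x z) θ) ∂Q) (g (τ + x) (φ x z))
    have h3 := hgM (τ + x) (φ x z)
    have h4 := (abs_nonneg _).trans (hηa 0 z)
    simp only [hj]
    linarith
  have hηM : ∀ x, |η (τ + x) (φ x z)| ≤ 2 * M + c * a := fun x => by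
    have := (abs_nonneg _).trans (hgM 0 z)
    linarith [hηa (τ + x) (φ x z)]
  have hkey := integral_expMeasure_one_step (L := t - τ) hc hηm hjm hηM hjM
  rw [integral_prod _ hni, ← hkey]
  -- By `hflow` the change of `g` along the flow up to the waiting time or the horizon is an
  -- integral of `η`, which brings the step into the form of `integral_expMeasure_one_step`.
  have h5 : ∀ᵐ ξ ∂expMeasure 1, ∫ θ, nextValue φ J c g t τ z (ξ, θ) ∂Q
      = g τ z + ((∫ y in Ioc 0 (t - τ), if y < ξ / c then η (τ + y) (φ y z) else 0)
        + if ξ / c ≤ t - τ then j (ξ / c) else 0) := by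
    filter_upwards [ae_expMeasure_one_pos] with ξ hξ
    have hx : 0 < ξ / c := div_pos hξ hc
    have hint : (∫ y in Ioc 0 (t - τ), if y < ξ / c then η (τ + y) (φ y z) else 0)
        = ∫ y in Ioc 0 (min (ξ / c) (t - τ)), η (τ + y) (φ y z) := by
      have e1 : ∀ y, (if y < ξ / c then η (τ + y) (φ y z) else 0)
          = (Iio (ξ / c)).indicator (fun y => η (τ + y) (φ y z)) y := fun y => by
        simp [indicator]
      simp only [e1]
      rw [setIntegral_indicator measurableSet_Iio]
      refine setIntegral_congr_set ?_
      have e2 : (Iio (ξ / c) : Set ℝ) =ᵐ[volume] Iic (ξ / c) := Iio_ae_eq_Iic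
      have e3 : Ioc 0 (min (ξ / c) (t - τ)) = Ioc 0 (t - τ) ∩ Iic (ξ / c) := by
        ext y; simp only [mem_Ioc, le_min_iff, mem_inter_iff, mem_Iic]; tauto
      rw [e3]
      exact (ae_eq_refl _).inter e2
    by_cases h : ξ / c ≤ t - τ
    · have h' : τ + ξ / c ≤ t := by linarith
      simp only [nextValue, h', if_true, h, hint, min_eq_left h, hj]
      have := hflow τ z (ξ / c) hτ hx.le h'
      linarith
    · have h' : ¬ τ + ξ / c ≤ t := fun h2 => h (by linarith)
      simp only [nextValue, h', if_false, h, hint, min_eq_right (not_le.1 h).le, integral_const,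
        probReal_univ, one_smul]
      have := hflow τ z (t - τ) hτ (by linarith) (by linarith)
      rw [add_sub_cancel] at this
      linarith
  have h6 : Integrable (fun ξ => ∫ θ, nextValue φ J c g t τ z (ξ, θ) ∂Q) (expMeasure 1) :=
    hni.integral_prod_left
  have h7 : Integrable (fun ξ => (∫ y in Ioc 0 (t - τ), if y < ξ / c then η (τ + y) (φ y z) else 0)
      + if ξ / c ≤ t - τ then j (ξ / c) else 0) (expMeasure 1) := by
    refine ((h6.congr h5).sub (integrable_const (g τ z))).congr (Eventually.of_forall fun ξ => ?_)
    simp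
  rw [integral_congr_ae h5, integral_add (integrable_const _) h7]
  simp

omit [MeasurableSpace F] [MeasurableSpace Θ] hφ hJ hg hη hgM in
-- The flow moves `g` at speed at most `c * a` during a time at most `w.1 / c`, hence by at most `a
-- * w.1`, and the jump adds at most `a`. This makes the second moment of a step of order `a ^ 2`.
theorem abs_nextValue_sub_le (hjump : ∀ s z θ, |g s (J s z θ) - g s z| ≤ a)
    {τ : ℝ} (hτ : 0 ≤ τ) (hτt : τ ≤ t) (z : F) {w : ℝ × Θ} (hw : 0 < w.1) :
    |nextValue φ J c g t τ z w - g τ z| ≤ a * (1 + w.1) := by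
  have ha : 0 ≤ a := (abs_nonneg _).trans (hjump 0 z w.2)
  have hdiff : ∀ x, 0 ≤ x → τ + x ≤ t → |g (τ + x) (φ x z) - g τ z| ≤ c * a * x := by
    intro x hx hxt
    rw [hflow τ z x hτ hx hxt, add_sub_cancel_left]
    have := norm_setIntegral_le_of_norm_le_const (μ := volume) (s := Ioc 0 x)
      (f := fun y => η (τ + y) (φ y z)) (C := c * a) (by simp) (fun y _ => hηa _ _)
    simpa [hx] using this
  have hx : 0 < w.1 / c := div_pos hw hc
  unfold nextValue
  split_ifs with h
  · have h1 := hdiff _ hx.le h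
    have h2 := hjump (τ + w.1 / c) (φ (w.1 / c) z) w.2
    have h3 : c * a * (w.1 / c) = a * w.1 := by field_simp
    rw [h3] at h1
    calc _ = |(g (τ + w.1 / c) (J (τ + w.1 / c) (φ (w.1 / c) z) w.2) - g (τ + w.1 / c) (φ (w.1 / c) z))
            + (g (τ + w.1 / c) (φ (w.1 / c) z) - g τ z)| := by ring_nf
      _ ≤ _ := (abs_add_le _ _).trans (by linarith)
  · have h1 := hdiff (t - τ) (by linarith) (by linarith)
    rw [add_sub_cancel] at h1
    have h2 : t - τ ≤ w.1 / c := by linarith [not_le.1 h]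
    have h3 : c * a * (w.1 / c) = a * w.1 := by field_simp
    have h4 : c * a * (t - τ) ≤ c * a * (w.1 / c) := by gcongr
    linarith

/-- A Dynkin-type inequality: the expected value of `ψ (g t Z_t)` for an approximately linear `ψ`
is controlled by the generator applied to `g`. -/
theorem lintegral_comp_stateAt_le (ht : 0 ≤ t) (hjump : ∀ s z θ, |g s (J s z θ) - g s z| ≤ a)
    {ψ ψ' : ℝ → ℝ} {κ : ℝ} (hψ : Measurable ψ) (hψ0 : ∀ s z, 0 ≤ ψ (g s z)) (hκ : 0 ≤ κ)
    (hψ' : ∀ x, |ψ' x| ≤ 1)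
    (hψψ : ∀ x y, ψ y ≤ ψ x + ψ' x * (y - x) + κ * (y - x) ^ 2) :
    ∫⁻ ω, ENNReal.ofReal (ψ (g t (stateAt φ J c ω t))) ∂(drivingLaw μ Q)
      ≤ ∫⁻ z, ENNReal.ofReal (ψ (g 0 z)) ∂μ
        + ((∫⁻ s in Ioc 0 t, ∫⁻ ω, ENNReal.ofReal |η s (stateAt φ J c ω s) +
            c * ((∫ θ, g s (J s (stateAt φ J c ω s) θ) ∂Q) - g s (stateAt φ J c ω s))|
            ∂(drivingLaw μ Q))
          + ENNReal.ofReal (5 * κ * a ^ 2) * ENNReal.ofReal (1 + c * t)) := by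
  set h : ℝ → F → ℝ := fun s z => η s z + c * ((∫ θ, g s (J s z θ) ∂Q) - g s z) with hh
  have hhm : Measurable fun p : ℝ × F => h p.1 p.2 :=
    hη.add (((measurable_jumpMean hJ Q hg).sub hg).const_mul c)
  let H : ℝ → F → ENNReal := fun s z => ENNReal.ofReal |h s z|
  have hHm : Measurable fun p : ℝ × F => H p.1 p.2 := by
    exact ENNReal.measurable_ofReal.comp (continuous_abs.measurable.comp hhm)
  -- The growth allowed per step: `κ` times the second moment of the increment, where `5` is the
  -- mean of `(1 + ξ) ^ 2` for a standard exponential `ξ`, plus the absolute drift accumulated until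
  -- the next point.
  let d : ℝ → F → ENNReal := fun τ z => ENNReal.ofReal (5 * κ * a ^ 2) +
    ∫⁻ x in Ioc 0 (t - τ), ENNReal.ofReal (Real.exp (-(c * x))) * H (τ + x) (φ x z)
  have hstep : ∀ τ z, 0 ≤ τ → τ ≤ t →
      ∫⁻ w, nextValue φ J c (fun s z => ENNReal.ofReal (ψ (g s z))) t τ z w
        ∂((expMeasure 1).prod Q) ≤ ENNReal.ofReal (ψ (g τ z)) + d τ z := by
    intro τ z hτ hτt
    set n : ℝ × Θ → ℝ := fun w => nextValue φ J c g t τ z w with hn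
    have hnv : Measurable n := (measurable_nextValue (c := c) hφ hJ hg t).comp
      (measurable_prodMk_left (x := (τ, z)))
    have hnM : ∀ w, |n w| ≤ M := by
      intro w
      simp only [hn, nextValue]
      split_ifs <;> exact hgM _ _
    have hni : Integrable n ((expMeasure 1).prod Q) :=
      Integrable.of_bound hnv.aestronglyMeasurable M (Eventually.of_forall hnM)
    have hni2 : Integrable (fun w => (n w - g τ z) ^ 2) ((expMeasure 1).prod Q) := by
      refine Integrable.of_bound (by fun_prop) ((2 * M) ^ 2) (Eventually.of_forall fun w => ?_)
      rw [Real.norm_eq_abs, abs_pow]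
      refine pow_le_pow_left₀ (abs_nonneg _) ?_ 2
      have := abs_sub (n w) (g τ z)
      linarith [hnM w, hgM τ z]
    have hsq : ∫ w, (n w - g τ z) ^ 2 ∂((expMeasure 1).prod Q) ≤ 5 * a ^ 2 := by
      rw [integral_eq_lintegral_of_nonneg_ae (Eventually.of_forall fun w => sq_nonneg _)
        hni2.aestronglyMeasurable]
      refine ENNReal.toReal_le_of_le_ofReal (by positivity) ?_
      calc ∫⁻ w, ENNReal.ofReal ((n w - g τ z) ^ 2) ∂((expMeasure 1).prod Q)
          ≤ ∫⁻ w, ENNReal.ofReal (a ^ 2) * ENNReal.ofReal ((1 + w.1) ^ 2)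
              ∂((expMeasure 1).prod Q) := by
            refine lintegral_mono_ae ?_
            have hpos : ∀ᵐ w ∂((expMeasure 1).prod Q), 0 < w.1 :=
              Measure.quasiMeasurePreserving_fst.ae ae_expMeasure_one_pos
            filter_upwards [hpos] with w hw
            rw [← ENNReal.ofReal_mul (sq_nonneg a), ← mul_pow]
            refine ENNReal.ofReal_le_ofReal (sq_le_sq.2 ?_)
            exact (abs_nextValue_sub_le hc hηa hflow hjump hτ hτt z hw).trans
              (le_abs_self _)
        _ = ENNReal.ofReal (5 * a ^ 2) := by
            rw [lintegral_const_mul _ (by fun_prop), lintegral_prod _ (by fun_prop)]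
            simp only [lintegral_const, measure_univ, mul_one]
            rw [lintegral_expMeasure_one_sq, mul_comm 5, ENNReal.ofReal_mul (sq_nonneg a)]
            simp
    have hdrift : ENNReal.ofReal |∫ w, (n w - g τ z) ∂((expMeasure 1).prod Q)|
        ≤ ∫⁻ x in Ioc 0 (t - τ), ENNReal.ofReal (Real.exp (-(c * x))) * H (τ + x) (φ x z) := by
      rw [integral_sub hni (integrable_const _), hn,
        integral_nextValue hφ hJ hc Q hg hη hgM hηa hflow hτ hτt z]
      simp only [integral_const, probReal_univ, one_smul, add_sub_cancel_left]
      rw [← Real.enorm_eq_ofReal_abs]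
      refine (enorm_integral_le_lintegral_enorm _).trans (le_of_eq (lintegral_congr fun x => ?_))
      rw [Real.enorm_eq_ofReal_abs, abs_mul, abs_of_pos (Real.exp_pos _),
        ENNReal.ofReal_mul (Real.exp_pos _).le]
    have hle : ∫⁻ w, nextValue φ J c (fun s z => ENNReal.ofReal (ψ (g s z))) t τ z w
        ∂((expMeasure 1).prod Q) ≤ ∫⁻ w, ENNReal.ofReal
          (ψ (g τ z) + ψ' (g τ z) * (n w - g τ z) + κ * (n w - g τ z) ^ 2)
          ∂((expMeasure 1).prod Q) := by
      refine lintegral_mono fun w => ?_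
      have e : nextValue φ J c (fun s z => ENNReal.ofReal (ψ (g s z))) t τ z w
          = ENNReal.ofReal (ψ (n w)) := by
        simp only [hn, nextValue]
        split_ifs <;> rfl
      rw [e]
      exact ENNReal.ofReal_le_ofReal (hψψ _ _)
    refine hle.trans ?_
    have hi1 : Integrable (fun w => ψ' (g τ z) * (n w - g τ z)) ((expMeasure 1).prod Q) :=
      (hni.sub (integrable_const _)).const_mul _
    have hi2 : Integrable (fun w => κ * (n w - g τ z) ^ 2) ((expMeasure 1).prod Q) :=
      hni2.const_mul _
    have hi3 : Integrable (fun w => ψ (g τ z) + ψ' (g τ z) * (n w - g τ z))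
        ((expMeasure 1).prod Q) := (integrable_const _).add hi1
    have hi4 : Integrable (fun w => ψ (g τ z) + ψ' (g τ z) * (n w - g τ z)
        + κ * (n w - g τ z) ^ 2) ((expMeasure 1).prod Q) := hi3.add hi2
    rw [← ofReal_integral_eq_lintegral_ofReal hi4]
    · rw [integral_add hi3 hi2, integral_add (integrable_const _) hi1, integral_const_mul,
        integral_const_mul]
      simp only [integral_const, probReal_univ, one_smul]
      set D := ∫ w, (n w - g τ z) ∂((expMeasure 1).prod Q)
      have h1 : ψ' (g τ z) * D ≤ |D| := by
        calc ψ' (g τ z) * D ≤ |ψ' (g τ z) * D| := le_abs_self _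
          _ = |ψ' (g τ z)| * |D| := abs_mul _ _
          _ ≤ 1 * |D| := by gcongr; exact hψ' _
          _ = |D| := one_mul _
      have h2 : κ * ∫ w, (n w - g τ z) ^ 2 ∂((expMeasure 1).prod Q) ≤ 5 * κ * a ^ 2 := by
        calc _ ≤ κ * (5 * a ^ 2) := by gcongr
          _ = _ := by ring
      calc _ ≤ ENNReal.ofReal (ψ (g τ z) + (5 * κ * a ^ 2 + |D|)) :=
            ENNReal.ofReal_le_ofReal (by linarith)
        _ = ENNReal.ofReal (ψ (g τ z)) + (ENNReal.ofReal (5 * κ * a ^ 2) + ENNReal.ofReal |D|) := by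
            rw [ENNReal.ofReal_add (hψ0 _ _) (by positivity), ENNReal.ofReal_add (by positivity)
              (abs_nonneg _)]
        _ ≤ _ := by
            simp only [d]
            gcongr
    · refine Eventually.of_forall fun w => ?_
      have h1 := hψψ (g τ z) (n w)
      have h2 : 0 ≤ ψ (n w) := by
        simp only [hn, nextValue]
        split_ifs <;> exact hψ0 _ _
      exact h2.trans h1
  have hΨm : Measurable fun p : ℝ × F => ENNReal.ofReal (ψ (g p.1 p.2)) :=
    ENNReal.measurable_ofReal.comp (hψ.comp hg)
  have hmain := lintegral_stateAt_le hφ hJ hc μ Q ht hΨm hstep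
  refine hmain.trans (add_le_add_right ?_ _)
  have hA : ∀ m, ∫⁻ ω, (if arrivalTime c ω m ≤ t then
        d (arrivalTime c ω m) (chainState φ J c ω m) else 0) ∂(drivingLaw μ Q)
      = ENNReal.ofReal (5 * κ * a ^ 2) * drivingLaw μ Q {ω | arrivalTime c ω m ≤ t} +
        ∫⁻ ω, (if arrivalTime c ω m ≤ t then ∫⁻ x in Ioc 0 (t - arrivalTime c ω m),
        ENNReal.ofReal (Real.exp (-(c * x))) *
          H (arrivalTime c ω m + x) (φ x (chainState φ J c ω m)) else 0) ∂(drivingLaw μ Q) := by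
    intro m
    have hm : MeasurableSet {ω : F × (ℕ → ℝ × Θ) | arrivalTime c ω m ≤ t} :=
      measurableSet_le (measurable_arrivalTime m) measurable_const
    rw [← lintegral_indicator_const hm, ← lintegral_add_left (measurable_const.indicator hm)]
    refine lintegral_congr fun ω => ?_
    by_cases hω : arrivalTime c ω m ≤ t
    · simp [hω, d, indicator]
    · simp [hω, indicator]
  -- The quadratic terms are counted by the expected number of points, at most `1 + c * t`; the
  -- drift terms reassemble into a time integral along the path.
  rw [tsum_congr hA, ENNReal.tsum_add, ENNReal.tsum_mul_left]
  refine (add_comm _ _).trans_le (add_le_add (tsum_occupation_le hφ hJ hc μ Q hHm) ?_)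
  exact mul_le_mul_right (tsum_arrivalTime_le hφ hJ hc μ Q ht) _

end Chain

/-! ### The single queue -/

/-- The integrand is the derivative of `exp (R * x) * (C - ∫ …)`. As `k` is only bounded and
measurable, this derivative exists merely almost everywhere, and the fundamental theorem is applied
in its form for absolutely continuous functions. -/
theorem integral_exp_mul_sub {R C M : ℝ} {k : ℝ → ℝ} (hk : Measurable k) (hkM : ∀ x, |k x| ≤ M)
    (q : ℝ) :
    ∫ x in (0 : ℝ)..q, R * (Real.exp (R * x) *
        (C - ∫ v in (0 : ℝ)..x, R * Real.exp (-(R * v)) * k v) - k x)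
      = Real.exp (R * q) * (C - ∫ v in (0 : ℝ)..q, R * Real.exp (-(R * v)) * k v) - C := by
  set G : ℝ → ℝ := fun v => R * Real.exp (-(R * v)) * k v with hG
  have hGii : IntervalIntegrable G volume 0 q := by
    have h1 : IntervalIntegrable k volume 0 q := by
      refine (intervalIntegrable_const (c := M)).mono_fun hk.aestronglyMeasurable
        (Eventually.of_forall fun x => ?_)
      exact (hkM x).trans (le_abs_self M)
    exact h1.continuousOn_mul (by fun_prop)
  have hf : AbsolutelyContinuousOnInterval (fun x => Real.exp (R * x)) 0 q := by
    apply ContDiffOn.absolutelyContinuousOnInterval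
    exact ContDiff.contDiffOn (by fun_prop)
  have hg : AbsolutelyContinuousOnInterval (fun x => C - ∫ v in (0 : ℝ)..x, G v) 0 q := by
    have h1 := hGii.absolutelyContinuousOnInterval_intervalIntegral (c := 0) (by simp)
    have h2 : AbsolutelyContinuousOnInterval (fun _ : ℝ => C) 0 q := by
      apply ContDiffOn.absolutelyContinuousOnInterval
      exact contDiffOn_const
    exact h2.sub h1
  have h := hf.integral_deriv_mul_eq_sub hg
  simp only [mul_zero, Real.exp_zero, intervalIntegral.integral_same, sub_zero, one_mul] at h
  rw [← h]
  refine intervalIntegral.integral_congr_ae ?_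
  filter_upwards [hGii.ae_hasDerivAt_integral] with x hx hxq
  have h1 : HasDerivAt (fun x => Real.exp (R * x)) (Real.exp (R * x) * R) x := by
    simpa using ((hasDerivAt_id x).const_mul R).exp
  have h2 : HasDerivAt (fun x => C - ∫ v in (0 : ℝ)..x, G v) (-G x) x := by
    simpa using (hx (uIoc_subset_uIcc hxq) 0 (by simp)).const_sub C
  rw [h1.deriv, h2.deriv]
  simp only [hG]
  have h3 : Real.exp (R * x) * Real.exp (-(R * x)) = 1 := by
    rw [← Real.exp_add]; simp
  linear_combination (R * k x) * h3

section SingleQueue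

variable {E : Type*} [MeasurableSpace E] (S : ServiceDiscipline E) (R : ℝ) (rate : ℝ → ℕ → ℝ)

@[fun_prop]
theorem measurable_queueLength : Measurable S.queueLength := S.measurable_card_jobs

open Classical in
/-- The effect of a potential arrival at the single queue. -/
noncomputable def queueJump (s : ℝ) (e : E) (θ : ℝ × unitInterval) : E :=
  if (θ.2 : ℝ) * R < rate s (S.queueLength e) then S.arrive e θ.1 else e

theorem queueAfter_eq (ω : QueuePath E) (m : ℕ) :
    queueAfter S R rate ω m = chainState S.serve (queueJump S R rate) R ω m := by
  induction m with
  | zero => rfl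
  | succ m ih =>
    simp only [queueAfter, chainState, queueJump, ih]
    rfl

theorem singleQueue_eq (ω : QueuePath E) (t : ℝ) :
    singleQueue S R rate ω t
      = S.queueLength (stateAt S.serve (queueJump S R rate) R ω t) := by
  simp only [singleQueue, stateAt, queueAfter_eq]
  rfl

variable {R rate}

theorem measurable_rate_queueLength (hrate : ∀ k, Measurable fun t => rate t k) :
    Measurable fun p : ℝ × E => rate p.1 (S.queueLength p.2) := by
  have h1 : Measurable fun p : ℝ × ℕ => rate p.1 p.2 :=
    measurable_from_prod_countable_left fun k => hrate k
  exact h1.comp (measurable_fst.prodMk ((measurable_queueLength S).comp measurable_snd))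

theorem measurable_queueJump (hrate : ∀ k, Measurable fun t => rate t k) :
    Measurable fun p : ℝ × E × (ℝ × unitInterval) => queueJump S R rate p.1 p.2.1 p.2.2 := by
  have h1 : Measurable fun p : ℝ × E × (ℝ × unitInterval) => rate p.1 (S.queueLength p.2.1) :=
    (measurable_rate_queueLength S hrate).comp
      (by fun_prop : Measurable fun p : ℝ × E × (ℝ × unitInterval) => (p.1, p.2.1))
  refine Measurable.ite (measurableSet_lt (by fun_prop) h1) ?_ (by fun_prop)
  exact S.measurable_arrive.comp
    (by fun_prop : Measurable fun p : ℝ × E × (ℝ × unitInterval) => (p.2.1, p.2.2.1))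

variable (B : Measure ℝ) [IsProbabilityMeasure B] (R rate)

open Classical in
/-- The expected value of `f` at time `t` for the single queue started at time `s` from the state
`e`, counting only paths with fewer than `m` potential arrivals. -/
noncomputable def valueIter (t : ℝ) (f : E → ENNReal) : ℕ → ℝ → E → ENNReal
  | 0, s, e => if t ≤ s then f e else 0
  | m + 1, s, e => if t ≤ s then f e else
      ∫⁻ w, nextValue S.serve (queueJump S R rate) R (valueIter t f m) t s e w
        ∂((expMeasure 1).prod (B.prod volume))

/-- The expected value of `f` at time `t` for the single queue started at time `s` from `e`. -/
noncomputable def queueValue (t : ℝ) (f : E → ENNReal) (s : ℝ) (e : E) : ENNReal :=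
  ⨆ m, valueIter S R rate B t f m s e

variable {R rate} (hrate : ∀ k, Measurable fun t => rate t k) {t : ℝ} {f : E → ENNReal}

omit [IsProbabilityMeasure B] in
theorem valueIter_of_le {s : ℝ} (h : t ≤ s) (m : ℕ) (e : E) :
    valueIter S R rate B t f m s e = f e := by
  cases m <;> simp [valueIter, h]

omit [IsProbabilityMeasure B] in
theorem queueValue_of_le {s : ℝ} (h : t ≤ s) (e : E) : queueValue S R rate B t f s e = f e := by
  simp [queueValue, valueIter_of_le S B h]

include hrate in
theorem measurable_valueIter (hf : Measurable f) (m : ℕ) :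
    Measurable fun p : ℝ × E => valueIter S R rate B t f m p.1 p.2 := by
  induction m with
  | zero =>
    exact Measurable.ite (measurableSet_le measurable_const measurable_fst)
      (hf.comp measurable_snd) measurable_const
  | succ m ih =>
    refine Measurable.ite (measurableSet_le measurable_const measurable_fst)
      (hf.comp measurable_snd) ?_
    exact (measurable_nextValue S.measurable_serve (measurable_queueJump S hrate) ih
      t).lintegral_prod_right'

include hrate in
theorem measurable_queueValue (hf : Measurable f) :
    Measurable fun p : ℝ × E => queueValue S R rate B t f p.1 p.2 :=
  Measurable.iSup fun m => measurable_valueIter S B hrate hf m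

theorem nextValue_mono {F Θ : Type*} {φ : ℝ → F → F} {J : ℝ → F → Θ → F} {c : ℝ}
    {Ψ Ψ' : ℝ → F → ENNReal} (h : ∀ s z, Ψ s z ≤ Ψ' s z) (t τ : ℝ) (z : F) (w : ℝ × Θ) :
    nextValue φ J c Ψ t τ z w ≤ nextValue φ J c Ψ' t τ z w := by
  unfold nextValue
  split_ifs <;> exact h _ _

omit [IsProbabilityMeasure B] in
theorem valueIter_mono : Monotone (valueIter S R rate B t f) := by
  refine monotone_nat_of_le_succ fun m => ?_
  induction m with
  | zero =>
    intro s e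
    by_cases h : t ≤ s
    · simp [valueIter, h]
    · simp [valueIter, h]
  | succ m ih =>
    intro s e
    by_cases h : t ≤ s
    · simp [valueIter, h]
    · rw [valueIter, if_neg h]
      rw [valueIter, if_neg h]
      exact lintegral_mono fun w => nextValue_mono (fun s z => ih s z) _ _ _ _

theorem sum_valueIter_le {ι : Type*} (I : Finset ι) {f : ι → E → ENNReal}
    (hrate : ∀ k, Measurable fun t => rate t k) (hfm : ∀ i, Measurable (f i))
    (hf : ∀ e, ∑ i ∈ I, f i e ≤ 1) (m : ℕ) (s : ℝ) (e : E) :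
    ∑ i ∈ I, valueIter S R rate B t (f i) m s e ≤ 1 := by
  induction m generalizing s e with
  | zero =>
    by_cases h : t ≤ s
    · simpa [valueIter, h] using hf e
    · simp [valueIter, h]
  | succ m ih =>
    by_cases h : t ≤ s
    · simpa [valueIter, h] using hf e
    · simp only [valueIter, h, if_false]
      rw [← lintegral_finsetSum]
      · calc _ ≤ ∫⁻ _, 1 ∂((expMeasure 1).prod (B.prod (volume : Measure unitInterval))) := by
              refine lintegral_mono fun w => ?_
              unfold nextValue
              split_ifs
              · exact ih _ _
              · exact ih _ _
          _ = 1 := by simp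
      · intro i _
        exact (measurable_nextValue S.measurable_serve (measurable_queueJump S hrate)
          (measurable_valueIter S B hrate (hfm i) m) t).comp (measurable_prodMk_left (x := (s, e)))

/-- Mass is only lost by the truncation at `m` potential arrivals, so the inequality passes to the
monotone limit. It is used twice: for a set and its complement, to turn one-sided estimates into
total variation, and for a partition, to bound the sum of the gains over the cells. -/
theorem sum_queueValue_le {ι : Type*} (I : Finset ι) {f : ι → E → ENNReal}
    (hrate : ∀ k, Measurable fun t => rate t k) (hfm : ∀ i, Measurable (f i))
    (hf : ∀ e, ∑ i ∈ I, f i e ≤ 1) (s : ℝ) (e : E) :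
    ∑ i ∈ I, queueValue S R rate B t (f i) s e ≤ 1 := by
  simp only [queueValue]
  rw [ENNReal.finsetSum_iSup_of_monotone (f := fun i m => valueIter S R rate B t (f i) m s e)
    fun i m m' h => valueIter_mono S B h s e]
  exact iSup_le fun m => sum_valueIter_le S B I hrate hfm hf m s e

theorem queueValue_le_one (hrate : ∀ k, Measurable fun t => rate t k) (hfm : Measurable f)
    (hf : ∀ e, f e ≤ 1) (s : ℝ) (e : E) : queueValue S R rate B t f s e ≤ 1 := by
  simpa using sum_queueValue_le S B (t := t) (R := R) ({()} : Finset Unit) (f := fun _ => f) hrate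
    (fun _ => hfm) (by simpa using hf) s e

include hrate in
-- The value function is invariant under one step, by monotone convergence in the recursion. With it
-- the growth term in `lintegral_stateAt_le` is zero.
theorem lintegral_nextValue_queueValue (hR : 0 < R) (hf : Measurable f) {s : ℝ} (hs : s ≤ t)
    (e : E) :
    ∫⁻ w, nextValue S.serve (queueJump S R rate) R (queueValue S R rate B t f) t s e w
        ∂((expMeasure 1).prod (B.prod volume)) = queueValue S R rate B t f s e := by
  rcases hs.eq_or_lt with rfl | hs
  -- At `s = t` the recursion has already stopped. The next point almost surely comes strictly
  -- later, and serving for time `0` changes nothing.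
  · rw [queueValue_of_le S B le_rfl]
    have hpos : ∀ᵐ w ∂((expMeasure 1).prod (B.prod (volume : Measure unitInterval))), 0 < w.1 :=
      Measure.quasiMeasurePreserving_fst.ae ae_expMeasure_one_pos
    rw [lintegral_congr_ae (g := fun _ => f e)]
    · simp
    · filter_upwards [hpos] with w hw
      have : ¬ s + w.1 / R ≤ s := by
        have := div_pos hw hR
        linarith
      simp [nextValue, this, queueValue_of_le S B le_rfl, S.serve_zero]
  · have h1 : ∀ w, nextValue S.serve (queueJump S R rate) R (queueValue S R rate B t f) t s e w
        = ⨆ m, nextValue S.serve (queueJump S R rate) R (valueIter S R rate B t f m) t s e w := by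
      intro w
      unfold nextValue
      split_ifs <;> rfl
    rw [lintegral_congr h1, lintegral_iSup]
    · have h2 : ∀ m, ∫⁻ w, nextValue S.serve (queueJump S R rate) R (valueIter S R rate B t f m)
          t s e w ∂((expMeasure 1).prod (B.prod volume)) = valueIter S R rate B t f (m + 1) s e := by
        intro m
        simp [valueIter, not_le.2 hs]
      simp only [h2, queueValue]
      exact (Monotone.iSup_nat_add (f := fun m => valueIter S R rate B t f m s e)
        (fun m m' h => valueIter_mono S B h s e) 1)
    · exact fun m => (measurable_nextValue S.measurable_serve (measurable_queueJump S hrate)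
          (measurable_valueIter S B hrate hf m) t).comp (measurable_prodMk_left (x := (s, e)))
    · exact fun m m' h w => nextValue_mono (fun s z => valueIter_mono S B h s z) _ _ _ _

/-- The value function bounds the expected value of `f` at time `t`. -/
theorem lintegral_singleQueue_le (hR : 0 < R) (hrate : ∀ k, Measurable fun t => rate t k)
    (hf : Measurable f) (ht : 0 ≤ t) (ν : Measure E) [IsProbabilityMeasure ν] :
    ∫⁻ ω, f (stateAt S.serve (queueJump S R rate) R ω t) ∂(queueMeasure B ν)
      ≤ ∫⁻ e, queueValue S R rate B t f 0 e ∂ν := by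
  have h := lintegral_stateAt_le S.measurable_serve (measurable_queueJump S hrate) hR ν
    (B.prod volume) ht (Ψ := queueValue S R rate B t f) (d := fun _ _ => 0)
    (measurable_queueValue S B hrate hf)
    (fun τ z _ hτ => by rw [lintegral_nextValue_queueValue S B hrate hR hf hτ, add_zero])
  simp only [queueValue_of_le S B le_rfl, ite_self, lintegral_zero, tsum_zero, add_zero] at h
  exact h

end SingleQueue

/-! ### The backward equation of the single queue. -/

section SingleQueue

variable {E : Type*} [MeasurableSpace E] (S : ServiceDiscipline E) (R : ℝ) (rate : ℝ → ℕ → ℝ)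
  (B : Measure ℝ)

/-- The real-valued version of `queueValue`. -/
noncomputable def queueProb (t : ℝ) (f : E → ENNReal) (s : ℝ) (e : E) : ℝ :=
  (queueValue S R rate B t f s e).toReal

/-- The expected change of `queueProb` caused by an arrival. -/
noncomputable def arrivalGain (t : ℝ) (f : E → ENNReal) (s : ℝ) (e : E) : ℝ :=
  (∫ b, queueProb S R rate B t f s (S.arrive e b) ∂B) - queueProb S R rate B t f s e

/-- The mean value of `queueProb` after a potential arrival. -/
noncomputable def potentialMean (t : ℝ) (f : E → ENNReal) (s : ℝ) (e : E) : ℝ :=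
  queueProb S R rate B t f s e
    + rate s (S.queueLength e) / R * arrivalGain S R rate B t f s e

variable [IsProbabilityMeasure B]
variable {R rate} (hR : 0 < R) (hrate : ∀ k, Measurable fun t => rate t k)
  (hrate0 : ∀ s k, 0 ≤ rate s k) (hrateR : ∀ s k, rate s k ≤ R) {t : ℝ} {f : E → ENNReal}
  (hfm : Measurable f) (hf : ∀ e, f e ≤ 1)

/-- The hypothesis is the renewal equation at the first potential arrival, along a line of the flow;
the conclusion is the integrated form of the differential equation `y' = R * (y - k)`. -/
theorem eq_add_integral_of_backward {R L A M : ℝ} {k y : ℝ → ℝ} (hk : Measurable k)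
    (hkM : ∀ x, |k x| ≤ M)
    (hy : ∀ q, 0 ≤ q → q ≤ L → y q = Real.exp (-(R * (L - q))) * A +
      ∫ v in Ioc 0 (L - q), R * Real.exp (-(R * v)) * k (q + v))
    {x : ℝ} (hx : 0 ≤ x) (hxL : x ≤ L) :
    y x = y 0 + ∫ v in Ioc 0 x, R * (y v - k v) := by
  set G : ℝ → ℝ := fun v => R * Real.exp (-(R * v)) * k v with hG
  have hGii : ∀ a b, IntervalIntegrable G volume a b := by
    intro a b
    have h1 : IntervalIntegrable k volume a b := by
      refine (intervalIntegrable_const (c := M)).mono_fun hk.aestronglyMeasurable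
        (Eventually.of_forall fun x => ?_)
      exact (hkM x).trans (le_abs_self M)
    exact h1.continuousOn_mul (by fun_prop)
  set C : ℝ := Real.exp (-(R * L)) * A + ∫ v in (0 : ℝ)..L, G v with hC
  -- Shifting the integration variable by `q` extracts the factor `exp (R * q)` and leaves a
  -- primitive of one fixed function, so that `integral_exp_mul_sub` applies.
  have hy' : ∀ q, 0 ≤ q → q ≤ L → y q = Real.exp (R * q) * (C - ∫ v in (0 : ℝ)..q, G v) := by
    intro q hq hqL
    rw [hy q hq hqL, ← intervalIntegral.integral_of_le (by linarith), hC, add_sub_assoc,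
      intervalIntegral.integral_interval_sub_left (hGii _ _) (hGii _ _), mul_add, ← mul_assoc,
      ← Real.exp_add]
    congr 1
    · congr 2; ring
    · have e3 := intervalIntegral.integral_comp_add_left (a := 0) (b := L - q) G q
      rw [add_zero, add_sub_cancel] at e3
      rw [← e3, ← intervalIntegral.integral_const_mul]
      refine intervalIntegral.integral_congr fun x _ => ?_
      simp only [hG]
      have e4 : Real.exp (R * q) * Real.exp (-(R * (q + x))) = Real.exp (-(R * x)) := by
        rw [← Real.exp_add]; congr 1; ring
      rw [← e4]
      ring
  have h0 := hy' 0 le_rfl (hx.trans hxL)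
  simp only [mul_zero, Real.exp_zero, one_mul, intervalIntegral.integral_same, sub_zero] at h0
  rw [hy' x hx hxL, h0, ← sub_eq_iff_eq_add', ← integral_exp_mul_sub hk hkM x,
    ← intervalIntegral.integral_of_le hx]
  refine intervalIntegral.integral_congr fun v hv => ?_
  rw [uIcc_of_le hx] at hv
  simp only [hy' v hv.1 (hv.2.trans hxL), hG]

theorem integral_expMeasure_one_terminal {R L A M : ℝ} (hR : 0 < R) (hL : 0 ≤ L) {k : ℝ → ℝ}
    (hkm : Measurable k) (hkM : ∀ x, |k x| ≤ M) :
    ∫ ξ, (fun x => if x ≤ L then k x else A) (ξ / R) ∂expMeasure 1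
      = Real.exp (-(R * L)) * A + ∫ x in Ioc 0 L, R * Real.exp (-(R * x)) * k x := by
  rw [integral_expMeasure_one_comp_div hR (fun x => if x ≤ L then k x else A)]
  have hE1 : IntegrableOn (fun x => R * Real.exp (-(R * x)) * (if x ≤ L then k x else A))
      (Ioc 0 (L)) := by
    have hbm : Measurable fun x => R * Real.exp (-(R * x)) * (if x ≤ L then k x else A) :=
      (by fun_prop : Measurable fun x : ℝ => R * Real.exp (-(R * x))).mul
        (Measurable.ite measurableSet_Iic hkm measurable_const)
    refine Integrable.of_bound hbm.aestronglyMeasurable (R * (M + |A|)) ?_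
    refine (ae_restrict_iff' measurableSet_Ioc).2 (Eventually.of_forall fun x hx => ?_)
    rw [norm_mul, norm_mul, Real.norm_eq_abs, Real.norm_eq_abs, Real.norm_eq_abs, abs_of_pos hR,
      abs_of_pos (Real.exp_pos _)]
    have e1 : Real.exp (-(R * x)) ≤ 1 := Real.exp_le_one_iff.2 (by nlinarith [hx.1])
    have e2 : |if x ≤ L then k x else A| ≤ M + |A| := by
      split_ifs
      · linarith [hkM x, abs_nonneg A]
      · linarith [(abs_nonneg _).trans (hkM 0)]
    calc R * Real.exp (-(R * x)) * |if x ≤ L then k x else A| ≤ R * 1 * (M + |A|) := by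
          gcongr
      _ = _ := by ring
  have hexp : IntegrableOn (fun x => R * Real.exp (-(R * x)) * A) (Ioi (L)) := by
    have := ((integrableOn_exp_mul_Ioi (a := -R) (by linarith) (L)).const_mul R).mul_const A
    refine this.congr (Eventually.of_forall fun x => ?_)
    simp [neg_mul]
  have hE2 : IntegrableOn (fun x => R * Real.exp (-(R * x)) * (if x ≤ L then k x else A))
      (Ioi (L)) := by
    refine hexp.congr_fun (fun x hx => ?_) measurableSet_Ioi
    simp [not_le.2 (mem_Ioi.1 hx)]
  rw [← Ioc_union_Ioi_eq_Ioi hL, setIntegral_union Ioc_disjoint_Ioi_same measurableSet_Ioi hE1 hE2,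
    add_comm]
  congr 1
  · have e1 : ∀ x ∈ Ioi (L), R * Real.exp (-(R * x)) * (if x ≤ L then k x else A)
        = (R * A) * Real.exp (-R * x) := by
      intro x hx
      rw [if_neg (not_le.2 (mem_Ioi.1 hx)), neg_mul]
      ring
    rw [setIntegral_congr_fun measurableSet_Ioi e1, integral_const_mul,
      integral_exp_mul_Ioi (by linarith)]
    rw [neg_mul]
    field_simp
  · refine setIntegral_congr_fun measurableSet_Ioc fun x hx => ?_
    simp [hx.2]

/-- Thinning: a uniform mark accepts a potential arrival with probability `r / R`, which lies in
`[0, 1]` because `0 ≤ r ≤ R`. -/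
theorem integral_mark {r : ℝ} (hR : 0 < R) (hr0 : 0 ≤ r) (hrR : r ≤ R) (a b : ℝ) :
    ∫ v : unitInterval, (if (v : ℝ) * R < r then a else b) = b + r / R * (a - b) := by
  have h1 : ∫ v : unitInterval, (if (v : ℝ) * R < r then a else b)
      = ∫ v in Icc (0 : ℝ) 1, (if v * R < r then a else b) :=
    integral_subtype_comap measurableSet_Icc (fun v : ℝ => if v * R < r then a else b)
  have h2 : ∀ v : ℝ, (if v * R < r then a else b) = b + (Iio (r / R)).indicator (fun _ => a - b) v := by
    intro v
    simp only [indicator, mem_Iio, lt_div_iff₀ hR]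
    split_ifs <;> ring
  rw [h1, integral_congr_ae (Eventually.of_forall h2), integral_add (integrable_const _)
    ((integrable_const _).indicator measurableSet_Iio), integral_indicator_const _ measurableSet_Iio,
    Measure.real, Measure.restrict_apply measurableSet_Iio]
  have h3 : Iio (r / R) ∩ Icc 0 1 = Ico 0 (r / R) := by
    ext v
    have : r / R ≤ 1 := (div_le_one hR).2 hrR
    simp only [mem_inter_iff, mem_Iio, mem_Icc, mem_Ico]
    constructor
    · rintro ⟨h, h', _⟩; exact ⟨h', h⟩
    · rintro ⟨h, h'⟩; exact ⟨h', h, by linarith⟩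
  rw [h3, Real.volume_Ico, sub_zero, ENNReal.toReal_ofReal (div_nonneg hr0 hR.le)]
  simp

omit [IsProbabilityMeasure B] in
theorem queueProb_nonneg (s : ℝ) (e : E) : 0 ≤ queueProb S R rate B t f s e :=
  ENNReal.toReal_nonneg

include hrate hfm hf

theorem queueProb_le_one (s : ℝ) (e : E) : queueProb S R rate B t f s e ≤ 1 :=
  ENNReal.toReal_le_of_le_ofReal zero_le_one (by simpa using queueValue_le_one S B hrate hfm hf s e)

omit hf in
theorem measurable_queueProb :
    Measurable fun p : ℝ × E => queueProb S R rate B t f p.1 p.2 :=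
  (measurable_queueValue S B hrate hfm).ennreal_toReal

theorem ofReal_queueProb (s : ℝ) (e : E) :
    ENNReal.ofReal (queueProb S R rate B t f s e) = queueValue S R rate B t f s e :=
  ENNReal.ofReal_toReal
    ((queueValue_le_one S B hrate hfm hf s e).trans_lt ENNReal.one_lt_top).ne

theorem abs_queueProb_le_one (s : ℝ) (e : E) : |queueProb S R rate B t f s e| ≤ 1 := by
  rw [abs_of_nonneg (queueProb_nonneg S B s e)]
  exact queueProb_le_one S B hrate hfm hf s e

omit [IsProbabilityMeasure B] hrate hf hfm in
theorem queueProb_of_le {s : ℝ} (h : t ≤ s) (e : E) :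
    queueProb S R rate B t f s e = (f e).toReal := by
  rw [queueProb, queueValue_of_le S B h]

omit hf in
theorem measurable_integral_arrive :
    Measurable fun p : ℝ × E => ∫ b, queueProb S R rate B t f p.1 (S.arrive p.2 b) ∂B := by
  have h1 : Measurable fun r : (ℝ × E) × ℝ => queueProb S R rate B t f r.1.1 (S.arrive r.1.2 r.2) :=
    (measurable_queueProb S B hrate hfm).comp
      ((by fun_prop : Measurable fun r : (ℝ × E) × ℝ => r.1.1).prodMk
        (S.measurable_arrive.comp (by fun_prop : Measurable fun r : (ℝ × E) × ℝ => (r.1.2, r.2))))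
  exact h1.stronglyMeasurable.integral_prod_right'.measurable

omit hf in
theorem measurable_arrivalGain :
    Measurable fun p : ℝ × E => arrivalGain S R rate B t f p.1 p.2 :=
  (measurable_integral_arrive S B hrate hfm).sub (measurable_queueProb S B hrate hfm)

theorem integrable_queueProb_arrive (s : ℝ) (e : E) :
    Integrable (fun b => queueProb S R rate B t f s (S.arrive e b)) B := by
  refine Integrable.of_bound (Measurable.aestronglyMeasurable ?_) 1
    (Eventually.of_forall fun b => abs_queueProb_le_one S B hrate hfm hf _ _)
  exact (measurable_queueProb S B hrate hfm).comp (measurable_const.prodMk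
    (S.measurable_arrive.comp (measurable_const.prodMk measurable_id)))

theorem abs_arrivalGain_le_one (s : ℝ) (e : E) : |arrivalGain S R rate B t f s e| ≤ 1 := by
  have h1 : ∫ b, queueProb S R rate B t f s (S.arrive e b) ∂B ≤ 1 := by
    have := integral_mono (integrable_queueProb_arrive S (R := R) (t := t) B hrate hfm hf s e)
      (integrable_const 1) (fun b => queueProb_le_one S B hrate hfm hf s (S.arrive e b))
    simpa using this
  have h0 : 0 ≤ ∫ b, queueProb S R rate B t f s (S.arrive e b) ∂B :=
    integral_nonneg fun b => queueProb_nonneg S B _ _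
  have h2 := queueProb_le_one S B hrate hfm hf (R := R) (t := t) s e
  have h3 : 0 ≤ queueProb S R rate B t f s e := queueProb_nonneg S B s e
  rw [arrivalGain, abs_le]
  constructor <;> linarith

include hR hrate0 hrateR

theorem integral_queueJump (s : ℝ) (e : E) :
    ∫ θ, queueProb S R rate B t f s (queueJump S R rate s e θ) ∂(B.prod volume)
      = potentialMean S R rate B t f s e := by
  have hi : Integrable (fun θ : ℝ × unitInterval =>
      queueProb S R rate B t f s (queueJump S R rate s e θ)) (B.prod volume) := by
    refine Integrable.of_bound (Measurable.aestronglyMeasurable ?_) 1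
      (Eventually.of_forall fun b => abs_queueProb_le_one S B hrate hfm hf _ _)
    exact (measurable_queueProb S B hrate hfm).comp (measurable_const.prodMk
      ((measurable_queueJump S hrate).comp (measurable_const.prodMk
        (measurable_const.prodMk measurable_id))))
  rw [integral_prod _ hi]
  have h1 : ∀ b : ℝ, ∫ v, queueProb S R rate B t f s (queueJump S R rate s e (b, v))
      = queueProb S R rate B t f s e + rate s (S.queueLength e) / R *
        (queueProb S R rate B t f s (S.arrive e b) - queueProb S R rate B t f s e) := by
    intro b
    rw [← integral_mark hR (hrate0 s _) (hrateR s _)]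
    refine integral_congr_ae (Eventually.of_forall fun v => ?_)
    simp only [queueJump]
    split_ifs <;> rfl
  have h2 := integrable_queueProb_arrive S B hrate hfm hf (R := R) (t := t) s e
  simp_rw [h1]
  have h3 : Integrable (fun b => queueProb S R rate B t f s (S.arrive e b)
      - queueProb S R rate B t f s e) B := h2.sub (integrable_const _)
  rw [integral_add (integrable_const _) (h3.const_mul _), integral_const_mul,
    integral_sub h2 (integrable_const _)]
  simp [potentialMean, arrivalGain]

omit hfm hf hrate0 hrateR hR in
theorem measurable_potentialMean (hfm : Measurable f) :
    Measurable fun p : ℝ × E => potentialMean S R rate B t f p.1 p.2 :=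
  (measurable_queueProb S B hrate hfm).add
    (((measurable_rate_queueLength S hrate).div_const R).mul (measurable_arrivalGain S B hrate hfm))

omit hfm hf hrate0 hrateR hR in
theorem measurable_potentialMean_path (hfm : Measurable f) (s : ℝ) (e : E) :
    Measurable fun x : ℝ => potentialMean S R rate B t f (s + x) (S.serve x e) := by
  have hpath : Measurable fun x : ℝ => (s + x, S.serve x e) :=
    Measurable.prodMk (by fun_prop) (S.measurable_serve.comp measurable_prodMk_right)
  exact (measurable_potentialMean S B hrate hfm).comp hpath

theorem abs_potentialMean_le (s : ℝ) (e : E) : |potentialMean S R rate B t f s e| ≤ 2 := by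
  have e1 := abs_queueProb_le_one S B hrate hfm hf (R := R) (t := t) s e
  have e2 := abs_arrivalGain_le_one S B hrate hfm hf (R := R) (t := t) s e
  have e3 : |rate s (S.queueLength e) / R| ≤ 1 := by
    rw [abs_of_nonneg (div_nonneg (hrate0 _ _) hR.le)]
    exact (div_le_one hR).2 (hrateR _ _)
  refine (abs_add_le _ _).trans ?_
  rw [abs_mul]
  have := mul_le_mul e3 e2 (abs_nonneg _) zero_le_one
  linarith

/-- Conditioning on the first potential arrival after `s`: with probability `exp (-(R * (t - s)))`
there is none before `t`; otherwise its time has an exponential density and the mean value after it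
is `potentialMean`. -/
theorem queueProb_eq_integral {s : ℝ} (hs : s ≤ t) (e : E) :
    queueProb S R rate B t f s e
      = Real.exp (-(R * (t - s))) * (f (S.serve (t - s) e)).toReal
        + ∫ x in Ioc 0 (t - s), R * Real.exp (-(R * x)) *
          potentialMean S R rate B t f (s + x) (S.serve x e) := by
  set n : ℝ × (ℝ × unitInterval) → ℝ := fun w =>
    nextValue S.serve (queueJump S R rate) R (queueProb S R rate B t f) t s e w with hn
  have hnm : Measurable n := (measurable_nextValue (c := R) S.measurable_serve
    (measurable_queueJump S hrate) (measurable_queueProb S B hrate hfm) t).comp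
      (measurable_prodMk_left (x := (s, e)))
  have hni : Integrable n ((expMeasure 1).prod (B.prod volume)) := by
    refine Integrable.of_bound hnm.aestronglyMeasurable 1 (Eventually.of_forall fun w => ?_)
    simp only [hn, nextValue]
    split_ifs <;> exact abs_queueProb_le_one S B hrate hfm hf _ _
  have h1 : queueProb S R rate B t f s e = ∫ w, n w ∂((expMeasure 1).prod (B.prod volume)) := by
    rw [integral_eq_lintegral_of_nonneg_ae _ hnm.aestronglyMeasurable, queueProb,
      ← lintegral_nextValue_queueValue S B hrate hR hfm hs]
    · congr 1
      refine lintegral_congr fun w => ?_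
      simp only [hn, nextValue]
      split_ifs <;> rw [ofReal_queueProb S B hrate hfm hf]
    · refine Eventually.of_forall fun w => ?_
      simp only [hn, nextValue, Pi.zero_apply]
      split_ifs <;> exact queueProb_nonneg S B _ _
  have h2 : ∀ ξ : ℝ, ∫ θ, n (ξ, θ) ∂(B.prod volume)
      = (fun x => if x ≤ t - s then potentialMean S R rate B t f (s + x) (S.serve x e)
          else (f (S.serve (t - s) e)).toReal) (ξ / R) := by
    intro ξ
    simp only [hn, nextValue]
    by_cases h : ξ / R ≤ t - s
    · have h' : s + ξ / R ≤ t := by linarith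
      simp only [h, h', if_true]
      exact integral_queueJump S B hR hrate hrate0 hrateR hfm hf _ _
    · have h' : ¬ s + ξ / R ≤ t := fun h2 => h (by linarith)
      simp only [h, h', if_false, integral_const, probReal_univ, one_smul]
      exact queueProb_of_le S B le_rfl _
  rw [h1, integral_prod _ hni, integral_congr_ae (Eventually.of_forall h2)]
  exact integral_expMeasure_one_terminal hR (by linarith)
    (measurable_potentialMean_path S B hrate hfm s e)
    (fun x => abs_potentialMean_le S B hR hrate hrate0 hrateR hfm hf _ _)

/-- The backward equation along the flow of the service discipline. -/
theorem queueProb_flow {τ x : ℝ} (z : E) (hx : 0 ≤ x) (hxt : τ + x ≤ t) :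
    queueProb S R rate B t f (τ + x) (S.serve x z) = queueProb S R rate B t f τ z
      + ∫ y in Ioc 0 x, -(rate (τ + y) (S.queueLength (S.serve y z)) *
        arrivalGain S R rate B t f (τ + y) (S.serve y z)) := by
  have hy : ∀ q, 0 ≤ q → q ≤ t - τ → queueProb S R rate B t f (τ + q) (S.serve q z)
      = Real.exp (-(R * (t - τ - q))) * (f (S.serve (t - τ) z)).toReal
        + ∫ v in Ioc 0 (t - τ - q), R * Real.exp (-(R * v)) *
          potentialMean S R rate B t f (τ + (q + v)) (S.serve (q + v) z) := by
    intro q hq hqL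
    rw [queueProb_eq_integral S B hR hrate hrate0 hrateR hfm hf (by linarith)]
    have e1 : t - (τ + q) = t - τ - q := by ring
    have e2 : S.serve (t - τ - q) (S.serve q z) = S.serve (t - τ) z := by
      rw [← S.serve_add _ _ _ hq (by linarith)]; congr 1; ring
    rw [e1, e2]
    congr 1
    refine setIntegral_congr_fun measurableSet_Ioc fun v hv => ?_
    rw [← S.serve_add _ _ _ hq hv.1.le, ← add_assoc]
  have h1 := eq_add_integral_of_backward
    (y := fun q => queueProb S R rate B t f (τ + q) (S.serve q z))
    (measurable_potentialMean_path S B hrate hfm τ z)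
    (fun x => abs_potentialMean_le S B hR hrate hrate0 hrateR hfm hf _ _) hy hx
    (by linarith : x ≤ t - τ)
  simp only [add_zero, S.serve_zero] at h1
  rw [h1]
  congr 1
  refine setIntegral_congr_fun measurableSet_Ioc fun v _ => ?_
  -- The difference of `queueProb` and `potentialMean` is `-(rate / R)` times the gain, so the
  -- artificial rate `R` of potential arrivals cancels.
  simp only [potentialMean]
  field_simp
  ring

end SingleQueue

/-! ### The JSQ(D) rule -/

section Combinatorics

variable {n : ℕ}

/-- The probability that server `i` receives a job arriving when the queue lengths are `x`. -/
noncomputable def receiveProb (D : ℕ) (x : Fin n → ℕ) (i : Fin n) : ℝ :=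
  (PMF.uniformOfFintype (Equiv.Perm (Fin n))).toMeasure.real {σ | Receives D x σ i}

open Classical in
theorem uniform_real_eq (p : Equiv.Perm (Fin n) → Prop) :
    (PMF.uniformOfFintype (Equiv.Perm (Fin n))).toMeasure.real {σ | p σ}
      = ((Finset.univ.filter p).card : ℝ) / (n.factorial : ℝ) := by
  rw [Measure.real, PMF.toMeasure_uniformOfFintype_apply _ MeasurableSpace.measurableSet_top,
    ENNReal.toReal_div]
  simp [Fintype.card_subtype, Fintype.card_perm]

theorem receives_unique {D : ℕ} {x : Fin n → ℕ} {σ : Equiv.Perm (Fin n)} {i j : Fin n}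
    (hi : Receives D x σ i) (hj : Receives D x σ j) : i = j := by
  have h1 := hi.2 j hj.1
  have h2 := hj.2 i hi.1
  have h3 : σ i = σ j := by
    rcases h1 with h1 | h1 <;> rcases h2 with h2 | h2
    · omega
    · omega
    · omega
    · exact le_antisymm h1.2 h2.2
  exact σ.injective h3

theorem exists_receives {D : ℕ} (hD : 1 ≤ D) (hn : 1 ≤ n) (x : Fin n → ℕ)
    (σ : Equiv.Perm (Fin n)) : ∃ i, Receives D x σ i := by
  classical
  have hne : (Finset.univ.filter fun j : Fin n => (σ j : ℕ) < D).Nonempty := by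
    refine ⟨σ.symm ⟨0, hn⟩, ?_⟩
    simp
    omega
  obtain ⟨i, hi, hmin⟩ := Finset.exists_min_image _ (fun j => toLex (x j, σ j)) hne
  simp only [Finset.mem_filter, Finset.mem_univ, true_and] at hi hmin
  refine ⟨i, hi, fun j hj => ?_⟩
  have := hmin j hj
  rw [Prod.Lex.toLex_le_toLex] at this
  exact this

/-- Exchanging the ranks of two servers with equal queues permutes the candidates without changing
their lengths, so the two servers exchange their roles. As the ranking is uniform, servers with
equal queues are equally likely to receive the job. -/
theorem receives_swap {D : ℕ} {x : Fin n → ℕ} {i j : Fin n} (hij : x i = x j)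
    (σ : Equiv.Perm (Fin n)) :
    Receives D x (σ * Equiv.swap i j) i ↔ Receives D x σ j := by
  have hx : ∀ k, x (Equiv.swap i j k) = x k := by
    intro k
    rcases eq_or_ne k i with rfl | hki
    · rw [Equiv.swap_apply_left, hij]
    · rcases eq_or_ne k j with rfl | hkj
      · rw [Equiv.swap_apply_right, hij]
      · rw [Equiv.swap_apply_of_ne_of_ne hki hkj]
  unfold Receives
  simp only [Equiv.Perm.mul_apply, Equiv.swap_apply_left]
  refine and_congr_right fun _ => ⟨fun h k hk => ?_, fun h k hk => ?_⟩
  · have := h (Equiv.swap i j k) (by simpa using hk)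
    rw [Equiv.swap_apply_self, hx, hij] at this
    exact this
  · have := h _ hk
    rw [hx, ← hij] at this
    exact this

theorem receiveProb_congr {D : ℕ} {x : Fin n → ℕ} {i j : Fin n} (hij : x i = x j) :
    receiveProb D x i = receiveProb D x j := by
  classical
  unfold receiveProb
  rw [uniform_real_eq, uniform_real_eq]
  congr 2
  refine Finset.card_bij' (fun σ _ => σ * Equiv.swap i j) (fun σ _ => σ * Equiv.swap i j) ?_ ?_ ?_ ?_
  · intro σ hσ
    simp only [Finset.mem_filter, Finset.mem_univ, true_and] at hσ ⊢
    rw [← receives_swap hij, mul_assoc, Equiv.swap_mul_self, mul_one]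
    exact hσ
  · intro σ hσ
    simp only [Finset.mem_filter, Finset.mem_univ, true_and] at hσ ⊢
    exact (receives_swap hij σ).2 hσ
  · intro σ _
    rw [mul_assoc, Equiv.swap_mul_self, mul_one]
  · intro σ _
    rw [mul_assoc, Equiv.swap_mul_self, mul_one]

theorem card_rank_lt_congr (D : ℕ) (i j : Fin n) :
    (Finset.univ.filter fun σ : Equiv.Perm (Fin n) => (σ i : ℕ) < D).card
      = (Finset.univ.filter fun σ : Equiv.Perm (Fin n) => (σ j : ℕ) < D).card := by
  refine Finset.card_bij' (fun σ _ => σ * Equiv.swap i j) (fun σ _ => σ * Equiv.swap i j) ?_ ?_ ?_ ?_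
  · intro σ hσ
    simpa using hσ
  · intro σ hσ
    simpa using hσ
  · intro σ _
    rw [mul_assoc, Equiv.swap_mul_self, mul_one]
  · intro σ _
    rw [mul_assoc, Equiv.swap_mul_self, mul_one]

theorem card_lt_of_perm {D : ℕ} (hD : D ≤ n) (σ : Equiv.Perm (Fin n)) :
    (Finset.univ.filter fun j : Fin n => (σ j : ℕ) < D).card = D := by
  have h1 : (Finset.univ.filter fun j : Fin n => (σ j : ℕ) < D)
      = (Finset.univ.filter fun j : Fin n => (j : ℕ) < D).map σ.symm.toEmbedding := by
    ext j
    simp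
  rw [h1, Finset.card_map]
  rcases hD.eq_or_lt with rfl | h
  · simp
  · have : (Finset.univ.filter fun j : Fin n => (j : ℕ) < D) = Finset.Iio (⟨D, h⟩ : Fin n) := by
      ext j; simp [Fin.lt_def]
    rw [this, Fin.card_Iio]

theorem receiveProb_nonneg (D : ℕ) (x : Fin n → ℕ) (i : Fin n) : 0 ≤ receiveProb D x i :=
  measureReal_nonneg

/-- No server receives more than its share of the sampled places. -/
theorem mul_receiveProb_le {D : ℕ} (hD : D ≤ n) (x : Fin n → ℕ) (i : Fin n) :
    (n : ℝ) * receiveProb D x i ≤ D := by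
  classical
  set c := (Finset.univ.filter fun σ : Equiv.Perm (Fin n) => (σ i : ℕ) < D).card with hc
  have h1 : n * c = D * n.factorial := by
    -- Double counting of the pairs of a ranking and a sampled server: each ranking samples `D`
    -- servers, and each server is sampled by the same number of rankings.
    have h2 : ∑ j : Fin n, (Finset.univ.filter fun σ : Equiv.Perm (Fin n) => (σ j : ℕ) < D).card
        = ∑ σ : Equiv.Perm (Fin n), (Finset.univ.filter fun j : Fin n => (σ j : ℕ) < D).card := by
      simp only [Finset.card_filter]
      exact Finset.sum_comm
    rw [Finset.sum_congr rfl fun j _ => card_rank_lt_congr D j i,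
      Finset.sum_congr rfl fun σ _ => card_lt_of_perm hD σ] at h2
    simpa [Fintype.card_perm, mul_comm] using h2
  have h3 : (Finset.univ.filter fun σ : Equiv.Perm (Fin n) => Receives D x σ i).card ≤ c :=
    Finset.card_le_card fun σ hσ => by
      simp only [Finset.mem_filter, Finset.mem_univ, true_and] at hσ ⊢
      exact hσ.1
  unfold receiveProb
  rw [uniform_real_eq, ← mul_div_assoc, div_le_iff₀ (by exact_mod_cast n.factorial_pos)]
  calc _ ≤ (n : ℝ) * c := by gcongr
    _ = D * n.factorial := by exact_mod_cast h1

/-- The set of the sampled servers. -/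
def sampleSet (D : ℕ) (σ : Equiv.Perm (Fin n)) : Finset (Fin n) :=
  Finset.univ.filter fun j => (σ j : ℕ) < D

theorem mem_sampleSet {D : ℕ} {σ : Equiv.Perm (Fin n)} {j : Fin n} :
    j ∈ sampleSet D σ ↔ (σ j : ℕ) < D := by
  simp [sampleSet]

/-- A bijection between two sets of servers of equal size extends to a permutation of all servers,
and composition with it carries one fibre to the other. Hence all sets of `D` servers are sampled
equally often. -/
theorem card_sampleSet_fiber {D : ℕ} {s s' : Finset (Fin n)} (h : s.card = s'.card) :
    (Finset.univ.filter fun σ : Equiv.Perm (Fin n) => sampleSet D σ = s).card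
      = (Finset.univ.filter fun σ : Equiv.Perm (Fin n) => sampleSet D σ = s').card := by
  let e : {x // x ∈ s} ≃ {x // x ∈ s'} := Finset.equivOfCardEq h
  let τ : Equiv.Perm (Fin n) := e.extendSubtype
  have hτ : ∀ j, τ j ∈ s' ↔ j ∈ s := by
    intro j
    constructor
    · intro hj
      by_contra hjs
      exact e.extendSubtype_not_mem j hjs hj
    · exact fun hj => e.extendSubtype_mem j hj
  refine Finset.card_bij' (fun σ _ => σ * τ⁻¹) (fun σ _ => σ * τ) ?_ ?_ ?_ ?_
  · intro σ hσ
    simp only [Finset.mem_filter, Finset.mem_univ, true_and] at hσ ⊢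
    ext j
    have h1 := Finset.ext_iff.1 hσ (τ⁻¹ j)
    have h2 := hτ (τ⁻¹ j)
    rw [show τ (τ⁻¹ j) = j from τ.apply_symm_apply j] at h2
    rw [h2, ← h1, mem_sampleSet, mem_sampleSet, Equiv.Perm.mul_apply]
  · intro σ hσ
    simp only [Finset.mem_filter, Finset.mem_univ, true_and] at hσ ⊢
    ext j
    have h1 := Finset.ext_iff.1 hσ (τ j)
    rw [← hτ, ← h1]
    rw [mem_sampleSet, mem_sampleSet, Equiv.Perm.mul_apply]
  · intro σ _
    simp
  · intro σ _
    simp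

open Classical in
theorem card_sampleSet_subset {D : ℕ} (hD : D ≤ n) (G : Finset (Fin n)) :
    ((Finset.univ.filter fun σ : Equiv.Perm (Fin n) => sampleSet D σ ⊆ G).card : ℝ)
        / (n.factorial : ℝ) = (G.card.choose D : ℝ) / (n.choose D : ℝ) := by
  have hcard : ∀ σ : Equiv.Perm (Fin n), (sampleSet D σ).card = D := fun σ => card_lt_of_perm hD σ
  set c := (Finset.univ.filter fun σ : Equiv.Perm (Fin n) =>
    sampleSet D σ = sampleSet D 1).card with hc
  have hG : ∀ G : Finset (Fin n),
      (Finset.univ.filter fun σ : Equiv.Perm (Fin n) => sampleSet D σ ⊆ G).card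
        = G.card.choose D * c := by
    intro G
    rw [Finset.card_eq_sum_card_fiberwise (f := sampleSet D) (t := G.powersetCard D)]
    · rw [Finset.sum_congr rfl (g := fun _ => c), Finset.sum_const, Finset.card_powersetCard,
        smul_eq_mul]
      intro s hs
      rw [Finset.mem_powersetCard] at hs
      rw [hc, ← card_sampleSet_fiber (D := D) (s := s) (hs.2.trans (hcard 1).symm)]
      congr 1
      ext σ
      simp only [Finset.mem_filter, Finset.mem_univ, true_and, and_iff_right_iff_imp]
      rintro rfl
      exact hs.1
    · intro σ hσ
      simp only [Finset.coe_filter, Finset.mem_univ, true_and, mem_ofPred_eq] at hσ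
      simp only [Finset.mem_coe, Finset.mem_powersetCard]
      exact ⟨hσ, hcard σ⟩
  -- For the set of all servers the count is `n!`, which determines the common fibre size `c` and
  -- shows that it is nonzero.
  have h1 := hG Finset.univ
  simp only [Finset.subset_univ, Finset.filter_true, Finset.card_univ, Fintype.card_perm,
    Fintype.card_fin] at h1
  rw [hG G, h1]
  have hc0 : (c : ℝ) ≠ 0 := by
    intro h
    have h2 : c = 0 := by exact_mod_cast h
    rw [h2, mul_zero] at h1
    exact n.factorial_ne_zero h1
  push_cast
  rw [mul_div_mul_right _ _ hc0]

/-- The job joins a server with at least `k` jobs exactly when every sampled server has at least `k`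
jobs, that is, when the sample lies within that set of servers. -/
theorem sum_receiveProb_ge {D : ℕ} (hD1 : 1 ≤ D) (hD : D ≤ n) (x : Fin n → ℕ) (k : ℕ) :
    ∑ i ∈ Finset.univ.filter (fun i => k ≤ x i), receiveProb D x i
      = ((numGE x k).choose D : ℝ) / (n.choose D : ℝ) := by
  classical
  unfold numGE
  rw [← card_sampleSet_subset hD]
  unfold receiveProb
  simp_rw [uniform_real_eq]
  rw [← Finset.sum_div]
  congr 1
  rw [← Nat.cast_sum]
  congr 1
  rw [← Finset.card_biUnion]
  · congr 1
    ext σ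
    simp only [Finset.mem_biUnion, Finset.mem_filter, Finset.mem_univ, true_and]
    constructor
    · rintro ⟨i, hi, hr⟩ j hj
      simp only [sampleSet, Finset.mem_filter, Finset.mem_univ, true_and] at hj ⊢
      rcases hr.2 j hj with h | h <;> omega
    · intro h
      obtain ⟨i, hi⟩ := exists_receives hD1 (hD1.trans hD) x σ
      refine ⟨i, ?_, hi⟩
      have := h (show i ∈ sampleSet D σ by simp [sampleSet, hi.1])
      simpa using this
  · intro i _ j _ hij
    rw [Function.onFun, Finset.disjoint_left]
    intro σ h1 h2
    simp only [Finset.mem_filter, Finset.mem_univ, true_and] at h1 h2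
    exact hij (receives_unique h1 h2)

theorem numGE_le (x : Fin n → ℕ) (k : ℕ) : numGE x k ≤ n := by
  unfold numGE
  simpa using Finset.card_le_univ (Finset.univ.filter fun i => k ≤ x i)

theorem card_eq_numGE_sub (x : Fin n → ℕ) (k : ℕ) :
    (Finset.univ.filter fun i => x i = k).card + numGE x (k + 1) = numGE x k := by
  unfold numGE
  rw [← Finset.card_union_of_disjoint]
  · congr 1
    ext i
    simp only [Finset.mem_union, Finset.mem_filter, Finset.mem_univ, true_and]
    omega
  · rw [Finset.disjoint_left]
    intro i h1 h2
    simp only [Finset.mem_filter, Finset.mem_univ, true_and] at h1 h2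
    omega

/-- Subtracting `sum_receiveProb_ge` at the levels `x i` and `x i + 1` leaves the servers of length
exactly `x i`, and these have equal probabilities. -/
theorem mul_receiveProb_eq {D : ℕ} (hD1 : 1 ≤ D) (hD : D ≤ n) (x : Fin n → ℕ) (i : Fin n) :
    ((numGE x (x i) : ℝ) - numGE x (x i + 1)) * receiveProb D x i
      = (((numGE x (x i)).choose D : ℝ) - (numGE x (x i + 1)).choose D) / (n.choose D : ℝ) := by
  have h1 := sum_receiveProb_ge hD1 hD x (x i)
  have h2 := sum_receiveProb_ge hD1 hD x (x i + 1)
  have h3 : (Finset.univ.filter fun j => x i ≤ x j)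
      = (Finset.univ.filter fun j => x j = x i) ∪ (Finset.univ.filter fun j => x i + 1 ≤ x j) := by
    ext j
    simp only [Finset.mem_union, Finset.mem_filter, Finset.mem_univ, true_and]
    omega
  rw [h3, Finset.sum_union, h2] at h1
  · have h4 : ∑ j ∈ Finset.univ.filter (fun j => x j = x i), receiveProb D x j
        = ((Finset.univ.filter fun j => x j = x i).card : ℝ) * receiveProb D x i := by
      rw [Finset.sum_congr rfl (g := fun _ => receiveProb D x i), Finset.sum_const, nsmul_eq_mul]
      intro j hj
      simp only [Finset.mem_filter, Finset.mem_univ, true_and] at hj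
      exact receiveProb_congr hj
    have h5 : ((Finset.univ.filter fun j => x j = x i).card : ℝ)
        = (numGE x (x i) : ℝ) - numGE x (x i + 1) := by
      rw [← card_eq_numGE_sub x (x i)]; push_cast; ring
    rw [h4, h5] at h1
    rw [sub_div, ← h1]
    ring
  · rw [Finset.disjoint_left]
    intro j h1 h2
    simp only [Finset.mem_filter, Finset.mem_univ, true_and] at h1 h2
    omega

theorem numGE_sub_pos (x : Fin n → ℕ) (i : Fin n) : numGE x (x i + 1) < numGE x (x i) := by
  have h := card_eq_numGE_sub x (x i)
  have : 0 < (Finset.univ.filter fun j => x j = x i).card :=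
    Finset.card_pos.2 ⟨i, by simp⟩
  omega

/-- The absorption identity `(m - 1).choose (i - 1) / i = m.choose i / m` reduces the sum to
Vandermonde's identity without its term `i = 0`. -/
theorem sum_choose_mul_choose {D m p : ℕ} (hm : 0 < m) :
    ∑ i ∈ Finset.Icc 1 D, (1 / (i : ℝ)) * (((m - 1).choose (i - 1) * p.choose (D - i) : ℕ) : ℝ)
      = (((m + p).choose D : ℝ) - p.choose D) / m := by
  have h1 : ∀ i ∈ Finset.Icc 1 D, (1 / (i : ℝ)) *
      (((m - 1).choose (i - 1) * p.choose (D - i) : ℕ) : ℝ)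
      = ((m.choose i * p.choose (D - i) : ℕ) : ℝ) / m := by
    intro i hi
    rw [Finset.mem_Icc] at hi
    obtain ⟨i, rfl⟩ : ∃ j, i = j + 1 := ⟨i - 1, by omega⟩
    obtain ⟨m, rfl⟩ : ∃ j, m = j + 1 := ⟨m - 1, by omega⟩
    have h := Nat.add_one_mul_choose_eq m i
    have h' : ((m : ℝ) + 1) * m.choose i = (m + 1).choose (i + 1) * ((i : ℝ) + 1) := by
      exact_mod_cast h
    simp only [Nat.add_sub_cancel]
    push_cast
    have : (i : ℝ) + 1 ≠ 0 := by positivity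
    have : (m : ℝ) + 1 ≠ 0 := by positivity
    field_simp
    linear_combination (p.choose (D - (i + 1)) : ℝ) * h'
  rw [Finset.sum_congr rfl h1, ← Finset.sum_div]
  congr 1
  rw [Nat.add_choose_eq, Finset.Nat.sum_antidiagonal_eq_sum_range_succ_mk,
    Finset.sum_range_succ']
  push_cast
  simp only [Nat.choose_zero_right, Nat.cast_one, one_mul, Nat.sub_zero, add_sub_cancel_right]
  rw [Finset.range_eq_Ico, Finset.sum_Ico_add' (fun i => (m.choose i : ℝ) * p.choose (D - i)) 0 D 1]
  rfl

/-- The tagged rate is the arrival rate of server `0`. -/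
theorem taggedRate_eq {N D : ℕ} (lam : ℝ) (hD1 : 1 ≤ D) (hD : D ≤ N + 1) (x : Fin (N + 1) → ℕ) :
    taggedRate lam D x (x 0) = lam * ((N + 1 : ℕ) : ℝ) * receiveProb D x 0 := by
  have h0 := numGE_sub_pos x 0
  have h1 := mul_receiveProb_eq hD1 hD x 0
  have hm : (0 : ℝ) < (numGE x (x 0) : ℝ) - numGE x (x 0 + 1) := by
    rw [sub_pos]; exact_mod_cast h0
  have h2 := sum_choose_mul_choose (D := D) (m := numGE x (x 0) - numGE x (x 0 + 1))
    (p := numGE x (x 0 + 1)) (by omega)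
  rw [Nat.sub_add_cancel h0.le, Nat.cast_sub h0.le] at h2
  unfold taggedRate
  rw [if_pos rfl]
  congr 1
  rw [← Finset.sum_div, h2, ← mul_right_inj' hm.ne', h1]
  field_simp

end Combinatorics

/-! ### The limiting form of the arrival rate -/

/-- The polynomial `∑_{l < D} a ^ l * b ^ (D - 1 - l) = (a ^ D - b ^ D) / (a - b)`. -/
noncomputable def jsqPoly : ℕ → ℝ → ℝ → ℝ
  | 0, _, _ => 0
  | D + 1, a, b => a ^ D + b * jsqPoly D a b

theorem measurable_jsqPoly (D : ℕ) : Measurable fun p : ℝ × ℝ => jsqPoly D p.1 p.2 := by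
  induction D with
  | zero => exact measurable_const
  | succ D ih => exact (measurable_fst.pow_const D).add (measurable_snd.mul ih)

theorem jsqPoly_nonneg (D : ℕ) {a b : ℝ} (ha : 0 ≤ a) (hb : 0 ≤ b) : 0 ≤ jsqPoly D a b := by
  induction D with
  | zero => exact le_rfl
  | succ D ih => exact add_nonneg (pow_nonneg ha D) (mul_nonneg hb ih)

theorem jsqPoly_le (D : ℕ) {a b : ℝ} (ha : 0 ≤ a) (ha1 : a ≤ 1) (hb : 0 ≤ b) (hb1 : b ≤ 1) :
    jsqPoly D a b ≤ D := by
  induction D with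
  | zero => simp [jsqPoly]
  | succ D ih =>
    have h1 := pow_le_one₀ (n := D) ha ha1
    have h2 := jsqPoly_nonneg D ha hb
    simp only [jsqPoly]
    push_cast
    nlinarith

theorem abs_pow_sub_pow_le' (D : ℕ) {a a' : ℝ} (ha : 0 ≤ a) (ha1 : a ≤ 1) (ha' : 0 ≤ a')
    (ha1' : a' ≤ 1) : |a ^ D - a' ^ D| ≤ D * |a - a'| := by
  induction D with
  | zero => simp
  | succ D ih =>
    have h1 : a ^ (D + 1) - a' ^ (D + 1) = a * (a ^ D - a' ^ D) + a' ^ D * (a - a') := by ring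
    rw [h1]
    refine (abs_add_le _ _).trans ?_
    rw [abs_mul, abs_mul, abs_of_nonneg ha, abs_of_nonneg (pow_nonneg ha' D)]
    have h2 := pow_le_one₀ (n := D) ha' ha1'
    have h3 := mul_le_mul ha1 ih (abs_nonneg _) zero_le_one
    have h4 := mul_le_mul_of_nonneg_right h2 (abs_nonneg (a - a'))
    push_cast
    linarith

theorem abs_jsqPoly_sub_le (D : ℕ) {a b a' b' : ℝ} (ha : 0 ≤ a) (ha1 : a ≤ 1) (hb : 0 ≤ b)
    (hb1 : b ≤ 1) (ha' : 0 ≤ a') (ha1' : a' ≤ 1) (hb' : 0 ≤ b') (hb1' : b' ≤ 1) :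
    |jsqPoly D a b - jsqPoly D a' b'| ≤ (D : ℝ) ^ 2 * (|a - a'| + |b - b'|) := by
  induction D with
  | zero => simp [jsqPoly]
  | succ D ih =>
    have h1 : jsqPoly (D + 1) a b - jsqPoly (D + 1) a' b'
        = (a ^ D - a' ^ D) + (b * (jsqPoly D a b - jsqPoly D a' b')
          + jsqPoly D a' b' * (b - b')) := by
      simp only [jsqPoly]; ring
    rw [h1]
    have h2 := abs_pow_sub_pow_le' D ha ha1 ha' ha1'
    have h3 : |b * (jsqPoly D a b - jsqPoly D a' b') + jsqPoly D a' b' * (b - b')|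
        ≤ (D : ℝ) ^ 2 * (|a - a'| + |b - b'|) + D * |b - b'| := by
      refine (abs_add_le _ _).trans ?_
      rw [abs_mul, abs_mul, abs_of_nonneg hb, abs_of_nonneg (jsqPoly_nonneg D ha' hb')]
      have e1 := mul_le_mul hb1 ih (abs_nonneg _) zero_le_one
      have e2 := mul_le_mul_of_nonneg_right (jsqPoly_le D ha' ha1' hb' hb1') (abs_nonneg (b - b'))
      linarith
    refine (abs_add_le _ _).trans ?_
    have h4 : 0 ≤ |a - a'| + |b - b'| := by positivity
    have h5 : 0 ≤ (D : ℝ) * (|a - a'| + |b - b'|) := by positivity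
    push_cast
    nlinarith

/-- The scaled falling factorial. -/
noncomputable def fallProd (n : ℝ) (D : ℕ) (a : ℝ) : ℝ := ∏ j ∈ Finset.range D, (a - j / n)

/-- The divided difference of `fallProd`. -/
noncomputable def fallDiff (n : ℝ) : ℕ → ℝ → ℝ → ℝ
  | 0, _, _ => 0
  | D + 1, a, b => fallProd n D a + (b - D / n) * fallDiff n D a b

theorem fallProd_succ (n : ℝ) (D : ℕ) (a : ℝ) :
    fallProd n (D + 1) a = fallProd n D a * (a - D / n) := Finset.prod_range_succ _ _

theorem fallProd_sub (n : ℝ) (D : ℕ) (a b : ℝ) :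
    fallProd n D a - fallProd n D b = (a - b) * fallDiff n D a b := by
  induction D with
  | zero => simp [fallProd, fallDiff]
  | succ D ih =>
    rw [fallProd_succ, fallProd_succ, fallDiff]
    linear_combination (b - D / n) * ih

/-- Rescaling by `n ^ D` turns binomial coefficients into functions of the fraction `k / n`, which
are close to its `D`-th power for large `n`. -/
theorem choose_mul_factorial_eq {n : ℝ} (hn : n ≠ 0) (k D : ℕ) :
    (k.choose D : ℝ) * D.factorial = n ^ D * fallProd n D (k / n) := by
  induction D with
  | zero => simp [fallProd]
  | succ D ih =>
    have h1 : (k.choose (D + 1) : ℝ) * (D + 1) = k.choose D * ((k : ℝ) - D) := by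
      rcases le_or_gt D k with h | h
      · rw [← Nat.cast_sub h]
        exact_mod_cast Nat.choose_succ_right_eq k D
      · rw [Nat.choose_eq_zero_of_lt h, Nat.choose_eq_zero_of_lt (h.trans (Nat.lt_succ_self D))]
        simp
    rw [Nat.factorial_succ, fallProd_succ, pow_succ]
    push_cast
    have h2 : n ^ D * n * (fallProd n D (k / n) * (k / n - D / n))
        = (n ^ D * fallProd n D (k / n)) * (k - D) := by field_simp
    rw [h2, ← ih]
    linear_combination (D.factorial : ℝ) * h1

theorem fallProd_one_pos {n : ℝ} {D : ℕ} (hn : 0 < n) (hD : (D : ℝ) ≤ n) : 0 < fallProd n D 1 := by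
  refine Finset.prod_pos fun j hj => ?_
  rw [Finset.mem_range] at hj
  rw [sub_pos, div_lt_one hn]
  exact lt_of_lt_of_le (by exact_mod_cast hj) hD

/-- Writing the difference of the binomials as a divided difference cancels the number of servers of
length `x i`. The comparison with `jsqPoly` is therefore uniform, however few such servers there
are. -/
theorem mul_receiveProb_eq_fallDiff {n D : ℕ} (hD1 : 1 ≤ D) (hD : D ≤ n) (x : Fin n → ℕ)
    (i : Fin n) :
    (n : ℝ) * receiveProb D x i
      = fallDiff n D (numGE x (x i) / n) (numGE x (x i + 1) / n) / fallProd n D 1 := by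
  have hn : (0 : ℝ) < n := by exact_mod_cast (by omega : 0 < n)
  have h0 := numGE_sub_pos x i
  have hm : (0 : ℝ) < (numGE x (x i) : ℝ) - numGE x (x i + 1) := by
    rw [sub_pos]; exact_mod_cast h0
  have h1 := mul_receiveProb_eq hD1 hD x i
  have hf : (0 : ℝ) < D.factorial := by exact_mod_cast D.factorial_pos
  have h2 : (((numGE x (x i)).choose D : ℝ) - (numGE x (x i + 1)).choose D) * D.factorial
      = (n : ℝ) ^ D * ((numGE x (x i) / n - numGE x (x i + 1) / n) *
        fallDiff n D (numGE x (x i) / n) (numGE x (x i + 1) / n)) := by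
    rw [sub_mul, choose_mul_factorial_eq hn.ne', choose_mul_factorial_eq hn.ne', ← fallProd_sub]
    ring
  have h3 := choose_mul_factorial_eq hn.ne' n D
  rw [div_self hn.ne'] at h3
  have hp := fallProd_one_pos hn (D := D) (by exact_mod_cast hD)
  have hc : (0 : ℝ) < n.choose D := by exact_mod_cast Nat.choose_pos hD
  rw [eq_div_iff hc.ne'] at h1
  rw [eq_div_iff hp.ne']
  set q := fallDiff n D (numGE x (x i) / n) (numGE x (x i + 1) / n)
  set A := (numGE x (x i) : ℝ)
  set b := (numGE x (x i + 1) : ℝ)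
  set r := receiveProb D x i
  have h4 : (n : ℝ) ^ D ≠ 0 := by positivity
  have h5 : (n : ℝ) ^ D * (A / n - b / n) ≠ 0 := by
    rw [← sub_div]; positivity
  have h6 : ((A - b) * r * n.choose D) * D.factorial = (n : ℝ) ^ D * ((A / n - b / n) * q) := by
    rw [h1, h2]
  rw [← mul_right_inj' h5]
  have h7 : (n : ℝ) ^ D * (A / n - b / n) * (n * r * fallProd n D 1)
      = (A - b) * r * (n ^ D * fallProd n D 1) := by field_simp
  rw [h7, ← h3]
  linear_combination h6

theorem abs_fallProd_le_one {n a : ℝ} {D : ℕ} (hn : 0 < n) (hD : (D : ℝ) ≤ n) (ha : 0 ≤ a)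
    (ha1 : a ≤ 1) : |fallProd n D a| ≤ 1 := by
  unfold fallProd
  rw [Finset.abs_prod]
  refine Finset.prod_le_one (fun _ _ => abs_nonneg _) fun j hj => ?_
  rw [Finset.mem_range] at hj
  have h1 : (j : ℝ) / n ≤ 1 := (div_le_one hn).2 ((by exact_mod_cast hj.le : (j : ℝ) ≤ D).trans hD)
  have h2 : 0 ≤ (j : ℝ) / n := by positivity
  rw [abs_le]
  constructor <;> linarith

theorem abs_fallProd_sub_pow_le {n a : ℝ} {D : ℕ} (hn : 0 < n) (hD : (D : ℝ) ≤ n) (ha : 0 ≤ a)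
    (ha1 : a ≤ 1) : |fallProd n D a - a ^ D| ≤ (D : ℝ) ^ 2 / n := by
  induction D with
  | zero => simp [fallProd]
  | succ D ih =>
    push_cast at hD
    have hD' : (D : ℝ) ≤ n := by linarith
    have h1 := ih hD'
    have h2 := abs_fallProd_le_one hn hD' ha ha1
    have h3 : fallProd n (D + 1) a - a ^ (D + 1)
        = a * (fallProd n D a - a ^ D) + -(D / n * fallProd n D a) := by
      rw [fallProd_succ]; ring
    rw [h3]
    refine (abs_add_le _ _).trans ?_
    rw [abs_neg, abs_mul, abs_mul, abs_of_nonneg ha, abs_of_nonneg (by positivity : 0 ≤ (D : ℝ) / n)]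
    have e1 := mul_le_mul ha1 h1 (abs_nonneg _) zero_le_one
    have e2 := mul_le_mul_of_nonneg_left h2 (by positivity : 0 ≤ (D : ℝ) / n)
    calc _ ≤ 1 * ((D : ℝ) ^ 2 / n) + D / n * 1 := add_le_add e1 e2
      _ = ((D : ℝ) ^ 2 + D) / n := by ring
      _ ≤ _ := by
        push_cast
        gcongr
        nlinarith [(by positivity : 0 ≤ (D : ℝ))]

theorem abs_fallDiff_le {n a b : ℝ} {D : ℕ} (hn : 0 < n) (hD : (D : ℝ) ≤ n) (ha : 0 ≤ a)
    (ha1 : a ≤ 1) (hb : 0 ≤ b) (hb1 : b ≤ 1) : |fallDiff n D a b| ≤ D := by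
  induction D with
  | zero => simp [fallDiff]
  | succ D ih =>
    push_cast at hD
    have hD' : (D : ℝ) ≤ n := by linarith
    have h1 := ih hD'
    have h2 := abs_fallProd_le_one hn hD' ha ha1
    have h3 : |b - D / n| ≤ 1 := by
      have h1 : (D : ℝ) / n ≤ 1 := (div_le_one hn).2 hD'
      have h2 : 0 ≤ (D : ℝ) / n := by positivity
      rw [abs_le]
      constructor <;> linarith
    rw [fallDiff]
    refine (abs_add_le _ _).trans ?_
    rw [abs_mul]
    have e1 := mul_le_mul h3 h1 (abs_nonneg _) zero_le_one
    push_cast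
    linarith

theorem abs_fallDiff_sub_le {n a b : ℝ} {D : ℕ} (hn : 0 < n) (hD : (D : ℝ) ≤ n) (ha : 0 ≤ a)
    (ha1 : a ≤ 1) (hb : 0 ≤ b) (hb1 : b ≤ 1) :
    |fallDiff n D a b - jsqPoly D a b| ≤ 2 * (D : ℝ) ^ 3 / n := by
  induction D with
  | zero => simp [fallDiff, jsqPoly]
  | succ D ih =>
    push_cast at hD
    have hD' : (D : ℝ) ≤ n := by linarith
    have h1 := ih hD'
    have h2 := abs_fallProd_sub_pow_le hn hD' ha ha1
    have h4 := abs_fallDiff_le hn hD' ha ha1 hb hb1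
    have h3 : fallDiff n (D + 1) a b - jsqPoly (D + 1) a b = (fallProd n D a - a ^ D)
        + (b * (fallDiff n D a b - jsqPoly D a b) + -(D / n * fallDiff n D a b)) := by
      rw [fallDiff, jsqPoly]; ring
    rw [h3]
    have h5 : |b * (fallDiff n D a b - jsqPoly D a b) + -(D / n * fallDiff n D a b)|
        ≤ 1 * (2 * (D : ℝ) ^ 3 / n) + D / n * D := by
      refine (abs_add_le _ _).trans ?_
      rw [abs_neg, abs_mul, abs_mul, abs_of_nonneg hb,
        abs_of_nonneg (by positivity : 0 ≤ (D : ℝ) / n)]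
      exact add_le_add (mul_le_mul hb1 h1 (abs_nonneg _) zero_le_one)
        (mul_le_mul_of_nonneg_left h4 (by positivity))
    refine (abs_add_le _ _).trans ((add_le_add h2 h5).trans ?_)
    calc (D : ℝ) ^ 2 / n + (1 * (2 * (D : ℝ) ^ 3 / n) + D / n * D)
        = (2 * (D : ℝ) ^ 3 + 2 * D ^ 2) / n := by ring
      _ ≤ _ := by
        push_cast
        gcongr
        nlinarith [(by positivity : 0 ≤ (D : ℝ)), (by positivity : 0 ≤ (D : ℝ) ^ 2)]

/-- The bound on the difference between the arrival rate of a server and its limiting form. -/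
noncomputable def rateError (D : ℕ) (n : ℕ) : ℝ :=
  D * |(fallProd n D 1)⁻¹ - 1| + 2 * (D : ℝ) ^ 3 / n

theorem rateError_nonneg (D n : ℕ) : 0 ≤ rateError D n := by
  unfold rateError; positivity

theorem tendsto_rateError (D : ℕ) : Tendsto (rateError D) atTop (𝓝 0) := by
  have h1 : Tendsto (fun n : ℕ => fallProd n D 1) atTop (𝓝 1) := by
    have : Tendsto (fun n : ℕ => ∏ j ∈ Finset.range D, ((1 : ℝ) - j / n)) atTop
        (𝓝 (∏ j ∈ Finset.range D, (1 - 0))) := by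
      refine tendsto_finsetProd _ fun j _ => ?_
      exact tendsto_const_nhds.sub (tendsto_const_div_atTop_nhds_zero_nat (j : ℝ))
    simpa [fallProd] using this
  have h2 : Tendsto (fun n : ℕ => (D : ℝ) * |(fallProd n D 1)⁻¹ - 1|) atTop
      (𝓝 (D * |(1 : ℝ)⁻¹ - 1|)) :=
    (((h1.inv₀ one_ne_zero).sub_const 1).abs).const_mul _
  have h3 := h2.add (tendsto_const_div_atTop_nhds_zero_nat (2 * (D : ℝ) ^ 3))
  have h4 : rateError D = fun n : ℕ => (D : ℝ) * |(fallProd n D 1)⁻¹ - 1| + 2 * (D : ℝ) ^ 3 / n := rfl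
  rw [h4]
  simpa using h3

theorem abs_mul_receiveProb_sub_le {n D : ℕ} (hD1 : 1 ≤ D) (hD : D ≤ n) (x : Fin n → ℕ)
    (i : Fin n) :
    |(n : ℝ) * receiveProb D x i - jsqPoly D (numGE x (x i) / n) (numGE x (x i + 1) / n)|
      ≤ rateError D n := by
  have hn : (0 : ℝ) < n := by exact_mod_cast (by omega : 0 < n)
  have hD' : (D : ℝ) ≤ n := by exact_mod_cast hD
  rw [mul_receiveProb_eq_fallDiff hD1 hD]
  set a := (numGE x (x i) : ℝ) / n
  set b := (numGE x (x i + 1) : ℝ) / n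
  have ha : 0 ≤ a := by positivity
  have hb : 0 ≤ b := by positivity
  have ha1 : a ≤ 1 := (div_le_one hn).2 (by exact_mod_cast numGE_le x _)
  have hb1 : b ≤ 1 := (div_le_one hn).2 (by exact_mod_cast numGE_le x _)
  have h1 : fallDiff n D a b / fallProd n D 1 - jsqPoly D a b
      = fallDiff n D a b * ((fallProd n D 1)⁻¹ - 1) + (fallDiff n D a b - jsqPoly D a b) := by
    rw [div_eq_mul_inv]; ring
  rw [h1]
  refine (abs_add_le _ _).trans ?_
  rw [abs_mul]
  exact add_le_add (mul_le_mul_of_nonneg_right (abs_fallDiff_le hn hD' ha ha1 hb hb1)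
    (abs_nonneg _)) (abs_fallDiff_sub_le hn hD' ha ha1 hb hb1)

/-! ### The system of `n` servers -/

theorem ServiceDiscipline.queueLength_serve_le {E : Type*} [MeasurableSpace E]
    (S : ServiceDiscipline E) {t : ℝ} (ht : 0 ≤ t) (e : E) :
    S.queueLength (S.serve t e) ≤ S.queueLength e := by
  obtain ⟨p, h1, h2, -, -⟩ := S.jobs_serve t e ht
  rw [ServiceDiscipline.queueLength, ServiceDiscipline.queueLength, ← h1, ← h2]
  refine (Multiset.card_le_card (Multiset.filter_le _ _)).trans ?_
  simp

theorem ServiceDiscipline.queueLength_arrive {E : Type*} [MeasurableSpace E]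
    (S : ServiceDiscipline E) (e : E) {b : ℝ} (hb : 0 < b) :
    S.queueLength (S.arrive e b) = S.queueLength e + 1 := by
  simp [ServiceDiscipline.queueLength, S.jobs_arrive e b hb]

instance (n : ℕ) : DiscreteMeasurableSpace (Equiv.Perm (Fin n)) := ⟨fun _ => trivial⟩

section System

variable {E : Type*} [MeasurableSpace E] (S : ServiceDiscipline E) (D : ℕ) {n : ℕ}

/-- The evolution of `n` servers without arrivals. -/
def systemFlow (s : ℝ) (z : Fin n → E) : Fin n → E := fun i => S.serve s (z i)

open Classical in
/-- The effect of an arrival on `n` servers. -/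
noncomputable def systemJump (_ : ℝ) (y : Fin n → E) (θ : ℝ × Equiv.Perm (Fin n)) : Fin n → E :=
  fun i => if Receives D (fun j => S.queueLength (y j)) θ.2 i then S.arrive (y i) θ.1 else y i

/-- The law of the service requirement and the ranking of the servers at an arrival. -/
noncomputable def markLaw (B : Measure ℝ) (n : ℕ) : Measure (ℝ × Equiv.Perm (Fin n)) :=
  B.prod (PMF.uniformOfFintype (Equiv.Perm (Fin n))).toMeasure

instance (B : Measure ℝ) [IsProbabilityMeasure B] : IsProbabilityMeasure (markLaw B n) := by
  unfold markLaw; infer_instance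

theorem systemMeasure_eq (B : Measure ℝ) [IsProbabilityMeasure B] (μ : Measure (Fin n → E)) :
    systemMeasure B μ = drivingLaw μ (markLaw B n) := rfl

instance (B : Measure ℝ) [IsProbabilityMeasure B] (μ : Measure (Fin n → E))
    [IsProbabilityMeasure μ] : IsProbabilityMeasure (systemMeasure B μ) := by
  rw [systemMeasure_eq]; infer_instance

theorem stateAfter_eq (c : ℝ) (ω : SystemPath E n) (m : ℕ) :
    stateAfter S D c ω m = chainState (systemFlow S) (systemJump S D) c ω m := by
  induction m with
  | zero => rfl
  | succ m ih =>
    rw [stateAfter, chainState, ← ih]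
    rfl

theorem systemState_eq (lam : ℝ) (ω : SystemPath E n) (t : ℝ) :
    systemState S D lam ω t = stateAt (systemFlow S) (systemJump S D) (lam * n) ω t := by
  funext i
  simp only [systemState, stateAt, stateAfter_eq]
  rfl

theorem measurable_systemFlow :
    Measurable fun p : ℝ × (Fin n → E) => systemFlow S p.1 p.2 := by
  refine measurable_pi_lambda _ fun i => ?_
  exact S.measurable_serve.comp (by fun_prop : Measurable fun p : ℝ × (Fin n → E) => (p.1, p.2 i))

theorem measurableSet_receives (i : Fin n) :
    MeasurableSet {p : (Fin n → E) × Equiv.Perm (Fin n) |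
      Receives D (fun j => S.queueLength (p.1 j)) p.2 i} := by
  have h1 : Measurable fun p : (Fin n → E) × Equiv.Perm (Fin n) =>
      ((fun j => S.queueLength (p.1 j) : Fin n → ℕ), p.2) :=
    (measurable_pi_lambda _ fun j => (measurable_queueLength S).comp (by fun_prop)).prodMk
      measurable_snd
  exact h1 (MeasurableSet.of_discrete (s := {q : (Fin n → ℕ) × Equiv.Perm (Fin n) |
    Receives D q.1 q.2 i}))

theorem measurable_systemJump :
    Measurable fun p : ℝ × (Fin n → E) × ℝ × Equiv.Perm (Fin n) =>
      systemJump S D p.1 p.2.1 p.2.2 := by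
  classical
  refine measurable_pi_lambda _ fun i => Measurable.ite ?_ ?_ (by fun_prop)
  · exact (by fun_prop : Measurable fun p : ℝ × (Fin n → E) × ℝ × Equiv.Perm (Fin n) =>
      (p.2.1, p.2.2.2)) (measurableSet_receives S D i)
  · exact S.measurable_arrive.comp (by fun_prop :
      Measurable fun p : ℝ × (Fin n → E) × ℝ × Equiv.Perm (Fin n) => (p.2.1 i, p.2.2.1))

theorem measurable_systemState (lam : ℝ) :
    Measurable fun p : SystemPath E n × ℝ => systemState S D lam p.1 p.2 := by
  simp only [systemState_eq]
  exact measurable_stateAt (measurable_systemFlow S) (measurable_systemJump S D)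

theorem measurable_queueLengths (lam : ℝ) (i : Fin n) :
    Measurable fun p : SystemPath E n × ℝ => queueLengths S D lam p.1 p.2 i :=
  (measurable_queueLength S).comp ((measurable_pi_apply i).comp (measurable_systemState S D lam))

theorem integral_receives (x : Fin n → ℕ) (i : Fin n) :
    ∫ σ, ({σ | Receives D x σ i}.indicator (fun _ => (1 : ℝ)) σ)
      ∂(PMF.uniformOfFintype (Equiv.Perm (Fin n))).toMeasure = receiveProb D x i := by
  rw [integral_indicator_const _ MeasurableSet.of_discrete, smul_eq_mul, mul_one]
  rfl

/-! ### The drift of weighted sums of value functions in the system of `n` servers. -/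

section Generator

variable {S D}
variable {R : ℝ} {rate : ℝ → ℕ → ℝ} (B : Measure ℝ) [IsProbabilityMeasure B]
  (hR : 0 < R) (hrate : ∀ k, Measurable fun t => rate t k)
  (hrate0 : ∀ s k, 0 ≤ rate s k) (hrateR : ∀ s k, rate s k ≤ R) {t : ℝ} {f : E → ENNReal}
  (hfm : Measurable f) (hf : ∀ e, f e ≤ 1)

include hrate hfm hf

omit [IsProbabilityMeasure B] hrate hfm hf in
theorem queueProb_systemJump_sub (s : ℝ) (z : Fin n → E) (θ : ℝ × Equiv.Perm (Fin n)) (i : Fin n) :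
    queueProb S R rate B t f s (systemJump S D s z θ i) - queueProb S R rate B t f s (z i)
      = (queueProb S R rate B t f s (S.arrive (z i) θ.1) - queueProb S R rate B t f s (z i)) *
        {σ | Receives D (fun j => S.queueLength (z j)) σ i}.indicator (fun _ => (1 : ℝ)) θ.2 := by
  by_cases h : Receives D (fun j => S.queueLength (z j)) θ.2 i <;>
    simp [systemJump, h]

/-- At most one server receives the job, so at most one summand changes, and by no more than its
weight. -/
theorem abs_sum_systemJump_sub_le {w : Fin n → ℝ} {a : ℝ} (ha : 0 ≤ a) (hw0 : ∀ i, 0 ≤ w i)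
    (hwa : ∀ i, w i ≤ a) (s : ℝ) (z : Fin n → E) (θ : ℝ × Equiv.Perm (Fin n)) :
    |∑ i, w i * queueProb S R rate B t f s (systemJump S D s z θ i)
      - ∑ i, w i * queueProb S R rate B t f s (z i)| ≤ a := by
  rw [← Finset.sum_sub_distrib]
  simp only [← mul_sub, queueProb_systemJump_sub B]
  have hle : ∀ i, |queueProb S R rate B t f s (S.arrive (z i) θ.1)
      - queueProb S R rate B t f s (z i)| ≤ 1 := fun i => by
    have h1 := queueProb_le_one S B hrate hfm hf (R := R) (t := t) s (z i)
    have h2 := queueProb_le_one S B hrate hfm hf (R := R) (t := t) s (S.arrive (z i) θ.1)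
    have h3 : 0 ≤ queueProb S R rate B t f s (z i) := queueProb_nonneg S B _ _
    have h4 : 0 ≤ queueProb S R rate B t f s (S.arrive (z i) θ.1) := queueProb_nonneg S B _ _
    rw [abs_le]; constructor <;> linarith
  by_cases h : ∃ i, Receives D (fun j => S.queueLength (z j)) θ.2 i
  · obtain ⟨i, hi⟩ := h
    rw [Finset.sum_eq_single i]
    · simp only [indicator, mem_ofPred_eq, hi, if_true, mul_one]
      rw [abs_mul, abs_of_nonneg (hw0 i)]
      exact (mul_le_mul (hwa i) (hle i) (abs_nonneg _) ha).trans (mul_one a).le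
    · intro j _ hj
      have : ¬ Receives D (fun j => S.queueLength (z j)) θ.2 j :=
        fun hj' => hj (receives_unique hj' hi)
      simp [this]
    · simp
  · push Not at h
    simp [h, ha]

/-- The service requirement is independent of the ranking, so the mean change at server `i`
factorizes into its probability of receiving the job and its gain. -/
theorem integral_sum_systemJump (w : Fin n → ℝ) (s : ℝ) (z : Fin n → E) :
    (∫ θ, (∑ i, w i * queueProb S R rate B t f s (systemJump S D s z θ i)) ∂(markLaw B n))
      - ∑ i, w i * queueProb S R rate B t f s (z i)
      = ∑ i, w i * (receiveProb D (fun j => S.queueLength (z j)) i *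
        arrivalGain S R rate B t f s (z i)) := by
  have hi : ∀ i, ∫ θ, queueProb S R rate B t f s (systemJump S D s z θ i)
      - queueProb S R rate B t f s (z i) ∂(markLaw B n)
      = receiveProb D (fun j => S.queueLength (z j)) i * arrivalGain S R rate B t f s (z i) := by
    intro i
    simp only [queueProb_systemJump_sub B]
    rw [markLaw, integral_prod_mul (fun b => queueProb S R rate B t f s (S.arrive (z i) b)
      - queueProb S R rate B t f s (z i)), integral_receives,
      integral_sub (integrable_queueProb_arrive S B hrate hfm hf s (z i)) (integrable_const _),
      arrivalGain]
    simp [mul_comm]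
  have hint : ∀ i, Integrable (fun θ => queueProb S R rate B t f s (systemJump S D s z θ i))
      (markLaw B n) := fun i => by
    refine Integrable.of_bound (Measurable.aestronglyMeasurable ?_) 1
      (Eventually.of_forall fun b => abs_queueProb_le_one S B hrate hfm hf _ _)
    refine (measurable_queueProb S B hrate hfm).comp (measurable_const.prodMk ?_)
    exact (measurable_pi_apply i).comp ((measurable_systemJump S D).comp
      (measurable_const.prodMk (measurable_const.prodMk measurable_id)) (f := fun θ => (s, z, θ)))
  rw [integral_finsetSum _ fun i _ => (hint i).const_mul _, ← Finset.sum_sub_distrib]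
  refine Finset.sum_congr rfl fun i _ => ?_
  rw [integral_const_mul, ← mul_sub, ← hi i, integral_sub (hint i) (integrable_const _)]
  simp

include hR hrate0 hrateR

/-- The Dynkin-type inequality for weighted sums of the value functions of the servers. -/
theorem lintegral_comp_systemState_le {lam : ℝ} (hc : 0 < lam * n) (μ : Measure (Fin n → E))
    [IsProbabilityMeasure μ] {w : Fin n → ℝ} {a : ℝ} (hw0 : ∀ i, 0 ≤ w i)
    (hwa : ∀ i, w i ≤ a) (hRa : R * ∑ i, w i ≤ lam * n * a) (ht : 0 ≤ t)
    {ψ ψ' : ℝ → ℝ} {κ : ℝ} (hψ : Measurable ψ) (hψ0 : ∀ x, 0 ≤ x → 0 ≤ ψ x) (hκ : 0 ≤ κ)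
    (hψ' : ∀ x, |ψ' x| ≤ 1)
    (hψψ : ∀ x y, ψ y ≤ ψ x + ψ' x * (y - x) + κ * (y - x) ^ 2) :
    ∫⁻ ω, ENNReal.ofReal (ψ (∑ i, w i * (f (systemState S D lam ω t i)).toReal))
        ∂(systemMeasure B μ)
      ≤ ∫⁻ z, ENNReal.ofReal (ψ (∑ i, w i * queueProb S R rate B t f 0 (z i))) ∂μ
        + ((∫⁻ s in Ioc 0 t, ∫⁻ ω, ENNReal.ofReal |∑ i, w i *
            ((lam * n * receiveProb D (queueLengths S D lam ω s) i
              - rate s (queueLengths S D lam ω s i)) *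
              arrivalGain S R rate B t f s (systemState S D lam ω s i))| ∂(systemMeasure B μ))
          + ENNReal.ofReal (5 * κ * a ^ 2) * ENNReal.ofReal (1 + lam * n * t)) := by
  have hW : 0 ≤ ∑ i, w i := Finset.sum_nonneg fun i _ => hw0 i
  have ha : 0 ≤ a := by
    by_contra h
    have := mul_neg_of_pos_of_neg hc (not_le.1 h)
    nlinarith [mul_nonneg hR.le hW]
  have hum := measurable_queueProb S B hrate hfm (R := R) (t := t)
  have hgm := measurable_arrivalGain S B hrate hfm (R := R) (t := t)
  have hcoord : ∀ i, Measurable fun p : ℝ × (Fin n → E) => (p.1, p.2 i) := fun i => by fun_prop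
  -- By the backward equation the drift `η` along the flow is minus `rate` times the gain of each
  -- server. The hypothesis `hRa` bounds it by `c * a`, so that the flow moves the sum by at most
  -- `a` per mean interarrival time, like a jump.
  have key := lintegral_comp_stateAt_le (measurable_systemFlow S) (measurable_systemJump S D) hc μ
    (markLaw B n) (g := fun s z => ∑ i, w i * queueProb S R rate B t f s (z i))
    (η := fun s z => ∑ i, w i *
      -(rate s (S.queueLength (z i)) * arrivalGain S R rate B t f s (z i)))
    (Finset.measurable_fun_sum _ fun i _ => (hum.comp (hcoord i)).const_mul _)
    (Finset.measurable_fun_sum _ fun i _ =>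
      (((measurable_rate_queueLength S hrate).comp (hcoord i)).mul
        (hgm.comp (hcoord i))).neg.const_mul _)
    (t := t) (M := ∑ i, w i) (a := a) ?_ ?_ ?_ ht
    (fun s z θ => abs_sum_systemJump_sub_le B hrate hfm hf ha hw0 hwa s z θ) hψ
    (fun s z => hψ0 _ (Finset.sum_nonneg fun i _ =>
      mul_nonneg (hw0 i) (queueProb_nonneg S B _ _))) hκ hψ' hψψ
  · simp only [queueProb_of_le S B le_rfl, integral_sum_systemJump B hrate hfm hf,
      ← systemState_eq, Finset.mul_sum, ← Finset.sum_add_distrib] at key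
    refine key.trans (le_of_eq ?_)
    congr 2
    refine lintegral_congr fun s => lintegral_congr fun ω => ?_
    congr 2
    refine Finset.sum_congr rfl fun i _ => ?_
    have hq : queueLengths S D lam ω s = fun j => S.queueLength (systemState S D lam ω s j) := rfl
    rw [hq]
    ring
  · intro s z
    refine (Finset.abs_sum_le_sum_abs _ _).trans (Finset.sum_le_sum fun i _ => ?_)
    rw [abs_mul, abs_of_nonneg (hw0 i)]
    exact mul_le_of_le_one_right (hw0 i) (abs_queueProb_le_one S B hrate hfm hf _ _)
  · intro s z
    rw [Finset.mul_sum] at hRa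
    refine (Finset.abs_sum_le_sum_abs _ _).trans (le_trans (Finset.sum_le_sum fun i _ => ?_) hRa)
    rw [abs_mul, abs_neg, abs_mul, abs_of_nonneg (hw0 i), abs_of_nonneg (hrate0 _ _), mul_comm R]
    refine mul_le_mul_of_nonneg_left ?_ (hw0 i)
    exact (mul_le_mul (hrateR _ _) (abs_arrivalGain_le_one S B hrate hfm hf _ _) (abs_nonneg _)
      hR.le).trans (mul_one R).le
  · intro τ z x _ hx hxt
    have hint : ∀ i, IntegrableOn (fun y => w i * -(rate (τ + y) (S.queueLength (systemFlow S y z i))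
        * arrivalGain S R rate B t f (τ + y) (systemFlow S y z i))) (Ioc 0 x) := fun i => by
      have hm : Measurable fun y : ℝ => (τ + y, systemFlow S y z i) :=
        (measurable_const.add measurable_id).prodMk ((measurable_pi_apply i).comp
          ((measurable_systemFlow S).comp (measurable_id.prodMk measurable_const)))
      refine Measure.integrableOn_of_bounded (M := |w i| * (R * 1)) (by simp)
        ((((measurable_rate_queueLength S hrate).comp hm).mul
          (hgm.comp hm)).neg.const_mul _).aestronglyMeasurable
        (Eventually.of_forall fun y => ?_)
      rw [Real.norm_eq_abs, abs_mul, abs_neg, abs_mul, abs_of_nonneg (hrate0 _ _)]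
      gcongr
      · exact hrateR _ _
      · exact abs_arrivalGain_le_one S B hrate hfm hf _ _
    rw [integral_finsetSum _ fun i _ => hint i, ← Finset.sum_add_distrib]
    refine Finset.sum_congr rfl fun i _ => ?_
    rw [integral_const_mul, ← mul_add]
    congr 1
    exact queueProb_flow S B hR hrate hrate0 hrateR hfm hf (z i) hx hxt

end Generator

end System

/-! ### Tightness of the queue lengths. -/

section Tightness

variable {E : Type*} [MeasurableSpace E] (S : ServiceDiscipline E)

/-- A truncated multiple of the queue length. -/
noncomputable def truncQueue (K : ℕ) (e : E) : ENNReal :=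
  ENNReal.ofReal (min 1 (S.queueLength e / K))

theorem measurable_truncQueue (K : ℕ) : Measurable (truncQueue S K) :=
  ((measurable_const.min (((measurable_from_top (f := fun k : ℕ => (k : ℝ))).comp
    (measurable_queueLength S)).div_const _))).ennreal_ofReal

theorem truncQueue_serve_le (K : ℕ) {s : ℝ} (hs : 0 ≤ s) (e : E) :
    truncQueue S K (S.serve s e) ≤ truncQueue S K e := by
  refine ENNReal.ofReal_le_ofReal (min_le_min le_rfl ?_)
  have := S.queueLength_serve_le hs e
  gcongr

theorem truncQueue_arrive_le (K : ℕ) (e : E) {b : ℝ} (hb : 0 < b) :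
    truncQueue S K (S.arrive e b) ≤ truncQueue S K e + ENNReal.ofReal (1 / K) := by
  rw [truncQueue, truncQueue, S.queueLength_arrive e hb, ← ENNReal.ofReal_add (by positivity)
    (by positivity)]
  refine ENNReal.ofReal_le_ofReal ?_
  have h : (0 : ℝ) ≤ 1 / K := by positivity
  push_cast
  rw [add_div, ← min_add_add_right]
  exact min_le_min (by linarith) le_rfl

theorem indicator_le_truncQueue {K : ℕ} (hK : 1 ≤ K) (e : E) :
    {e | K ≤ S.queueLength e}.indicator (fun _ => (1 : ENNReal)) e ≤ truncQueue S K e := by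
  by_cases h : K ≤ S.queueLength e
  · have : (1 : ℝ) ≤ S.queueLength e / K := by
      rw [le_div_iff₀ (by exact_mod_cast hK), one_mul]
      exact_mod_cast h
    simp [indicator, h, truncQueue, this]
  · simp [indicator, h]

variable {S} {D n : ℕ} (B : Measure ℝ) [IsProbabilityMeasure B] (hB : B (Iic 0) = 0)

include hB in
-- Service does not lengthen a queue. An arrival raises the truncated length by at most `1 / K`, and
-- it reaches server `i` with probability at most `D / n`.
theorem lintegral_nextValue_truncQueue_le (hD : D ≤ n) {c : ℝ} (hc : 0 < c) (hn : 0 < n) (K : ℕ)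
    (i : Fin n) {t τ : ℝ} (hτ : τ ≤ t) (z : Fin n → E) :
    ∫⁻ w, nextValue (systemFlow S) (systemJump S D) c (fun _ z => truncQueue S K (z i)) t τ z w
        ∂((expMeasure 1).prod (markLaw B n))
      ≤ truncQueue S K (z i) + ENNReal.ofReal (D / n * (1 / K)) := by
  have hB' : ∀ᵐ b ∂B, 0 < b := by
    rw [ae_iff]
    simpa [Iic] using hB
  have hpos : ∀ᵐ w ∂((expMeasure 1).prod (markLaw B n)), 0 < w.1 :=
    Measure.quasiMeasurePreserving_fst.ae ae_expMeasure_one_pos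
  have hbpos : ∀ᵐ w ∂((expMeasure 1).prod (markLaw B n)), 0 < w.2.1 :=
    Measure.quasiMeasurePreserving_snd.ae (Measure.quasiMeasurePreserving_fst.ae hB')
  let rec' : ℝ → Set (Equiv.Perm (Fin n)) := fun ξ =>
    {σ | Receives D (fun j => S.queueLength (systemFlow S (ξ / c) z j)) σ i}
  let G : ℝ × ℝ × Equiv.Perm (Fin n) → ENNReal := fun w =>
    ENNReal.ofReal (1 / K) * (rec' w.1).indicator (fun _ => 1) w.2.2
  have hGm : Measurable G := by
    refine Measurable.const_mul ?_ _
    have h1 : Measurable fun w : ℝ × ℝ × Equiv.Perm (Fin n) => (systemFlow S (w.1 / c) z, w.2.2) :=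
      ((measurable_systemFlow S).comp ((measurable_fst.div_const c).prodMk measurable_const)).prodMk
        (by fun_prop)
    exact (measurable_const.indicator (measurableSet_receives S D i)).comp h1
  have hle : ∀ᵐ w ∂((expMeasure 1).prod (markLaw B n)),
      nextValue (systemFlow S) (systemJump S D) c (fun _ z => truncQueue S K (z i)) t τ z w
        ≤ truncQueue S K (z i) + G w := by
    filter_upwards [hpos, hbpos] with w hw hb
    have h0 : 0 ≤ w.1 / c := (div_pos hw hc).le
    have h1 := truncQueue_serve_le S K h0 (z i)
    simp only [nextValue]
    split_ifs
    · by_cases h : w.2.2 ∈ rec' w.1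
      · have h' : systemJump S D (τ + w.1 / c) (systemFlow S (w.1 / c) z) w.2 i
            = S.arrive (S.serve (w.1 / c) (z i)) w.2.1 := by
          simp only [systemJump]; exact if_pos h
        rw [h']
        simp only [G, h, indicator_of_mem, mul_one]
        exact (truncQueue_arrive_le S K _ hb).trans (by gcongr)
      · have h' : systemJump S D (τ + w.1 / c) (systemFlow S (w.1 / c) z) w.2 i
            = S.serve (w.1 / c) (z i) := by
          simp only [systemJump]; exact if_neg h
        rw [h']
        exact h1.trans le_self_add
    · exact (truncQueue_serve_le S K (by linarith) (z i)).trans le_self_add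
  refine (lintegral_mono_ae hle).trans ?_
  rw [lintegral_add_left measurable_const, lintegral_const, measure_univ, mul_one]
  refine add_le_add le_rfl ?_
  rw [lintegral_prod _ hGm.aemeasurable]
  have hin : ∀ ξ, ∫⁻ θ, G (ξ, θ) ∂(markLaw B n) ≤ ENNReal.ofReal (D / n * (1 / K)) := by
    intro ξ
    have : ∀ θ : ℝ × Equiv.Perm (Fin n), G (ξ, θ)
        = ENNReal.ofReal (1 / K) * (rec' ξ).indicator (fun _ => 1) θ.2 := fun θ => rfl
    simp only [this]
    have hm : Measurable fun θ : ℝ × Equiv.Perm (Fin n) =>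
        (rec' ξ).indicator (fun _ => (1 : ENNReal)) θ.2 :=
      (measurable_of_countable ((rec' ξ).indicator fun _ => (1 : ENNReal))).comp measurable_snd
    rw [lintegral_const_mul _ hm, markLaw, lintegral_prod _ hm.aemeasurable]
    simp only [lintegral_const, measure_univ, mul_one]
    rw [lintegral_indicator_const MeasurableSet.of_discrete, one_mul, mul_comm,
      ENNReal.ofReal_mul (by positivity)]
    refine mul_le_mul_left ?_ _
    have h1 := mul_receiveProb_le hD (fun j => S.queueLength (systemFlow S (ξ / c) z j)) i
    rw [← ENNReal.ofReal_toReal (measure_ne_top _ (rec' ξ))]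
    refine ENNReal.ofReal_le_ofReal ?_
    rw [le_div_iff₀ (by exact_mod_cast hn), mul_comm]
    exact h1
  calc _ ≤ ∫⁻ _, ENNReal.ofReal (D / n * (1 / K)) ∂(expMeasure 1) := lintegral_mono hin
    _ = _ := by simp

include hB in
/-- The queue lengths of a server are tight, uniformly in the number of servers. -/
theorem lintegral_truncQueue_systemState_le (hD : D ≤ n) (hn : 0 < n) {lam : ℝ} (hlam : 0 < lam)
    (K : ℕ) (i : Fin n) {t : ℝ} (ht : 0 ≤ t) (μ : Measure (Fin n → E)) [IsProbabilityMeasure μ] :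
    ∫⁻ ω, truncQueue S K (systemState S D lam ω t i) ∂(systemMeasure B μ)
      ≤ ∫⁻ z, truncQueue S K (z i) ∂μ + ENNReal.ofReal (D * (1 + lam * t) / K) := by
  have hn' : (1 : ℝ) ≤ n := by exact_mod_cast hn
  have hc : 0 < lam * n := by positivity
  have h1 := lintegral_stateAt_le (measurable_systemFlow S) (measurable_systemJump S D) hc μ
    (markLaw B n) ht (Ψ := fun _ z => truncQueue S K (z i))
    (d := fun _ _ => ENNReal.ofReal (D / n * (1 / K)))
    ((measurable_truncQueue S K).comp (by fun_prop))
    (fun τ z _ hτ => lintegral_nextValue_truncQueue_le B hB hD hc hn K i hτ z)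
  simp only [← systemState_eq] at h1
  refine h1.trans (add_le_add le_rfl ?_)
  have h2 : ∀ m, ∫⁻ ω, (if arrivalTime (lam * n) ω m ≤ t then ENNReal.ofReal (D / n * (1 / K)) else 0)
      ∂(drivingLaw μ (markLaw B n)) = ENNReal.ofReal (D / n * (1 / K)) *
        drivingLaw μ (markLaw B n) {ω | arrivalTime (lam * n) ω m ≤ t} := by
    intro m
    rw [← lintegral_indicator_const (measurableSet_le (measurable_arrivalTime m) measurable_const)]
    rfl
  simp only [h2]
  rw [ENNReal.tsum_mul_left]
  refine (mul_le_mul_right (tsum_arrivalTime_le (measurable_systemFlow S)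
    (measurable_systemJump S D) hc μ (markLaw B n) ht) _).trans ?_
  rw [← ENNReal.ofReal_mul (by positivity)]
  refine ENNReal.ofReal_le_ofReal ?_
  -- About `lam * n * t` arrivals, each costing `D / (n * K)`, give a bound that does not depend on
  -- `n`.
  have h3 : (1 + lam * n * t) / n ≤ 1 + lam * t := by
    rw [div_le_iff₀ (by linarith)]
    nlinarith
  calc (D : ℝ) / n * (1 / K) * (1 + lam * n * t) = D / K * ((1 + lam * n * t) / n) := by ring
    _ ≤ D / K * (1 + lam * t) := mul_le_mul_of_nonneg_left h3 (by positivity)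
    _ = _ := by ring

end Tightness

/-! ### Convergence of the tagged queue -/

theorem tendsto_zero_of_le_add {F : ℕ → ENNReal} {b : ℕ → ENNReal} {c : ℕ → ℕ → ENNReal}
    (h : ∀ K, ∀ᶠ N in atTop, F N ≤ b K + c K N) (hb : Tendsto b atTop (𝓝 0))
    (hc : ∀ K, Tendsto (c K) atTop (𝓝 0)) : Tendsto F atTop (𝓝 0) := by
  rw [ENNReal.tendsto_nhds_zero] at hb ⊢
  intro ε hε
  have hε2 : 0 < ε / 2 := ENNReal.half_pos hε.ne'
  obtain ⟨K, hK⟩ := (hb _ hε2).exists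
  filter_upwards [h K, ENNReal.tendsto_nhds_zero.1 (hc K) _ hε2] with N h1 h2
  exact (h1.trans (add_le_add hK h2)).trans (ENNReal.add_halves ε).le

/-- The complement in the hypothesis is there because both laws are only estimated from above.
Exchanging `A` and its complement yields the lower bound. -/
theorem tvDist_le {α : Type*} [MeasurableSpace α] {μ ν : Measure α} [IsProbabilityMeasure μ]
    [IsProbabilityMeasure ν] {x : ENNReal} (hx : x ≠ ⊤)
    (h : ∀ A, MeasurableSet A → μ A + ν Aᶜ ≤ 1 + x) : tvDist μ ν ≤ x.toReal := by
  have hreal : ∀ A, MeasurableSet A → μ.real A - ν.real A ≤ x.toReal := by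
    intro A hA
    have h1 := ENNReal.toReal_mono (ENNReal.add_ne_top.2 ⟨ENNReal.one_ne_top, hx⟩) (h A hA)
    rw [ENNReal.toReal_add (measure_ne_top _ _) (measure_ne_top _ _),
      ENNReal.toReal_add ENNReal.one_ne_top hx, ENNReal.toReal_one] at h1
    have h2 : ν.real Aᶜ = 1 - ν.real A := probReal_compl_eq_one_sub hA
    simp only [Measure.real] at h2 ⊢
    linarith
  have : Nonempty {A : Set α // MeasurableSet A} := ⟨⟨∅, MeasurableSet.empty⟩⟩
  refine ciSup_le fun A => abs_le.2 ⟨?_, hreal A A.2⟩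
  have h1 := hreal _ A.2.compl
  rw [probReal_compl_eq_one_sub A.2, probReal_compl_eq_one_sub A.2] at h1
  linarith

theorem tvDist_nonneg {α : Type*} [MeasurableSpace α] (μ ν : Measure α) : 0 ≤ tvDist μ ν :=
  Real.iSup_nonneg fun _ => abs_nonneg _

variable {E : Type*} [MeasurableSpace E] {S : ServiceDiscipline E} {D : ℕ}

instance (B : Measure ℝ) [IsProbabilityMeasure B] (ν : Measure E) [IsProbabilityMeasure ν] :
    IsProbabilityMeasure (queueMeasure B ν) := by
  unfold queueMeasure; infer_instance

theorem measurable_singleQueue {R : ℝ} {rate : ℝ → ℕ → ℝ} (hrate : ∀ k, Measurable fun t => rate t k)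
    (t : ℝ) : Measurable fun ω => singleQueue S R rate ω t := by
  simp only [singleQueue_eq]
  exact (measurable_queueLength S).comp ((measurable_stateAt S.measurable_serve
    (measurable_queueJump S hrate)).comp (measurable_id.prodMk measurable_const))

theorem measurable_queueLengths_apply {n : ℕ} (lam t : ℝ) (i : Fin n) :
    Measurable fun ω : SystemPath E n => queueLengths S D lam ω t i :=
  (measurable_queueLengths S D lam i).comp (measurable_id.prodMk measurable_const)

/-- The difference between the arrival rate of the tagged server and `rate`. -/
noncomputable def rateGap (S : ServiceDiscipline E) (D : ℕ) (lam : ℝ) (rate : ℝ → ℕ → ℝ) {N : ℕ}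
    (s : ℝ) (ω : SystemPath E (N + 1)) : ℝ :=
  taggedRate lam D (queueLengths S D lam ω s) (queueLengths S D lam ω s 0)
    - rate s (queueLengths S D lam ω s 0)

theorem measurable_rateGap (lam : ℝ) {rate : ℝ → ℕ → ℝ} (hrate : ∀ k, Measurable fun t => rate t k)
    (N : ℕ) : Measurable fun p : ℝ × SystemPath E (N + 1) => rateGap S D lam rate p.1 p.2 := by
  have h1 : Measurable fun p : ℝ × SystemPath E (N + 1) => queueLengths S D lam p.2 p.1 :=
    measurable_pi_lambda _ fun i => (measurable_queueLengths S D lam i).comp measurable_swap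
  have h2 : Measurable fun x : Fin (N + 1) → ℕ => taggedRate lam D x (x 0) :=
    measurable_of_countable _
  have h3 : Measurable fun p : ℝ × ℕ => rate p.1 p.2 := measurable_from_prod_countable_left hrate
  exact (h2.comp h1).sub (h3.comp (measurable_fst.prodMk ((measurable_pi_apply 0).comp h1)))

/-! ### The distance of the tagged queue from the single queue for a fixed number of servers. -/

section Tagged

variable {R : ℝ} {rate : ℝ → ℕ → ℝ} (B : Measure ℝ) [IsProbabilityMeasure B]
  (hR : 0 < R) (hrate : ∀ k, Measurable fun t => rate t k)
  (hrate0 : ∀ s k, 0 ≤ rate s k) (hrateR : ∀ s k, rate s k ≤ R) {t : ℝ}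
  (hD1 : 1 ≤ D) {lam : ℝ} (hlam : 0 < lam) {N : ℕ} (hD : D ≤ N + 1)

include hD1 hlam hD

theorem abs_taggedRate_sub_le (x : Fin (N + 1) → ℕ) {r : ℝ} (hr0 : 0 ≤ r) (hrR : r ≤ R) :
    |taggedRate lam D x (x 0) - r| ≤ lam * D + R := by
  rw [taggedRate_eq lam hD1 hD, mul_assoc]
  have h1 := mul_receiveProb_le hD x 0
  have h2 := receiveProb_nonneg D x 0
  have h3 : lam * (((N + 1 : ℕ) : ℝ) * receiveProb D x 0) ≤ lam * D :=
    mul_le_mul_of_nonneg_left h1 hlam.le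
  have h4 : 0 ≤ lam * (((N + 1 : ℕ) : ℝ) * receiveProb D x 0) := by positivity
  rw [abs_le]; constructor <;> linarith

include hR hrate hrate0 hrateR

/-- Both laws are compared with the same initial integral of the value function. The large system
exceeds it by at most the accumulated rate gap, since the gains are at most `1`; the single queue
does not exceed it. -/
theorem tvDist_taggedLaw_le (ht : 0 ≤ t) (μ : Measure (Fin (N + 1) → E)) [IsProbabilityMeasure μ] :
    tvDist (taggedLaw S B D lam μ t) (singleQueueLaw S B R rate (μ.map fun x => x 0) t)
      ≤ (∫⁻ s in Ioc 0 t, ∫⁻ ω, ENNReal.ofReal |rateGap S D lam rate s ω|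
        ∂(systemMeasure B μ)).toReal := by
  have hm0 : Measurable fun x : Fin (N + 1) → E => x 0 := measurable_pi_apply 0
  have : IsProbabilityMeasure (μ.map fun x => x 0) := Measure.isProbabilityMeasure_map
    hm0.aemeasurable
  have hq := measurable_queueLengths_apply (S := S) (D := D) lam t (0 : Fin (N + 1))
  have hs := measurable_singleQueue (S := S) (R := R) hrate t
  have : IsProbabilityMeasure (taggedLaw S B D lam μ t) :=
    Measure.isProbabilityMeasure_map hq.aemeasurable
  have : IsProbabilityMeasure (singleQueueLaw S B R rate (μ.map fun x => x 0) t) :=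
    Measure.isProbabilityMeasure_map hs.aemeasurable
  have hn : (0 : ℝ) < ((N + 1 : ℕ) : ℝ) := by positivity
  have hc : 0 < lam * ((N + 1 : ℕ) : ℝ) := by positivity
  refine tvDist_le ?_ fun A hA => ?_
  · refine ne_top_of_le_ne_top (b := ∫⁻ _ in Ioc 0 t, ENNReal.ofReal (lam * D + R)) (by simp; finiteness) ?_
    refine lintegral_mono fun s => ?_
    refine (lintegral_mono fun ω => ENNReal.ofReal_le_ofReal
      (abs_taggedRate_sub_le hD1 hlam hD _ (hrate0 _ _) (hrateR _ _))).trans ?_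
    simp
  · let f : Set ℕ → E → ENNReal := fun A => {e | S.queueLength e ∈ A}.indicator fun _ => 1
    have hfm : ∀ A, Measurable (f A) := fun A =>
      measurable_const.indicator (measurable_queueLength S (MeasurableSet.of_discrete (s := A)))
    have hf : ∀ A e, f A e ≤ 1 := fun A e => indicator_le_self' (by simp) e
    have hsum : ∀ e, f A e + f Aᶜ e = 1 := by
      intro e
      by_cases h : S.queueLength e ∈ A <;> simp [f, h]
    have hqv : ∀ A, Measurable fun e => queueValue S R rate B t (f A) 0 e := fun A =>
      (measurable_queueValue S B hrate (hfm A)).comp (measurable_const.prodMk measurable_id)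
    have h1 : taggedLaw S B D lam μ t A
        ≤ ∫⁻ e, queueValue S R rate B t (f A) 0 e ∂(μ.map fun x => x 0)
          + ∫⁻ s in Ioc 0 t, ∫⁻ ω, ENNReal.ofReal |rateGap S D lam rate s ω|
            ∂(systemMeasure B μ) := by
      -- All weight is on the tagged server and `ψ` is the identity, so `κ = 0` and the quadratic
      -- error disappears. The value of `a` is then immaterial and only has to satisfy the side
      -- conditions.
      have h := lintegral_comp_systemState_le (S := S) (D := D) B hR hrate hrate0 hrateR (hfm A)
        (hf A) hc μ (w := Pi.single 0 1) (a := max 1 (R / (lam * ((N + 1 : ℕ) : ℝ))))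
        (fun i => by by_cases h : i = 0 <;> simp [h])
        (fun i => by
          refine le_trans ?_ (le_max_left _ _)
          by_cases h : i = 0 <;> simp [h])
        (by
          rw [Finset.sum_pi_single']
          simp only [Finset.mem_univ, if_true, mul_one]
          rw [← div_le_iff₀' hc]
          exact le_max_right _ _) ht (ψ := id) (ψ' := fun _ => 1) (κ := 0) measurable_id
        (fun x hx => hx) le_rfl (by simp) (by intro x y; simp)
      simp only [Pi.single_apply, ite_mul, one_mul, zero_mul, Finset.sum_ite_eq', Finset.mem_univ,
        if_true, id, mul_zero, ENNReal.ofReal_zero, add_zero] at h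
      have e1 : taggedLaw S B D lam μ t A = ∫⁻ ω, ENNReal.ofReal
          (f A (systemState S D lam ω t 0)).toReal ∂(systemMeasure B μ) := by
        rw [taggedLaw, Measure.map_apply hq hA, ← lintegral_indicator_one (hq hA)]
        refine lintegral_congr fun ω => ?_
        rw [ENNReal.ofReal_toReal (ne_top_of_le_ne_top ENNReal.one_ne_top (hf A _))]
        rfl
      rw [e1, lintegral_map (hqv A) hm0]
      refine h.trans (add_le_add (le_of_eq ?_) ?_)
      · exact lintegral_congr fun z => ofReal_queueProb S B hrate (hfm A) (hf A) 0 (z 0)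
      · refine lintegral_mono fun s => lintegral_mono fun ω => ENNReal.ofReal_le_ofReal ?_
        rw [abs_mul, rateGap, taggedRate_eq lam hD1 hD]
        exact mul_le_of_le_one_right (abs_nonneg _)
          (abs_arrivalGain_le_one S B hrate (hfm A) (hf A) _ _)
    have h2 : singleQueueLaw S B R rate (μ.map fun x => x 0) t Aᶜ
        ≤ ∫⁻ e, queueValue S R rate B t (f Aᶜ) 0 e ∂(μ.map fun x => x 0) := by
      refine le_trans (le_of_eq ?_) (lintegral_singleQueue_le S B hR hrate (hfm Aᶜ) ht
        (μ.map fun x => x 0))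
      rw [singleQueueLaw, Measure.map_apply hs hA.compl, ← lintegral_indicator_one (hs hA.compl)]
      refine lintegral_congr fun ω => ?_
      have hω : (ω ∈ (fun ω => singleQueue S R rate ω t) ⁻¹' Aᶜ) ↔
          stateAt S.serve (queueJump S R rate) R ω t ∈ {e | S.queueLength e ∈ Aᶜ} := by
        rw [mem_preimage, singleQueue_eq]; rfl
      by_cases h' : ω ∈ (fun ω => singleQueue S R rate ω t) ⁻¹' Aᶜ
      · exact (indicator_of_mem h' _).trans (indicator_of_mem (hω.1 h') fun _ => 1).symm
      · exact (indicator_of_notMem h' _).trans (indicator_of_notMem (mt hω.2 h') fun _ => 1).symm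
    -- The value functions of `A` and its complement add up to at most `1`, which removes the
    -- initial law from the sum of the two upper bounds.
    have h3 : ∀ e, queueValue S R rate B t (f A) 0 e + queueValue S R rate B t (f Aᶜ) 0 e ≤ 1 := by
      intro e
      have := sum_queueValue_le S (R := R) (rate := rate) (t := t) B (Finset.univ : Finset Bool)
        (f := fun b => cond b (f A) (f Aᶜ)) hrate (fun b => by cases b <;> exact hfm _)
        (fun e => by simp [hsum]) 0 e
      simpa using this
    calc _ ≤ (∫⁻ e, queueValue S R rate B t (f A) 0 e ∂(μ.map fun x => x 0)
          + ∫⁻ s in Ioc 0 t, ∫⁻ ω, ENNReal.ofReal |rateGap S D lam rate s ω|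
            ∂(systemMeasure B μ)) + ∫⁻ e, queueValue S R rate B t (f Aᶜ) 0 e ∂(μ.map fun x => x 0) :=
          add_le_add h1 h2
      _ = ∫⁻ e, (queueValue S R rate B t (f A) 0 e + queueValue S R rate B t (f Aᶜ) 0 e)
            ∂(μ.map fun x => x 0) + ∫⁻ s in Ioc 0 t, ∫⁻ ω, ENNReal.ofReal |rateGap S D lam rate s ω|
            ∂(systemMeasure B μ) := by
          rw [lintegral_add_left (hqv A)]
          ring
      _ ≤ _ := by
          refine add_le_add ?_ le_rfl
          exact (lintegral_mono h3).trans (by simp)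

end Tagged

/-! ### The limit of many servers for the tagged queue. -/

section TaggedLimit

variable {E : Type*} [MeasurableSpace E] {S : ServiceDiscipline E} {D : ℕ}
  {R : ℝ} {rate : ℝ → ℕ → ℝ} (B : Measure ℝ) [IsProbabilityMeasure B] (hB : B (Iic 0) = 0)
  (hR : 0 < R) (hD1 : 1 ≤ D) {lam : ℝ} (hlam : 0 < lam)

theorem truncQueue_le_one (K : ℕ) (e : E) : truncQueue S K e ≤ 1 := by
  rw [truncQueue, ENNReal.ofReal_le_one]
  exact min_le_left _ _

/-- The truncated multiples of the queue length vanish in the limit. -/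
theorem tendsto_lintegral_truncQueue (ν : Measure E) [IsFiniteMeasure ν] :
    Tendsto (fun K => ∫⁻ e, truncQueue S K e ∂ν) atTop (𝓝 0) := by
  have h := tendsto_lintegral_of_dominated_convergence (μ := ν) (F := fun K => truncQueue S K)
    (f := fun _ => 0) (fun _ => 1) (fun K => measurable_truncQueue S K)
    (fun K => Eventually.of_forall fun e => truncQueue_le_one K e) (by simp)
    (Eventually.of_forall fun e => by
      have h1 : Tendsto (fun K : ℕ => ENNReal.ofReal ((S.queueLength e : ℝ) / K)) atTop (𝓝 0) := by
        simpa using (ENNReal.tendsto_ofReal (tendsto_const_div_atTop_nhds_zero_nat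
          (S.queueLength e : ℝ)))
      exact tendsto_of_tendsto_of_tendsto_of_le_of_le tendsto_const_nhds h1 (fun _ => zero_le)
        (fun K => ENNReal.ofReal_le_ofReal (min_le_right _ _)))
  simpa using h

/-- Passes from second to first moments at the cost of an arbitrarily small `ε`. -/
theorem abs_le_add_sq_div {ε x : ℝ} (hε : 0 < ε) : |x| ≤ ε + x ^ 2 / ε := by
  have h1 : x ^ 2 = |x| ^ 2 := (sq_abs x).symm
  rw [h1, ← sub_nonneg]
  have : ε + |x| ^ 2 / ε - |x| = ((|x| - ε / 2) ^ 2 + 3 / 4 * ε ^ 2) / ε := by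
    field_simp; ring
  rw [this]; positivity

/-- A bounded random variable is estimated by its second moments on the events `{X = k}`, `k < K`. -/
theorem lintegral_abs_le_sum {Ω : Type*} [MeasurableSpace Ω] (P : Measure Ω) [IsProbabilityMeasure P]
    {X : Ω → ℕ} (hX : Measurable X) {Y : Ω → ℝ} (hY : Measurable Y) {C : ℝ} (hYC : ∀ ω, |Y ω| ≤ C)
    {ε : ℝ} (hε : 0 < ε) (K : ℕ) :
    ∫⁻ ω, ENNReal.ofReal |Y ω| ∂P ≤ ENNReal.ofReal ε + ENNReal.ofReal C * P {ω | K ≤ X ω}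
      + ∑ k ∈ Finset.range K, ENNReal.ofReal ((∫ ω in {ω | X ω = k}, Y ω ^ 2 ∂P) / ε) := by
  have hXk : ∀ k, MeasurableSet {ω | X ω = k} := fun k => hX (measurableSet_singleton k)
  have hXK : MeasurableSet {ω | K ≤ X ω} := hX measurableSet_Ici
  have hY2 : Measurable fun ω => ENNReal.ofReal (Y ω ^ 2 / ε) :=
    ((hY.pow_const 2).div_const ε).ennreal_ofReal
  have hle : ∀ ω, ENNReal.ofReal |Y ω| ≤ ENNReal.ofReal ε
      + {ω | K ≤ X ω}.indicator (fun _ => ENNReal.ofReal C) ω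
      + ∑ k ∈ Finset.range K, {ω | X ω = k}.indicator (fun ω => ENNReal.ofReal (Y ω ^ 2 / ε)) ω := by
    intro ω
    by_cases h : K ≤ X ω
    · have h1 : {ω | K ≤ X ω}.indicator (fun _ => ENNReal.ofReal C) ω = ENNReal.ofReal C := by
        simp [indicator, h]
      rw [h1]
      exact (ENNReal.ofReal_le_ofReal (hYC ω)).trans (le_add_self.trans le_self_add)
    · have h1 : ENNReal.ofReal (Y ω ^ 2 / ε) ≤ ∑ k ∈ Finset.range K,
          {ω | X ω = k}.indicator (fun ω => ENNReal.ofReal (Y ω ^ 2 / ε)) ω := by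
        refine le_trans (le_of_eq ?_) (Finset.single_le_sum
          (f := fun k => {ω | X ω = k}.indicator (fun ω => ENNReal.ofReal (Y ω ^ 2 / ε)) ω)
          (fun _ _ => zero_le) (Finset.mem_range.2 (not_le.1 h)))
        simp [indicator]
      calc _ ≤ ENNReal.ofReal (ε + Y ω ^ 2 / ε) := ENNReal.ofReal_le_ofReal (abs_le_add_sq_div hε)
        _ = ENNReal.ofReal ε + ENNReal.ofReal (Y ω ^ 2 / ε) :=
            ENNReal.ofReal_add hε.le (by positivity)
        _ ≤ _ := add_le_add le_self_add h1
  refine (lintegral_mono hle).trans (le_of_eq ?_)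
  have hKm : Measurable ({ω | K ≤ X ω}.indicator fun _ => ENNReal.ofReal C) :=
    measurable_const.indicator hXK
  have hεm : Measurable fun ω => ENNReal.ofReal ε +
      {ω | K ≤ X ω}.indicator (fun _ => ENNReal.ofReal C) ω := hKm.const_add _
  rw [lintegral_add_left hεm, lintegral_add_left measurable_const, lintegral_indicator_const hXK,
    lintegral_finsetSum _ fun k _ => hY2.indicator (hXk k)]
  congr 1
  · simp
  · refine Finset.sum_congr rfl fun k _ => ?_
    rw [lintegral_indicator (hXk k), ← integral_div, ofReal_integral_eq_lintegral_ofReal]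
    · refine Integrable.of_bound ((hY.pow_const 2).div_const ε).aestronglyMeasurable (C ^ 2 / ε)
        (Eventually.of_forall fun ω => ?_)
      rw [Real.norm_eq_abs, abs_of_nonneg (by positivity), ← sq_abs]
      have := hYC ω
      gcongr
    · exact Eventually.of_forall fun ω => by positivity

include hB hD1 hlam

/-- The assumed `L²` convergence is only for each fixed queue length. It is used for lengths up to
`K`; on longer queues the gap is bounded by `lam * D + R`, and their probability is small uniformly
in `N` by tightness. -/
theorem tendsto_lintegral_rateGap {T : ℝ} {μ : (N : ℕ) → Measure (Fin (N + 1) → E)} {ν : Measure E}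
    (hμ : ∀ N, IsProbabilityMeasure (μ N)) (hν : ∀ N, (μ N).map (fun x => x 0) = ν)
    (h : IsLimitRate S B D lam T μ R rate) {s : ℝ} (hs : s ∈ Icc 0 T) :
    Tendsto (fun N => ∫⁻ ω, ENNReal.ofReal |rateGap S D lam rate s ω| ∂(systemMeasure B (μ N)))
      atTop (𝓝 0) := by
  have hm0 : ∀ N, Measurable fun x : Fin (N + 1) → E => x 0 := fun N => measurable_pi_apply 0
  have hνp : IsProbabilityMeasure ν := by
    rw [← hν 0]
    exact Measure.isProbabilityMeasure_map (hm0 0).aemeasurable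
  -- Tying `ε` to the cutoff leaves two limits: `N → ∞` for fixed `K`, then `K → ∞`. The cutoff `K +
  -- 1` avoids division by `0`.
  let ε : ℕ → ℝ := fun K => 1 / ((K : ℝ) + 1)
  have hε : ∀ K, 0 < ε K := fun K => by positivity
  refine tendsto_zero_of_le_add
    (b := fun K => ENNReal.ofReal (ε K) + ENNReal.ofReal (lam * D + R) *
      (∫⁻ e, truncQueue S (K + 1) e ∂ν + ENNReal.ofReal (D * (1 + lam * s) / (K + 1 : ℕ))))
    (c := fun K N => ∑ k ∈ Finset.range (K + 1), ENNReal.ofReal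
      ((∫ ω in {ω | queueLengths S D lam ω s 0 = k},
        (taggedRate lam D (queueLengths S D lam ω s) k - rate s k) ^ 2 ∂(systemMeasure B (μ N)))
        / ε K)) ?_ ?_ ?_
  · intro K
    filter_upwards [eventually_ge_atTop D] with N hN
    have hD : D ≤ N + 1 := by omega
    have hmeas : Measurable fun ω : SystemPath E (N + 1) => rateGap S D lam rate s ω :=
      (measurable_rateGap lam h.measurable N).comp (measurable_const.prodMk measurable_id)
    have h1 := lintegral_abs_le_sum (systemMeasure B (μ N))
      (measurable_queueLengths_apply (S := S) (D := D) lam s (0 : Fin (N + 1))) hmeas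
      (fun ω => abs_taggedRate_sub_le hD1 hlam hD _ (h.nonneg _ _) (h.le _ _)) (hε K) (K + 1)
    refine h1.trans (add_le_add (add_le_add le_rfl (mul_le_mul_right ?_ _)) (le_of_eq ?_))
    · calc _ ≤ ∫⁻ ω, truncQueue S (K + 1) (systemState S D lam ω s 0) ∂(systemMeasure B (μ N)) := by
            have hmK : MeasurableSet {ω : SystemPath E (N + 1) |
                K + 1 ≤ queueLengths S D lam ω s 0} :=
              measurable_queueLengths_apply lam s 0 measurableSet_Ici
            rw [← lintegral_indicator_one hmK]
            exact lintegral_mono fun ω => indicator_le_truncQueue S (by omega)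
              (systemState S D lam ω s 0)
        _ ≤ _ := lintegral_truncQueue_systemState_le B hB hD (by omega) hlam (K + 1) 0 hs.1 (μ N)
        _ = _ := by rw [← hν N, lintegral_map (measurable_truncQueue S _) (hm0 N)]
    · refine Finset.sum_congr rfl fun k _ => ?_
      congr 2
      refine setIntegral_congr_fun (measurable_queueLengths_apply (S := S) (D := D) lam s
        (0 : Fin (N + 1)) (measurableSet_singleton k)) fun ω hω => ?_
      have hω' : queueLengths S D lam ω s 0 = k := hω
      simp only [rateGap, hω']
  · have h1 : Tendsto (fun K => ENNReal.ofReal (ε K)) atTop (𝓝 0) := by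
      simpa [ε] using ENNReal.tendsto_ofReal (tendsto_one_div_add_atTop_nhds_zero_nat (𝕜 := ℝ))
    have h2 := (tendsto_add_atTop_iff_nat 1).2 (tendsto_lintegral_truncQueue (S := S) ν)
    have h3 : Tendsto (fun K : ℕ => ENNReal.ofReal (D * (1 + lam * s) / (K + 1 : ℕ))) atTop (𝓝 0) := by
      simpa using ENNReal.tendsto_ofReal ((tendsto_add_atTop_iff_nat 1).2
        (tendsto_const_div_atTop_nhds_zero_nat (D * (1 + lam * s))))
    have h4 := h1.add (ENNReal.Tendsto.const_mul (a := ENNReal.ofReal (lam * D + R)) (h2.add h3)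
      (Or.inr ENNReal.ofReal_ne_top))
    simpa using h4
  · intro K
    have h1 : Tendsto (fun N => ∑ k ∈ Finset.range (K + 1), ENNReal.ofReal
      ((∫ ω in {ω | queueLengths S D lam ω s 0 = k},
        (taggedRate lam D (queueLengths S D lam ω s) k - rate s k) ^ 2 ∂(systemMeasure B (μ N)))
        / ε K)) atTop (𝓝 (∑ k ∈ Finset.range (K + 1), ENNReal.ofReal (0 / ε K))) :=
      tendsto_finsetSum _ fun k _ => ENNReal.tendsto_ofReal ((h.tendsto s hs k).div_const _)
    simpa using h1

include hR in
/-- The law of the tagged queue length converges to that of the single queue with the limiting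
rate. -/
theorem tendsto_tvDist_taggedLaw {T : ℝ} {μ : (N : ℕ) → Measure (Fin (N + 1) → E)} {ν : Measure E}
    (hμ : ∀ N, IsProbabilityMeasure (μ N)) (hν : ∀ N, (μ N).map (fun x => x 0) = ν)
    (h : IsLimitRate S B D lam T μ R rate) {t : ℝ} (ht : t ∈ Icc 0 T) :
    Tendsto (fun N => tvDist (taggedLaw S B D lam (μ N) t) (singleQueueLaw S B R rate ν t))
      atTop (𝓝 0) := by
  -- The shift by `D` guarantees at least `D` servers for every index, so the dominating constant is
  -- valid along the whole sequence.
  have hlim : Tendsto (fun N => ∫⁻ s in Ioc 0 t, ∫⁻ ω, ENNReal.ofReal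
      |rateGap S D lam rate s ω| ∂(systemMeasure B (μ (N + D)))) atTop (𝓝 0) := by
    have h1 := tendsto_lintegral_of_dominated_convergence (μ := volume.restrict (Ioc 0 t))
      (F := fun N s => ∫⁻ ω, ENNReal.ofReal
        |rateGap S D lam rate s ω| ∂(systemMeasure B (μ (N + D)))) (f := fun _ => 0)
      (fun _ => ENNReal.ofReal (lam * D + R)) ?_ ?_ (by simp; finiteness) ?_
    · simpa using h1
    · intro N
      have hm : Measurable fun p : ℝ × SystemPath E (N + D + 1) =>
          ENNReal.ofReal |rateGap S D lam rate p.1 p.2| :=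
        ENNReal.measurable_ofReal.comp (continuous_abs.measurable.comp
          (measurable_rateGap lam h.measurable (N + D)))
      exact hm.lintegral_prod_right'
    · refine fun N => Eventually.of_forall fun s => ?_
      refine (lintegral_mono fun ω => ENNReal.ofReal_le_ofReal
        (abs_taggedRate_sub_le hD1 hlam (by omega) _ (h.nonneg _ _) (h.le _ _))).trans ?_
      simp
    · filter_upwards [ae_restrict_mem measurableSet_Ioc] with s hs
      exact (tendsto_add_atTop_iff_nat D).2 (tendsto_lintegral_rateGap B hB hD1 hlam hμ hν h
        ⟨hs.1.le, hs.2.trans ht.2⟩)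
  rw [← tendsto_add_atTop_iff_nat D]
  refine squeeze_zero (fun N => tvDist_nonneg _ _) (fun N => ?_)
    ((ENNReal.tendsto_toReal ENNReal.zero_ne_top).comp hlim)
  rw [← hν (N + D)]
  exact tvDist_taggedLaw_le B hR h.measurable h.nonneg h.le hD1 hlam (by omega) ht.1 (μ (N + D))

end TaggedLimit

/-! ### Analytic tools for the mean-field limit -/

/-- This direction needs no measurability of the summands, which spares such proofs for iterated
integrals. -/
theorem sum_lintegral_le {α ι : Type*} [MeasurableSpace α] (μ : Measure α) (I : Finset ι)
    (f : ι → α → ENNReal) : ∑ j ∈ I, ∫⁻ x, f j x ∂μ ≤ ∫⁻ x, ∑ j ∈ I, f j x ∂μ := by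
  classical
  induction I using Finset.induction_on with
  | empty => simp
  | insert j I hj ih =>
    simp only [Finset.sum_insert hj]
    exact (add_le_add le_rfl ih).trans (le_lintegral_add _ _)

/-- A smoothing of the absolute value with slope at most `1` and quadratic error coefficient `1 / (2
* ε)`. With `p` and `q` the two square roots, the defect of the sharper bound with `p` in place of
`ε` is exactly `(p - q) ^ 2 / (2 * p)`. -/
theorem sqrt_sq_add_sq_le {ε : ℝ} (hε : 0 < ε) (x y : ℝ) :
    √(ε ^ 2 + y ^ 2) ≤ √(ε ^ 2 + x ^ 2) + x / √(ε ^ 2 + x ^ 2) * (y - x)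
      + 1 / (2 * ε) * (y - x) ^ 2 := by
  set p := √(ε ^ 2 + x ^ 2) with hp
  set q := √(ε ^ 2 + y ^ 2) with hq
  have hp2 : p ^ 2 = ε ^ 2 + x ^ 2 := Real.sq_sqrt (by positivity)
  have hq2 : q ^ 2 = ε ^ 2 + y ^ 2 := Real.sq_sqrt (by positivity)
  have hpε : ε ≤ p := Real.le_sqrt_of_sq_le (by nlinarith [sq_nonneg x])
  have hp0 : 0 < p := hε.trans_le hpε
  have h1 : q ≤ p + x / p * (y - x) + 1 / (2 * p) * (y - x) ^ 2 := by
    have : p + x / p * (y - x) + 1 / (2 * p) * (y - x) ^ 2 - q = (p - q) ^ 2 / (2 * p) := by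
      field_simp
      nlinarith
    have h2 : 0 ≤ (p - q) ^ 2 / (2 * p) := by positivity
    linarith
  have h2 : 1 / (2 * p) * (y - x) ^ 2 ≤ 1 / (2 * ε) * (y - x) ^ 2 := by gcongr
  linarith

theorem abs_div_sqrt_le_one {ε : ℝ} (hε : 0 < ε) (x : ℝ) : |x / √(ε ^ 2 + x ^ 2)| ≤ 1 := by
  have h : 0 < √(ε ^ 2 + x ^ 2) := Real.sqrt_pos.2 (by positivity)
  rw [abs_div, abs_of_pos h, div_le_one h]
  exact Real.abs_le_sqrt (by nlinarith [sq_nonneg ε])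

/-- A Grönwall inequality for bounded functions. -/
theorem le_of_le_add_lintegral {Y : ℝ → ENNReal} {α b : ENNReal} {c T : ℝ} (hc : 0 < c)
    (hb : b ≠ ⊤) (hYb : ∀ t, Y t ≤ b)
    (hY : ∀ t ∈ Icc 0 T, Y t ≤ α + ENNReal.ofReal c * ∫⁻ s in Ioc 0 t, Y s) :
    ∀ t ∈ Icc 0 T, Y t ≤ 2 * α * ENNReal.ofReal (Real.exp (2 * c * t)) := by
  -- In the supremum norm weighted by `exp (-2ct)` the integral term has norm at most `1 / 2` and
  -- can be absorbed, since the bound `b` makes the norm finite. No measurability of `Y` is needed.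
  let w : ℝ → ENNReal := fun t => ENNReal.ofReal (Real.exp (-(2 * c * t)))
  have hw : ∀ t, w t * ENNReal.ofReal (Real.exp (2 * c * t)) = 1 := fun t => by
    rw [← ENNReal.ofReal_mul (Real.exp_pos _).le, ← Real.exp_add]; simp
  let M : ENNReal := ⨆ t ∈ Icc 0 T, w t * Y t
  have hle : ∀ t ∈ Icc 0 T, w t * Y t ≤ M := fun t ht =>
    le_iSup₂_of_le (f := fun t (_ : t ∈ Icc 0 T) => w t * Y t) t ht le_rfl
  have hYM : ∀ t ∈ Icc 0 T, Y t ≤ M * ENNReal.ofReal (Real.exp (2 * c * t)) := fun t ht => by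
    calc Y t = w t * Y t * ENNReal.ofReal (Real.exp (2 * c * t)) := by
          rw [mul_right_comm, hw, one_mul]
      _ ≤ _ := mul_le_mul_left (hle t ht) _
  have hMb : M ≤ b := iSup₂_le fun t ht => by
    calc w t * Y t ≤ 1 * b := by
          refine mul_le_mul' ?_ (hYb t)
          rw [ENNReal.ofReal_le_one, Real.exp_le_one_iff]
          have := mul_nonneg hc.le ht.1
          linarith
      _ = b := one_mul b
  have hMt : M ≠ ⊤ := ne_top_of_le_ne_top hb hMb
  have hint : ∀ t, 0 ≤ t → ENNReal.ofReal c * ∫⁻ s in Ioc 0 t, ENNReal.ofReal (Real.exp (2 * c * s))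
      ≤ ENNReal.ofReal (Real.exp (2 * c * t)) / 2 := by
    intro t ht
    rw [← ofReal_integral_eq_lintegral_ofReal
      ((by fun_prop : Continuous fun s => Real.exp (2 * c * s)).integrableOn_Ioc)
      (Eventually.of_forall fun s => (Real.exp_pos _).le), ← intervalIntegral.integral_of_le ht,
      intervalIntegral.integral_comp_mul_left (fun x => Real.exp x) (by positivity : 2 * c ≠ 0),
      integral_exp, ← ENNReal.ofReal_mul hc.le, ← ENNReal.ofReal_ofNat 2,
      ← ENNReal.ofReal_div_of_pos two_pos]
    refine ENNReal.ofReal_le_ofReal ?_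
    have h1 : c * ((2 * c)⁻¹ • (Real.exp (2 * c * t) - Real.exp (2 * c * 0)))
        = Real.exp (2 * c * t) / 2 - 1 / 2 := by
      rw [mul_zero, Real.exp_zero, smul_eq_mul]; field_simp
    rw [h1]; linarith
  have hM : M ≤ α + M / 2 := iSup₂_le fun t ht => by
    have h1 : Y t ≤ α + M * (ENNReal.ofReal (Real.exp (2 * c * t)) / 2) := by
      refine (hY t ht).trans (add_le_add le_rfl ?_)
      calc _ ≤ ENNReal.ofReal c * ∫⁻ s in Ioc 0 t, M * ENNReal.ofReal (Real.exp (2 * c * s)) := by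
            refine mul_le_mul_right (setLIntegral_mono' measurableSet_Ioc fun s hs => ?_) _
            exact hYM s ⟨hs.1.le, hs.2.trans ht.2⟩
        _ = M * (ENNReal.ofReal c * ∫⁻ s in Ioc 0 t, ENNReal.ofReal (Real.exp (2 * c * s))) := by
            rw [lintegral_const_mul' _ _ hMt]; ring
        _ ≤ _ := mul_le_mul_right (hint t ht.1) _
    have hw1 : w t ≤ 1 := by
      rw [ENNReal.ofReal_le_one, Real.exp_le_one_iff]
      have := mul_nonneg hc.le ht.1
      linarith
    calc w t * Y t ≤ w t * (α + M * (ENNReal.ofReal (Real.exp (2 * c * t)) / 2)) :=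
          mul_le_mul_right h1 _
      _ = w t * α + (w t * ENNReal.ofReal (Real.exp (2 * c * t))) * (M / 2) := by
          simp only [div_eq_mul_inv]; ring
      _ ≤ α + M / 2 := by
          rw [hw, one_mul]
          exact add_le_add (mul_le_of_le_one_left' hw1) le_rfl
  have hM2 : M ≤ 2 * α := by
    have h1 : M / 2 + M / 2 ≤ α + M / 2 := (ENNReal.add_halves M).le.trans hM
    have h2 : M / 2 ≤ α := ENNReal.le_of_add_le_add_right (ENNReal.div_ne_top hMt two_ne_zero) h1
    calc M = 2 * (M / 2) := by rw [two_mul, ENNReal.add_halves]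
      _ ≤ _ := mul_le_mul_right h2 _
  exact fun t ht => (hYM t ht).trans (mul_le_mul_left hM2 _)

theorem lintegral_le_add_tvDist {α : Type*} [MeasurableSpace α] {μ ν : Measure α}
    [IsProbabilityMeasure μ] [IsProbabilityMeasure ν] {u : α → ℝ} (hu : Measurable u)
    (hu0 : ∀ x, 0 ≤ u x) (hu1 : ∀ x, u x ≤ 1) :
    ∫⁻ x, ENNReal.ofReal (u x) ∂μ ≤ ∫⁻ x, ENNReal.ofReal (u x) ∂ν
      + ENNReal.ofReal (tvDist μ ν) := by
  have hA : ∀ A, MeasurableSet A → μ A ≤ ν A + ENNReal.ofReal (tvDist μ ν) := by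
    intro A hA
    have hbdd : BddAbove (range fun A : {A : Set α // MeasurableSet A} => |μ.real A - ν.real A|) := by
      refine ⟨1, ?_⟩
      rintro _ ⟨A, rfl⟩
      have h1 := measureReal_nonneg (μ := μ) (s := A.1)
      have h2 := measureReal_nonneg (μ := ν) (s := A.1)
      have h3 := measureReal_le_one (μ := μ) (s := A.1)
      have h4 := measureReal_le_one (μ := ν) (s := A.1)
      rw [abs_le]; constructor <;> linarith
    have h1 := (le_abs_self _).trans (le_ciSup hbdd ⟨A, hA⟩)
    have h2 : μ.real A ≤ ν.real A + tvDist μ ν := by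
      simp only [tvDist] at h1 ⊢; linarith
    rw [← ofReal_measureReal, ← ofReal_measureReal, ← ENNReal.ofReal_add measureReal_nonneg
      (tvDist_nonneg μ ν)]
    exact ENNReal.ofReal_le_ofReal h2
  -- The layer-cake formula reduces functions with values in `[0, 1]` to their superlevel sets, on
  -- which the total variation acts directly.
  have hlayer : ∀ κ : Measure α, IsProbabilityMeasure κ →
      ∫⁻ x, ENNReal.ofReal (u x) ∂κ = ∫⁻ r in Ioc 0 1, κ {x | r ≤ u x} := by
    intro κ _
    rw [lintegral_eq_lintegral_meas_le κ (Eventually.of_forall hu0) hu.aemeasurable,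
      ← Ioc_union_Ioi_eq_Ioi zero_le_one, lintegral_union measurableSet_Ioi
        (Set.Ioc_disjoint_Ioi le_rfl)]
    rw [setLIntegral_congr_fun (g := fun _ => 0) measurableSet_Ioi, lintegral_zero, add_zero]
    intro r hr
    have : {x | r ≤ u x} = ∅ := by
      ext x; simpa using (hu1 x).trans_lt hr
    simp only [this, measure_empty]
  rw [hlayer μ inferInstance, hlayer ν inferInstance]
  calc _ ≤ ∫⁻ r in Ioc (0 : ℝ) 1, (ν {x | r ≤ u x} + ENNReal.ofReal (tvDist μ ν)) :=
        lintegral_mono fun r => hA _ (measurableSet_le measurable_const hu)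
    _ = _ := by
        rw [lintegral_add_right _ measurable_const]
        simp

theorem abs_integral_sub_le_tvDist {α : Type*} [MeasurableSpace α] {μ μ' ν : Measure α}
    [IsProbabilityMeasure μ] [IsProbabilityMeasure μ'] [IsProbabilityMeasure ν] {u : α → ℝ}
    (hu : Measurable u) (hu0 : ∀ x, 0 ≤ u x) (hu1 : ∀ x, u x ≤ 1) :
    |∫ x, u x ∂μ - ∫ x, u x ∂μ'| ≤ tvDist μ ν + tvDist μ' ν := by
  have key : ∀ κ : Measure α, IsProbabilityMeasure κ →
      |∫ x, u x ∂κ - ∫ x, u x ∂ν| ≤ tvDist κ ν := by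
    intro κ _
    have hle : ∀ v : α → ℝ, Measurable v → (∀ x, 0 ≤ v x) → (∀ x, v x ≤ 1) →
        ∫ x, v x ∂κ ≤ ∫ x, v x ∂ν + tvDist κ ν := by
      intro v hv hv0 hv1
      have hi : ∀ κ : Measure α, IsProbabilityMeasure κ → Integrable v κ := fun κ _ =>
        Integrable.of_bound hv.aestronglyMeasurable 1 (Eventually.of_forall fun x => by
          rw [Real.norm_eq_abs, abs_of_nonneg (hv0 x)]; exact hv1 x)
      have h := lintegral_le_add_tvDist (μ := κ) (ν := ν) hv hv0 hv1
      rw [← ofReal_integral_eq_lintegral_ofReal (hi κ inferInstance) (Eventually.of_forall hv0),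
        ← ofReal_integral_eq_lintegral_ofReal (hi ν inferInstance) (Eventually.of_forall hv0),
        ← ENNReal.ofReal_add (integral_nonneg hv0) (tvDist_nonneg _ _)] at h
      exact (ENNReal.ofReal_le_ofReal_iff (add_nonneg (integral_nonneg hv0)
        (tvDist_nonneg _ _))).1 h
    have h1 := hle u hu hu0 hu1
    have h2 := hle (fun x => 1 - u x) (hu.const_sub 1) (fun x => by linarith [hu1 x])
      (fun x => by linarith [hu0 x])
    have hi : ∀ κ : Measure α, IsProbabilityMeasure κ → Integrable u κ := fun κ _ =>
      Integrable.of_bound hu.aestronglyMeasurable 1 (Eventually.of_forall fun x => by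
        rw [Real.norm_eq_abs, abs_of_nonneg (hu0 x)]; exact hu1 x)
    rw [integral_sub (integrable_const _) (hi κ inferInstance),
      integral_sub (integrable_const _) (hi ν inferInstance)] at h2
    simp only [integral_const, probReal_univ, smul_eq_mul, mul_one] at h2
    rw [abs_le]; constructor <;> linarith
  have h1 := abs_le.1 (key μ inferInstance)
  have h2 := abs_le.1 (key μ' inferInstance)
  rw [abs_le]; constructor <;> linarith

/-- The mean absolute deviation of an average of `n` independent random variables. -/
theorem lintegral_abs_average_sub_le {E : Type*} [MeasurableSpace E] {n : ℕ} (hn : 0 < n)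
    (ν : Fin n → Measure E) [∀ i, IsProbabilityMeasure (ν i)] {u : E → ℝ} (hu : Measurable u)
    (hu0 : ∀ x, 0 ≤ u x) (hu1 : ∀ x, u x ≤ 1) {ε : ℝ} (hε : 0 < ε) :
    ∫⁻ z, ENNReal.ofReal |∑ i, (n : ℝ)⁻¹ * u (z i) - ∑ i, (n : ℝ)⁻¹ * ∫ e, u e ∂(ν i)|
      ∂(Measure.pi ν) ≤ ENNReal.ofReal (ε + 1 / (n * ε)) := by
  have hn' : (0 : ℝ) < n := by exact_mod_cast hn
  let v : E → ℝ := fun e => (n : ℝ)⁻¹ * u e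
  have hv : Measurable v := hu.const_mul _
  have hv0 : ∀ e, 0 ≤ v e := fun e => mul_nonneg (by positivity) (hu0 e)
  have hv1 : ∀ e, v e ≤ (n : ℝ)⁻¹ := fun e => mul_le_of_le_one_right (by positivity) (hu1 e)
  have hL : ∀ i, MemLp v 2 (ν i) := fun i => MemLp.of_bound hv.aestronglyMeasurable (n : ℝ)⁻¹
    (Eventually.of_forall fun e => by rw [Real.norm_eq_abs, abs_of_nonneg (hv0 e)]; exact hv1 e)
  have hvar := variance_sum_pi (μ := ν) (X := fun _ => v) hL
  have hvi : ∀ i, Var[v; ν i] ≤ ((n : ℝ)⁻¹) ^ 2 := fun i => by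
    refine (variance_le_expectation_sq hv.aestronglyMeasurable).trans ?_
    calc ∫ e, (v ^ 2) e ∂(ν i) ≤ ∫ _, ((n : ℝ)⁻¹) ^ 2 ∂(ν i) :=
          integral_mono_of_nonneg (f := v ^ 2) (Eventually.of_forall fun e => sq_nonneg (v e))
            (integrable_const _) (Eventually.of_forall fun e => pow_le_pow_left₀ (hv0 e) (hv1 e) 2)
      _ = _ := by simp
  -- By independence the variances add: `n` terms, each at most `n⁻¹ ^ 2`.
  have hVar : Var[∑ i, fun z : Fin n → E => v (z i); Measure.pi ν] ≤ (n : ℝ)⁻¹ := by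
    rw [hvar]
    refine (Finset.sum_le_sum fun i _ => hvi i).trans (le_of_eq ?_)
    simp only [Finset.sum_const, Finset.card_univ, Fintype.card_fin, nsmul_eq_mul]
    field_simp
  have hLz : ∀ i, MemLp (fun z : Fin n → E => v (z i)) 2 (Measure.pi ν) := fun i =>
    (hL i).comp_measurePreserving (measurePreserving_eval ν i)
  have hLs : MemLp (∑ i, fun z : Fin n → E => v (z i)) 2 (Measure.pi ν) :=
    memLp_finsetSum' _ fun i _ => hLz i
  have hmean : ∫ z, (∑ i, fun z : Fin n → E => v (z i)) z ∂(Measure.pi ν)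
      = ∑ i, (n : ℝ)⁻¹ * ∫ e, u e ∂(ν i) := by
    simp only [Finset.sum_apply]
    rw [integral_finsetSum _ fun i _ => (hLz i).integrable one_le_two]
    refine Finset.sum_congr rfl fun i _ => ?_
    rw [integral_comp_eval (μ := ν) (f := v) hv.aestronglyMeasurable]
    exact integral_const_mul _ _
  rw [variance_eq_integral hLs.aestronglyMeasurable.aemeasurable, hmean] at hVar
  have hi : Integrable (fun z => ((∑ i, fun z : Fin n → E => v (z i)) z
      - ∑ i, (n : ℝ)⁻¹ * ∫ e, u e ∂(ν i)) ^ 2) (Measure.pi ν) :=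
    (hLs.sub (memLp_const _)).integrable_sq
  calc _ ≤ ∫⁻ z, ENNReal.ofReal (ε + ((∑ i, fun z : Fin n → E => v (z i)) z
          - ∑ i, (n : ℝ)⁻¹ * ∫ e, u e ∂(ν i)) ^ 2 / ε) ∂(Measure.pi ν) := by
        refine lintegral_mono fun z => ENNReal.ofReal_le_ofReal ?_
        have := abs_le_add_sq_div (x := (∑ i, fun z : Fin n → E => v (z i)) z
          - ∑ i, (n : ℝ)⁻¹ * ∫ e, u e ∂(ν i)) hε
        simpa [v, Finset.sum_apply] using this
    _ = ENNReal.ofReal (∫ z, (ε + ((∑ i, fun z : Fin n → E => v (z i)) z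
          - ∑ i, (n : ℝ)⁻¹ * ∫ e, u e ∂(ν i)) ^ 2 / ε) ∂(Measure.pi ν)) := by
        refine (ofReal_integral_eq_lintegral_ofReal (f := fun z => ε + ((∑ i, fun z : Fin n → E =>
          v (z i)) z - ∑ i, (n : ℝ)⁻¹ * ∫ e, u e ∂(ν i)) ^ 2 / ε) ((integrable_const ε).add
          (hi.div_const ε)) (Eventually.of_forall fun z => ?_)).symm
        have : 0 ≤ ε + ((∑ i, fun z : Fin n → E => v (z i)) z
          - ∑ i, (n : ℝ)⁻¹ * ∫ e, u e ∂(ν i)) ^ 2 / ε := by positivity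
        exact this
    _ ≤ _ := by
        refine ENNReal.ofReal_le_ofReal ?_
        rw [integral_add (integrable_const _) (hi.div_const _), integral_div]
        simp only [integral_const, probReal_univ, smul_eq_mul, one_mul]
        refine add_le_add le_rfl ((div_le_div_of_nonneg_right hVar hε.le).trans (le_of_eq ?_))
        field_simp

/-! ### Fractions of servers with given queue lengths -/

section Fractions

variable {n : ℕ}

/-- The fraction of the servers whose queue length is in `A`. -/
noncomputable def frac (A : Set ℕ) (x : Fin n → ℕ) : ℝ :=
  ∑ i, (n : ℝ)⁻¹ * A.indicator (fun _ => 1) (x i)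

theorem indicator_one_nonneg (A : Set ℕ) (k : ℕ) : (0 : ℝ) ≤ A.indicator (fun _ => 1) k :=
  indicator_nonneg (fun _ _ => zero_le_one) _

theorem indicator_one_le (A : Set ℕ) (k : ℕ) : A.indicator (fun _ => (1 : ℝ)) k ≤ 1 :=
  indicator_le_self' (f := fun _ => (1 : ℝ)) (fun _ _ => zero_le_one) k

theorem frac_nonneg (A : Set ℕ) (x : Fin n → ℕ) : 0 ≤ frac A x :=
  Finset.sum_nonneg fun _ _ => mul_nonneg (by positivity) (indicator_one_nonneg _ _)

theorem sum_inv_le_one : ∑ _i : Fin n, (n : ℝ)⁻¹ ≤ 1 := by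
  rcases Nat.eq_zero_or_pos n with rfl | hn
  · simp
  · have : (n : ℝ) ≠ 0 := by exact_mod_cast hn.ne'
    simp [this]

theorem frac_le_one (A : Set ℕ) (x : Fin n → ℕ) : frac A x ≤ 1 :=
  (Finset.sum_le_sum fun _ _ => mul_le_of_le_one_right (by positivity)
    (indicator_one_le _ _)).trans sum_inv_le_one

theorem frac_mono {A A' : Set ℕ} (h : A ⊆ A') (x : Fin n → ℕ) : frac A x ≤ frac A' x :=
  Finset.sum_le_sum fun _ _ => mul_le_mul_of_nonneg_left
    (indicator_le_indicator_of_subset h (fun _ => zero_le_one) _) (by positivity)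

theorem frac_Ici (x : Fin n → ℕ) (k : ℕ) : frac (Ici k) x = numGE x k / n := by
  rw [frac, numGE, ← Finset.mul_sum, Finset.card_filter, div_eq_inv_mul]
  congr 1
  push_cast
  exact Finset.sum_congr rfl fun i _ => by simp [indicator]

/-- The `j`-th of the sets `{0}, …, {K - 1}, [K, ∞)`. -/
def cell (K j : ℕ) : Set ℕ := {k | min k K = j}

theorem mem_cell {K j k : ℕ} : k ∈ cell K j ↔ min k K = j := Iff.rfl

theorem indicator_Ici_eq_sum {k K : ℕ} (h : k ≤ K) (m : ℕ) :
    (Ici k).indicator (fun _ => (1 : ℝ)) m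
      = ∑ j ∈ Finset.range (K + 1), if k ≤ j then (cell K j).indicator (fun _ => 1) m else 0 := by
  rw [Finset.sum_eq_single (min m K)]
  · have h1 : (cell K (min m K)).indicator (fun _ => (1 : ℝ)) m = 1 :=
      indicator_of_mem (mem_cell.2 rfl) _
    rw [h1]
    by_cases hk : k ≤ m
    · rw [if_pos (le_min hk h)]; simp [hk]
    · rw [if_neg (fun h' => hk (h'.trans (min_le_left _ _)))]; simp [hk]
  · intro j _ hj
    have : m ∉ cell K j := fun h' => hj h'.symm
    simp [this]
  · intro h'
    exact absurd (Finset.mem_range.2 (Nat.lt_succ_of_le (min_le_right m K))) h'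

theorem frac_Ici_eq_sum {k K : ℕ} (h : k ≤ K) (x : Fin n → ℕ) :
    frac (Ici k) x = ∑ j ∈ Finset.range (K + 1), if k ≤ j then frac (cell K j) x else 0 := by
  simp only [frac, indicator_Ici_eq_sum h, Finset.mul_sum]
  rw [Finset.sum_comm]
  refine Finset.sum_congr rfl fun j _ => ?_
  split_ifs <;> simp

end Fractions

/-! ### The mean-field limit -/

section Chaos

variable {E : Type*} [MeasurableSpace E] {S : ServiceDiscipline E} {D n : ℕ}

/-- The indicator of the states with queue length in `A`. -/
noncomputable def queueIn (S : ServiceDiscipline E) (A : Set ℕ) : E → ENNReal :=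
  {e | S.queueLength e ∈ A}.indicator fun _ => 1

theorem measurable_queueIn (A : Set ℕ) : Measurable (queueIn S A) :=
  measurable_const.indicator (measurable_queueLength S (MeasurableSet.of_discrete (s := A)))

theorem queueIn_le_one (A : Set ℕ) (e : E) : queueIn S A e ≤ 1 :=
  indicator_le_self' (f := fun _ => (1 : ENNReal)) (fun _ _ => zero_le) e

theorem toReal_queueIn (A : Set ℕ) (e : E) :
    (queueIn S A e).toReal = A.indicator (fun _ => 1) (S.queueLength e) := by
  by_cases h : S.queueLength e ∈ A <;> simp [queueIn, h]

theorem sum_queueIn_cell (K : ℕ) (e : E) :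
    ∑ j ∈ Finset.range (K + 1), queueIn S (cell K j) e = 1 := by
  rw [Finset.sum_eq_single (min (S.queueLength e) K)]
  · simp [queueIn, mem_cell]
  · intro j _ hj
    simp [queueIn, mem_cell, hj.symm]
  · intro h'
    exact absurd (Finset.mem_range.2 (Nat.lt_succ_of_le (min_le_right _ K))) h'

variable {R : ℝ} {rate : ℝ → ℕ → ℝ} (B : Measure ℝ) [IsProbabilityMeasure B]
  (hR : 0 < R) (hrate : ∀ k, Measurable fun t => rate t k)
  (hrate0 : ∀ s k, 0 ≤ rate s k) (hrateR : ∀ s k, rate s k ≤ R) {t : ℝ}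

include hrate in
-- Before and after the arrival the probabilities of the disjoint cells sum to at most `1`. The
-- bound is free of `K`, which keeps `K` out of the Grönwall constant.
theorem sum_abs_arrivalGain_cell_le (K : ℕ) (s : ℝ) (e : E) :
    ∑ j ∈ Finset.range (K + 1), |arrivalGain S R rate B t (queueIn S (cell K j)) s e| ≤ 2 := by
  have hsum : ∀ e, ∑ j ∈ Finset.range (K + 1), queueProb S R rate B t (queueIn S (cell K j)) s e
      ≤ 1 := by
    intro e
    have h := sum_queueValue_le S (R := R) (t := t) B (Finset.range (K + 1))
      (f := fun j => queueIn S (cell K j)) hrate (fun j => measurable_queueIn _)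
      (fun e => (sum_queueIn_cell K e).le) s e
    have h1 := ENNReal.toReal_mono ENNReal.one_ne_top h
    rwa [ENNReal.toReal_sum fun j _ => ne_top_of_le_ne_top ENNReal.one_ne_top
      (queueValue_le_one S B hrate (measurable_queueIn _) (queueIn_le_one _) s e),
      ENNReal.toReal_one] at h1
  have hint : ∀ j, Integrable (fun b => queueProb S R rate B t (queueIn S (cell K j)) s
      (S.arrive e b)) B := fun j =>
    integrable_queueProb_arrive S B hrate (measurable_queueIn _) (queueIn_le_one _) s e
  have h1 : ∑ j ∈ Finset.range (K + 1), ∫ b, queueProb S R rate B t (queueIn S (cell K j)) s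
      (S.arrive e b) ∂B ≤ 1 := by
    rw [← integral_finsetSum _ fun j _ => hint j]
    refine (integral_mono (integrable_finsetSum _ fun j _ => hint j) (integrable_const 1)
      fun b => hsum _).trans (by simp)
  calc _ ≤ ∑ j ∈ Finset.range (K + 1), ((∫ b, queueProb S R rate B t (queueIn S (cell K j)) s
      (S.arrive e b) ∂B) + queueProb S R rate B t (queueIn S (cell K j)) s e) := by
        refine Finset.sum_le_sum fun j _ => ?_
        have h2 : 0 ≤ ∫ b, queueProb S R rate B t (queueIn S (cell K j)) s (S.arrive e b) ∂B :=
          integral_nonneg fun b => queueProb_nonneg S B _ _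
        have h3 : 0 ≤ queueProb S R rate B t (queueIn S (cell K j)) s e := queueProb_nonneg S B _ _
        rw [arrivalGain, abs_le]; constructor <;> linarith
    _ ≤ 2 := by
        rw [Finset.sum_add_distrib]
        linarith [hsum e]

/-- The constant in the bound on the fluctuations of the fractions. -/
noncomputable def chaosConst (D : ℕ) (lam t : ℝ) : ℝ := 3 + 5 / 2 * D ^ 2 * (1 + lam * t)

/-- The mean of the value function over the servers. -/
noncomputable def meanValue (S : ServiceDiscipline E) (R : ℝ) (rate : ℝ → ℕ → ℝ) (B : Measure ℝ)
    (t : ℝ) (ν : Fin n → Measure E) (A : Set ℕ) : ℝ :=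
  ∑ i, (n : ℝ)⁻¹ * ∫ e, queueProb S R rate B t (queueIn S A) 0 e ∂(ν i)

include hR hrate hrate0 hrateR

/-- Propagation of concentration from time `0` to time `t`: independence is used only for the
initial average of the value functions. Afterwards the Dynkin-type inequality with equal weights
controls noise and drift. -/
theorem lintegral_abs_frac_sub_le (hD1 : 1 ≤ D) {lam : ℝ} (hlam : 0 < lam) (hRD : R ≤ lam * D)
    (hn : 0 < n) (ν : Fin n → Measure E) [∀ i, IsProbabilityMeasure (ν i)] (ht : 0 ≤ t)
    (A : Set ℕ) :
    ∫⁻ ω, ENNReal.ofReal |frac A (queueLengths S D lam ω t) - meanValue S R rate B t ν A|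
        ∂(systemMeasure B (Measure.pi ν))
      ≤ ENNReal.ofReal (chaosConst D lam t / √n) + ∫⁻ s in Ioc 0 t, ∫⁻ ω, ENNReal.ofReal
          (∑ i, (n : ℝ)⁻¹ * |lam * n * receiveProb D (queueLengths S D lam ω s) i
              - rate s (queueLengths S D lam ω s i)| *
            |arrivalGain S R rate B t (queueIn S A) s (systemState S D lam ω s i)|)
          ∂(systemMeasure B (Measure.pi ν)) := by
  have hn' : (1 : ℝ) ≤ n := by exact_mod_cast hn
  have hn0 : (0 : ℝ) < n := by linarith
  have hs : 0 < √(n : ℝ) := Real.sqrt_pos.2 hn0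
  have hss : √(n : ℝ) ^ 2 = n := Real.sq_sqrt hn0.le
  have hfm := measurable_queueIn (S := S) A
  have hf := queueIn_le_one (S := S) A
  set m := meanValue S R rate B t ν A with hm
  -- This balances the error `ε` of the smoothing against the noise: about `n` steps of squared size
  -- `1 / n ^ 2` with curvature `1 / ε` contribute order `1 / (n * ε)`.
  set ε : ℝ := 1 / √n with hεdef
  have hε : 0 < ε := by positivity
  -- The weights alone would permit `a = 1 / n`; the factor `D` is what the drift condition needs,
  -- as `R` may be as large as `lam * D`.
  have key := lintegral_comp_systemState_le (S := S) (D := D) B hR hrate hrate0 hrateR hfm hf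
    (by positivity : 0 < lam * n) (Measure.pi ν) (w := fun _ => (n : ℝ)⁻¹) (a := D / n)
    (fun _ => by positivity) (fun _ => by
      rw [inv_eq_one_div]
      have : (1 : ℝ) ≤ D := by exact_mod_cast hD1
      gcongr) (by
      calc R * ∑ _i : Fin n, (n : ℝ)⁻¹ ≤ R * 1 := mul_le_mul_of_nonneg_left sum_inv_le_one hR.le
        _ ≤ lam * n * (D / n) := by
          rw [mul_one]; refine hRD.trans (le_of_eq ?_); field_simp) ht
    (ψ := fun x => √(ε ^ 2 + (x - m) ^ 2)) (ψ' := fun x => (x - m) / √(ε ^ 2 + (x - m) ^ 2))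
    (κ := 1 / (2 * ε)) (by fun_prop) (fun _ _ => Real.sqrt_nonneg _) (by positivity)
    (fun x => abs_div_sqrt_le_one hε _) (fun x y => by
      have := sqrt_sq_add_sq_le hε (x - m) (y - m)
      simpa using this)
  have h1 : ∫⁻ ω, ENNReal.ofReal |frac A (queueLengths S D lam ω t) - m|
      ∂(systemMeasure B (Measure.pi ν)) ≤ ∫⁻ ω, ENNReal.ofReal (√(ε ^ 2 + ((∑ i, (n : ℝ)⁻¹ *
        (queueIn S A (systemState S D lam ω t i)).toReal) - m) ^ 2))
        ∂(systemMeasure B (Measure.pi ν)) := by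
    refine lintegral_mono fun ω => ENNReal.ofReal_le_ofReal ?_
    simp only [toReal_queueIn]
    exact Real.abs_le_sqrt (le_add_of_nonneg_left (sq_nonneg ε))
  have h2 : ∫⁻ z, ENNReal.ofReal (√(ε ^ 2 + ((∑ i, (n : ℝ)⁻¹ *
      queueProb S R rate B t (queueIn S A) 0 (z i)) - m) ^ 2)) ∂(Measure.pi ν)
      ≤ ENNReal.ofReal (3 * ε) := by
    have h3 := lintegral_abs_average_sub_le hn ν (u := fun e => queueProb S R rate B t (queueIn S A) 0 e)
      ((measurable_queueProb S B hrate hfm).comp (measurable_const.prodMk measurable_id))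
      (fun e => queueProb_nonneg S B 0 e) (fun e => queueProb_le_one S B hrate hfm hf 0 e) hε
    calc _ ≤ ∫⁻ z, (ENNReal.ofReal ε + ENNReal.ofReal |∑ i, (n : ℝ)⁻¹ *
        queueProb S R rate B t (queueIn S A) 0 (z i) - m|) ∂(Measure.pi ν) := by
          refine lintegral_mono fun z => ?_
          rw [← ENNReal.ofReal_add hε.le (abs_nonneg _)]
          refine ENNReal.ofReal_le_ofReal ?_
          rw [Real.sqrt_le_left (by positivity), ← sq_abs (_ - m)]
          nlinarith [abs_nonneg (∑ i, (n : ℝ)⁻¹ *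
            queueProb S R rate B t (queueIn S A) 0 (z i) - m)]
      _ ≤ ENNReal.ofReal ε + ENNReal.ofReal (ε + 1 / (n * ε)) := by
          rw [lintegral_add_left measurable_const, lintegral_const, measure_univ, mul_one]
          exact add_le_add le_rfl h3
      _ = _ := by
          rw [← ENNReal.ofReal_add hε.le (by positivity)]
          congr 1
          have : 1 / ((n : ℝ) * ε) = ε := by
            rw [hεdef, ← hss]; field_simp
            rw [Real.sqrt_sq hs.le]
          rw [this]; ring
  have h3 : ENNReal.ofReal (5 * (1 / (2 * ε)) * (D / n) ^ 2) * ENNReal.ofReal (1 + lam * n * t)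
      ≤ ENNReal.ofReal (5 / 2 * D ^ 2 * (1 + lam * t) / √n) := by
    rw [← ENNReal.ofReal_mul (by positivity)]
    refine ENNReal.ofReal_le_ofReal ?_
    have h4 : (1 + lam * n * t) / n ≤ 1 + lam * t := by
      rw [div_le_iff₀ hn0]
      nlinarith
    calc 5 * (1 / (2 * ε)) * (D / n) ^ 2 * (1 + lam * n * t)
        = 5 / 2 * D ^ 2 / √n * ((1 + lam * n * t) / n) := by
          rw [hεdef]
          field_simp
          rw [hss]
      _ ≤ 5 / 2 * D ^ 2 / √n * (1 + lam * t) := mul_le_mul_of_nonneg_left h4 (by positivity)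
      _ = _ := by ring
  refine h1.trans (key.trans ?_)
  have h5 : ENNReal.ofReal (chaosConst D lam t / √n) = ENNReal.ofReal (3 * ε)
      + ENNReal.ofReal (5 / 2 * D ^ 2 * (1 + lam * t) / √n) := by
    rw [← ENNReal.ofReal_add (by positivity) (by positivity), chaosConst, hεdef]
    congr 1; ring
  rw [h5, add_assoc, add_comm (ENNReal.ofReal (5 / 2 * (D : ℝ) ^ 2 * (1 + lam * t) / √n))]
  refine add_le_add h2 (add_le_add ?_ h3)
  refine lintegral_mono fun s => lintegral_mono fun ω => ENNReal.ofReal_le_ofReal ?_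
  refine (Finset.abs_sum_le_sum_abs _ _).trans (le_of_eq (Finset.sum_congr rfl fun i _ => ?_))
  rw [abs_mul, abs_mul, abs_of_nonneg (by positivity : 0 ≤ (n : ℝ)⁻¹), ← mul_assoc]

/-- The joint fluctuations of the fractions of servers in the sets `cell K j`. -/
theorem sum_lintegral_abs_frac_sub_le (hD1 : 1 ≤ D) {lam : ℝ} (hlam : 0 < lam) (hRD : R ≤ lam * D)
    (hn : 0 < n) (ν : Fin n → Measure E) [∀ i, IsProbabilityMeasure (ν i)] (ht : 0 ≤ t) (K : ℕ) :
    ∑ j ∈ Finset.range (K + 1), ∫⁻ ω, ENNReal.ofReal |frac (cell K j) (queueLengths S D lam ω t)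
        - meanValue S R rate B t ν (cell K j)| ∂(systemMeasure B (Measure.pi ν))
      ≤ (K + 1 : ℕ) * ENNReal.ofReal (chaosConst D lam t / √n) + 2 * ∫⁻ s in Ioc 0 t, ∫⁻ ω,
          ENNReal.ofReal (∑ i, (n : ℝ)⁻¹ * |lam * n * receiveProb D (queueLengths S D lam ω s) i
              - rate s (queueLengths S D lam ω s i)|) ∂(systemMeasure B (Measure.pi ν)) := by
  refine (Finset.sum_le_sum fun j _ => lintegral_abs_frac_sub_le B hR hrate hrate0 hrateR hD1 hlam
    hRD hn ν ht (cell K j)).trans ?_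
  rw [Finset.sum_add_distrib]
  refine add_le_add (by simp) ?_
  refine (sum_lintegral_le _ _ _).trans ?_
  rw [← lintegral_const_mul' _ _ (by simp)]
  refine lintegral_mono fun s => (sum_lintegral_le _ _ _).trans ?_
  rw [← lintegral_const_mul' _ _ (by simp)]
  refine lintegral_mono fun ω => ?_
  rw [← ENNReal.ofReal_sum_of_nonneg fun j _ => Finset.sum_nonneg fun i _ => by positivity,
    ← ENNReal.ofReal_ofNat 2, ← ENNReal.ofReal_mul zero_le_two, Finset.sum_comm]
  refine ENNReal.ofReal_le_ofReal ?_
  rw [Finset.mul_sum]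
  refine Finset.sum_le_sum fun i _ => ?_
  rw [← Finset.mul_sum, mul_comm 2]
  exact mul_le_mul_of_nonneg_left (sum_abs_arrivalGain_cell_le B hrate K s _) (by positivity)

end Chaos

/-! ### Arrival rates as Lipschitz functions of the fractions of servers. -/

section RateComparison

variable {n D : ℕ}

/-- Up to level `K` a tail is a sum of cells. Above `K` both tails are dominated by their values at
`K`, where the random one is within the cell error of `a K`. -/
theorem abs_frac_Ici_sub_le {K : ℕ} (x : Fin n → ℕ) {a b : ℕ → ℝ} (ha0 : ∀ k, 0 ≤ a k)
    (haK : ∀ k, K ≤ k → a k ≤ a K)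
    (hab : ∀ k ≤ K, a k = ∑ j ∈ Finset.range (K + 1), if k ≤ j then b j else 0) (k : ℕ) :
    |frac (Ici k) x - a k|
      ≤ ∑ j ∈ Finset.range (K + 1), |frac (cell K j) x - b j| + 2 * a K := by
  have key : ∀ k ≤ K, |frac (Ici k) x - a k|
      ≤ ∑ j ∈ Finset.range (K + 1), |frac (cell K j) x - b j| := by
    intro k hk
    rw [frac_Ici_eq_sum hk, hab k hk, ← Finset.sum_sub_distrib]
    refine (Finset.abs_sum_le_sum_abs _ _).trans (Finset.sum_le_sum fun j _ => ?_)
    split_ifs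
    · exact le_rfl
    · simp
  rcases le_total k K with hk | hk
  · linarith [key k hk, ha0 K]
  · have h1 := key K le_rfl
    have h2 := frac_mono (Ici_subset_Ici.2 hk) x
    have h3 := frac_nonneg (Ici k) x
    have h4 := haK k hk
    have h5 := ha0 k
    have h6 := (abs_le.1 h1).2
    rw [abs_le]
    constructor <;> linarith

/-- Three errors enter: the finite-size error of the rate, and, through the Lipschitz bound for
`jsqPoly` in its two arguments, the tail beyond `K` and the deviations on the cells. -/
theorem sum_abs_receiveProb_sub_le (hD1 : 1 ≤ D) (hD : D ≤ n) {lam : ℝ} (hlam : 0 < lam) {K : ℕ}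
    (x : Fin n → ℕ) {a b : ℕ → ℝ} (ha0 : ∀ k, 0 ≤ a k) (ha1 : ∀ k, a k ≤ 1)
    (haK : ∀ k, K ≤ k → a k ≤ a K)
    (hab : ∀ k ≤ K, a k = ∑ j ∈ Finset.range (K + 1), if k ≤ j then b j else 0) :
    ∑ i, (n : ℝ)⁻¹ * |lam * n * receiveProb D x i - lam * jsqPoly D (a (x i)) (a (x i + 1))|
      ≤ lam * rateError D n + 4 * lam * D ^ 2 * a K
        + 2 * lam * D ^ 2 * ∑ j ∈ Finset.range (K + 1), |frac (cell K j) x - b j| := by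
  set V := ∑ j ∈ Finset.range (K + 1), |frac (cell K j) x - b j| with hV
  have hV0 : 0 ≤ V := Finset.sum_nonneg fun _ _ => abs_nonneg _
  set C := lam * rateError D n + 4 * lam * D ^ 2 * a K + 2 * lam * D ^ 2 * V with hC
  have hC0 : 0 ≤ C := by
    have := rateError_nonneg D n
    have := ha0 K
    positivity
  have hi : ∀ i, |lam * n * receiveProb D x i - lam * jsqPoly D (a (x i)) (a (x i + 1))| ≤ C := by
    intro i
    have h1 := abs_mul_receiveProb_sub_le hD1 hD x i
    rw [← frac_Ici, ← frac_Ici] at h1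
    have h2 := abs_jsqPoly_sub_le D (frac_nonneg (Ici (x i)) x) (frac_le_one _ x)
      (frac_nonneg (Ici (x i + 1)) x) (frac_le_one _ x) (ha0 (x i)) (ha1 (x i)) (ha0 (x i + 1))
      (ha1 (x i + 1))
    have h3 := abs_frac_Ici_sub_le x ha0 haK hab (x i)
    have h4 := abs_frac_Ici_sub_le x ha0 haK hab (x i + 1)
    have h5 : (D : ℝ) ^ 2 * (|frac (Ici (x i)) x - a (x i)| + |frac (Ici (x i + 1)) x - a (x i + 1)|)
        ≤ D ^ 2 * ((V + 2 * a K) + (V + 2 * a K)) := by gcongr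
    rw [mul_assoc, ← mul_sub, abs_mul, abs_of_pos hlam]
    calc _ ≤ lam * (rateError D n + D ^ 2 * ((V + 2 * a K) + (V + 2 * a K))) := by
          refine mul_le_mul_of_nonneg_left ?_ hlam.le
          exact (abs_sub_le _ _ _).trans (add_le_add h1 (h2.trans h5))
      _ = C := by rw [hC]; ring
  calc _ ≤ ∑ _i : Fin n, (n : ℝ)⁻¹ * C :=
        Finset.sum_le_sum fun i _ => mul_le_mul_of_nonneg_left (hi i) (by positivity)
    _ ≤ 1 * C := by
        rw [← Finset.sum_mul]
        exact mul_le_mul_of_nonneg_right sum_inv_le_one hC0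
    _ = C := one_mul C

end RateComparison

theorem ofReal_abs_integral_sub_le {Ω : Type*} [MeasurableSpace Ω] {P : Measure Ω}
    [IsProbabilityMeasure P] {X : Ω → ℝ} (hX : Integrable X P) (m : ℝ) :
    ENNReal.ofReal |∫ ω, X ω ∂P - m| ≤ ∫⁻ ω, ENNReal.ofReal |X ω - m| ∂P := by
  have h1 : ∫ ω, (X ω - m) ∂P = ∫ ω, X ω ∂P - m := by
    rw [integral_sub hX (integrable_const m)]; simp
  have h2 := enorm_integral_le_lintegral_enorm (μ := P) fun ω => X ω - m
  rw [h1] at h2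
  simpa [← ofReal_norm] using h2

/-! ### Expected fractions and the rates computed from them. -/

section MeanField

variable {E : Type*} [MeasurableSpace E] (S : ServiceDiscipline E) (B : Measure ℝ)
  [IsProbabilityMeasure B] (D : ℕ) (lam : ℝ) (ν : ℕ → Measure E)

/-- The law of independent initial states. -/
noncomputable def initLaw (N : ℕ) : Measure (Fin (N + 1) → E) :=
  Measure.pi fun i : Fin (N + 1) => ν i

instance [∀ i, IsProbabilityMeasure (ν i)] (N : ℕ) : IsProbabilityMeasure (initLaw ν N) := by
  unfold initLaw; infer_instance

/-- The average of the laws of the initial states. -/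
noncomputable def averageLaw (N : ℕ) : Measure E :=
  (((N + 1 : ℕ) : ENNReal)⁻¹) • ∑ i ∈ Finset.range (N + 1), ν i

instance [∀ i, IsProbabilityMeasure (ν i)] (N : ℕ) : IsProbabilityMeasure (averageLaw ν N) := by
  constructor
  simp only [averageLaw, Measure.smul_apply, Measure.finsetSum_apply, measure_univ, smul_eq_mul,
    Finset.sum_const, Finset.card_range, nsmul_eq_mul, mul_one]
  exact ENNReal.inv_mul_cancel (by simp) (by finiteness)

/-- The expected fraction of the servers with queue length in `A`. -/
noncomputable def fieldMean (N : ℕ) (A : Set ℕ) (s : ℝ) : ℝ :=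
  ∫ ω, frac A (queueLengths S D lam ω s) ∂(systemMeasure B (initLaw ν N))

/-- The arrival rates computed from the expected fractions. -/
noncomputable def fieldRate (N : ℕ) (s : ℝ) (k : ℕ) : ℝ :=
  lam * jsqPoly D (fieldMean S B D lam ν N (Ici k) s) (fieldMean S B D lam ν N (Ici (k + 1)) s)

/-- The distance of the random fractions in system `N` from the expected ones in system `M`. -/
noncomputable def fluct (N M K : ℕ) (s : ℝ) : ENNReal :=
  ∑ j ∈ Finset.range (K + 1), ∫⁻ ω, ENNReal.ofReal |frac (cell K j) (queueLengths S D lam ω s)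
    - fieldMean S B D lam ν M (cell K j) s| ∂(systemMeasure B (initLaw ν N))

variable {S B D lam ν}

theorem measurable_frac_queueLengths {n : ℕ} (A : Set ℕ) :
    Measurable fun p : SystemPath E n × ℝ => frac A (queueLengths S D lam p.1 p.2) :=
  (measurable_of_countable fun x : Fin n → ℕ => frac A x).comp
    (measurable_pi_lambda _ fun i => measurable_queueLengths S D lam i)

theorem measurable_frac_queueLengths_apply {n : ℕ} (A : Set ℕ) (s : ℝ) :
    Measurable fun ω : SystemPath E n => frac A (queueLengths S D lam ω s) :=
  (measurable_of_countable fun x : Fin n → ℕ => frac A x).comp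
    (measurable_pi_lambda _ fun i => measurable_queueLengths_apply lam s i)

theorem fieldMean_nonneg (N : ℕ) (A : Set ℕ) (s : ℝ) : 0 ≤ fieldMean S B D lam ν N A s :=
  integral_nonneg fun _ => frac_nonneg _ _

variable [∀ i, IsProbabilityMeasure (ν i)]

theorem integrable_frac (N : ℕ) (A : Set ℕ) (s : ℝ) :
    Integrable (fun ω => frac A (queueLengths S D lam ω s)) (systemMeasure B (initLaw ν N)) :=
  Integrable.of_bound (measurable_frac_queueLengths_apply A s).aestronglyMeasurable 1
    (Eventually.of_forall fun ω => by
      rw [Real.norm_eq_abs, abs_of_nonneg (frac_nonneg _ _)]; exact frac_le_one _ _)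

theorem fieldMean_le_one (N : ℕ) (A : Set ℕ) (s : ℝ) : fieldMean S B D lam ν N A s ≤ 1 :=
  (integral_mono (integrable_frac N A s) (integrable_const 1) fun _ => frac_le_one _ _).trans
    (by simp)

theorem fieldMean_mono (N : ℕ) {A A' : Set ℕ} (h : A ⊆ A') (s : ℝ) :
    fieldMean S B D lam ν N A s ≤ fieldMean S B D lam ν N A' s :=
  integral_mono (integrable_frac N A s) (integrable_frac N A' s) fun _ => frac_mono h _

theorem fieldMean_Ici_eq_sum (N : ℕ) {k K : ℕ} (h : k ≤ K) (s : ℝ) :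
    fieldMean S B D lam ν N (Ici k) s = ∑ j ∈ Finset.range (K + 1),
      if k ≤ j then fieldMean S B D lam ν N (cell K j) s else 0 := by
  simp only [fieldMean, frac_Ici_eq_sum h]
  rw [integral_finsetSum]
  · refine Finset.sum_congr rfl fun j _ => ?_
    split_ifs <;> simp
  · intro j _
    split_ifs
    · exact integrable_frac N _ s
    · exact integrable_const _

theorem measurable_fieldMean (N : ℕ) (A : Set ℕ) : Measurable (fieldMean S B D lam ν N A) := by
  have h := (measurable_frac_queueLengths (S := S) (D := D) (lam := lam) (n := N + 1) A).comp
    measurable_swap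
  exact (h.stronglyMeasurable.integral_prod_right' (ν := systemMeasure B (initLaw ν N))).measurable

theorem measurable_fieldRate (N k : ℕ) : Measurable fun s => fieldRate S B D lam ν N s k :=
  ((measurable_jsqPoly D).comp ((measurable_fieldMean N _).prodMk
    (measurable_fieldMean N _))).const_mul lam

omit [∀ i, IsProbabilityMeasure (ν i)] in
theorem fieldRate_nonneg (hlam : 0 < lam) (N : ℕ) (s : ℝ) (k : ℕ) :
    0 ≤ fieldRate S B D lam ν N s k :=
  mul_nonneg hlam.le (jsqPoly_nonneg D (fieldMean_nonneg _ _ _) (fieldMean_nonneg _ _ _))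

theorem fieldRate_le (hlam : 0 < lam) (N : ℕ) (s : ℝ) (k : ℕ) :
    fieldRate S B D lam ν N s k ≤ lam * D :=
  mul_le_mul_of_nonneg_left (jsqPoly_le D (fieldMean_nonneg _ _ _) (fieldMean_le_one _ _ _)
    (fieldMean_nonneg _ _ _) (fieldMean_le_one _ _ _)) hlam.le

omit [∀ i, IsProbabilityMeasure (ν i)] in
theorem integral_averageLaw (N : ℕ) {u : E → ℝ} (hu : ∀ i, Integrable u (ν i)) :
    ∫ e, u e ∂(averageLaw ν N)
      = ∑ i : Fin (N + 1), ((N + 1 : ℕ) : ℝ)⁻¹ * ∫ e, u e ∂(ν i) := by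
  rw [averageLaw, integral_smul_measure, integral_finsetSum_measure fun i _ => hu i,
    ← Finset.mul_sum, Finset.sum_range fun i => ∫ e, u e ∂(ν i), ENNReal.toReal_inv,
    ENNReal.toReal_natCast]
  rfl

omit [∀ i, IsProbabilityMeasure (ν i)] in
theorem lintegral_averageLaw (N : ℕ) (u : E → ENNReal) :
    ∫⁻ e, u e ∂(averageLaw ν N)
      = ∑ i : Fin (N + 1), ENNReal.ofReal ((N + 1 : ℕ) : ℝ)⁻¹ * ∫⁻ e, u e ∂(ν i) := by
  rw [averageLaw, lintegral_smul_measure, lintegral_finsetSum_measure,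
    ← Finset.mul_sum, Finset.sum_range fun i => ∫⁻ e, u e ∂(ν i),
    ENNReal.ofReal_inv_of_pos (by positivity), ENNReal.ofReal_natCast]
  rfl

theorem fluct_le (N M K : ℕ) (s : ℝ) : fluct S B D lam ν N M K s ≤ (K + 1 : ℕ) := by
  refine (Finset.sum_le_sum (g := fun _ => 1) fun j _ => ?_).trans (by simp)
  refine (lintegral_mono (g := fun _ => 1) fun ω => ?_).trans (by simp)
  rw [ENNReal.ofReal_le_one, abs_le]
  have h1 := frac_nonneg (cell K j) (queueLengths S D lam ω s)
  have h2 := frac_le_one (cell K j) (queueLengths S D lam ω s)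
  have h3 := fieldMean_nonneg (S := S) (B := B) (D := D) (lam := lam) (ν := ν) M (cell K j) s
  have h4 := fieldMean_le_one (S := S) (B := B) (D := D) (lam := lam) (ν := ν) M (cell K j) s
  constructor <;> linarith

/-- The tightness of the expected fractions. -/
theorem fieldMean_Ici_le (hB : B (Iic 0) = 0) (hlam : 0 < lam) {ρ : Measure E}
    [IsProbabilityMeasure ρ] {N K : ℕ} (hD : D ≤ N + 1) (hK : 1 ≤ K) {s T : ℝ} (hs : s ∈ Icc 0 T) :
    fieldMean S B D lam ν N (Ici K) s ≤ (∫⁻ e, truncQueue S K e ∂ρ).toReal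
      + tvDist (averageLaw ν N) ρ + D * (1 + lam * T) / K := by
  have hfin : ∫⁻ e, truncQueue S K e ∂ρ ≠ ⊤ :=
    ne_top_of_le_ne_top (b := 1) ENNReal.one_ne_top
      ((lintegral_mono fun e => truncQueue_le_one K e).trans (by simp))
  have hT : 0 ≤ T := hs.1.trans hs.2
  have htv := tvDist_nonneg (averageLaw ν N) ρ
  have h1 : ENNReal.ofReal (fieldMean S B D lam ν N (Ici K) s)
      ≤ ∫⁻ e, truncQueue S K e ∂(averageLaw ν N) + ENNReal.ofReal (D * (1 + lam * T) / K) := by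
    rw [fieldMean, ofReal_integral_eq_lintegral_ofReal (integrable_frac N _ s)
      (Eventually.of_forall fun _ => frac_nonneg _ _)]
    calc _ ≤ ∫⁻ ω, ∑ i : Fin (N + 1), ENNReal.ofReal ((N + 1 : ℕ) : ℝ)⁻¹ *
          truncQueue S K (systemState S D lam ω s i) ∂(systemMeasure B (initLaw ν N)) := by
          refine lintegral_mono fun ω => ?_
          rw [frac, ENNReal.ofReal_sum_of_nonneg fun i _ => mul_nonneg (by positivity)
            (indicator_one_nonneg _ _)]
          refine Finset.sum_le_sum fun i _ => ?_
          rw [ENNReal.ofReal_mul (by positivity)]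
          refine mul_le_mul_right (le_trans (le_of_eq ?_)
            (indicator_le_truncQueue S hK (systemState S D lam ω s i))) _
          by_cases h : K ≤ S.queueLength (systemState S D lam ω s i)
          · simp [indicator, queueLengths, h]
          · simp [indicator, queueLengths, h]
      _ = ∑ i : Fin (N + 1), ENNReal.ofReal ((N + 1 : ℕ) : ℝ)⁻¹ *
          ∫⁻ ω, truncQueue S K (systemState S D lam ω s i) ∂(systemMeasure B (initLaw ν N)) := by
          have hm : ∀ i, Measurable fun ω : SystemPath E (N + 1) =>
              truncQueue S K (systemState S D lam ω s i) := fun i =>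
            (measurable_truncQueue S K).comp ((measurable_pi_apply i).comp
              ((measurable_systemState S D lam).comp (measurable_id.prodMk measurable_const)))
          rw [lintegral_finsetSum _ fun i _ => (hm i).const_mul _]
          exact Finset.sum_congr rfl fun i _ => lintegral_const_mul _ (hm i)
      _ ≤ ∑ i : Fin (N + 1), ENNReal.ofReal ((N + 1 : ℕ) : ℝ)⁻¹ *
          (∫⁻ e, truncQueue S K e ∂(ν i) + ENNReal.ofReal (D * (1 + lam * T) / K)) := by
          refine Finset.sum_le_sum fun i _ => mul_le_mul_right ?_ _
          refine (lintegral_truncQueue_systemState_le B hB hD (by omega) hlam K i hs.1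
            (initLaw ν N)).trans (add_le_add (le_of_eq ?_) (ENNReal.ofReal_le_ofReal ?_))
          · exact (measurePreserving_eval (fun i : Fin (N + 1) => ν i) i).lintegral_comp
              (measurable_truncQueue S K)
          · have := hs.2
            gcongr
      _ = _ := by
          simp only [mul_add]
          rw [Finset.sum_add_distrib, lintegral_averageLaw, ← Finset.sum_mul,
            ← ENNReal.ofReal_sum_of_nonneg fun i _ => by positivity]
          congr 1
          have : ∑ _i : Fin (N + 1), ((N + 1 : ℕ) : ℝ)⁻¹ = 1 := by
            rw [Finset.sum_const, Finset.card_univ, Fintype.card_fin, nsmul_eq_mul]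
            exact mul_inv_cancel₀ (by positivity)
          rw [this, ENNReal.ofReal_one, one_mul]
  have h2 := lintegral_le_add_tvDist (μ := averageLaw ν N) (ν := ρ)
    (u := fun e => min 1 ((S.queueLength e : ℝ) / K))
    (measurable_const.min (((measurable_from_top (f := fun k : ℕ => (k : ℝ))).comp
      (measurable_queueLength S)).div_const _)) (fun e => by positivity) (fun e => min_le_left _ _)
  have h3 := h1.trans (add_le_add h2 le_rfl)
  have h4 : (∫⁻ e, ENNReal.ofReal (min 1 ((S.queueLength e : ℝ) / K)) ∂ρ)
      = ENNReal.ofReal (∫⁻ e, truncQueue S K e ∂ρ).toReal := (ENNReal.ofReal_toReal hfin).symm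
  rw [h4, ← ENNReal.ofReal_add ENNReal.toReal_nonneg htv, ← ENNReal.ofReal_add (by positivity)
    (by positivity)] at h3
  exact (ENNReal.ofReal_le_ofReal_iff (by positivity)).1 h3

end MeanField

/-! ### Comparison of two systems of different sizes. -/

section MeanFieldLimit

variable {E : Type*} [MeasurableSpace E] {S : ServiceDiscipline E} {B : Measure ℝ}
  [IsProbabilityMeasure B] {D : ℕ} {lam : ℝ} {ν : ℕ → Measure E}
  [∀ i, IsProbabilityMeasure (ν i)]

/-- The error term of system `N`, given a bound `τ` on the tails. -/
noncomputable def driftError (D : ℕ) (lam T : ℝ) (K : ℕ) (τ : ℝ) (N : ℕ) : ℝ :=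
  (K + 1 : ℕ) * (chaosConst D lam T / √((N + 1 : ℕ) : ℝ))
    + 2 * T * (lam * rateError D (N + 1) + 4 * lam * D ^ 2 * τ)

/-- The fluctuations around the deterministic prediction based on system `M`. -/
theorem sum_lintegral_abs_frac_sub_meanValue_le (hD1 : 1 ≤ D) (hlam : 0 < lam) {N M K : ℕ}
    (hD : D ≤ N + 1) {T t τ : ℝ} (ht : t ∈ Icc 0 T)
    (hτ : ∀ s ∈ Icc 0 T, fieldMean S B D lam ν M (Ici K) s ≤ τ) :
    ∑ j ∈ Finset.range (K + 1), ∫⁻ ω, ENNReal.ofReal |frac (cell K j) (queueLengths S D lam ω t)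
        - meanValue S (lam * D) (fieldRate S B D lam ν M) B t (fun i : Fin (N + 1) => ν i)
          (cell K j)| ∂(systemMeasure B (initLaw ν N))
      ≤ ENNReal.ofReal (driftError D lam T K τ N)
        + ENNReal.ofReal (4 * lam * D ^ 2) * ∫⁻ s in Ioc 0 t, fluct S B D lam ν N M K s := by
  have hD0 : (1 : ℝ) ≤ D := by exact_mod_cast hD1
  have hT : 0 ≤ T := ht.1.trans ht.2
  have hτ0 : 0 ≤ τ := (fieldMean_nonneg M (Ici K) t).trans (hτ t ht)
  have hr0 := rateError_nonneg D (N + 1)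
  set P := systemMeasure B (initLaw ν N) with hP
  set c0 := lam * rateError D (N + 1) + 4 * lam * D ^ 2 * τ with hc0
  have hc0' : 0 ≤ c0 := by positivity
  have key := sum_lintegral_abs_frac_sub_le (S := S) B (by positivity : 0 < lam * D)
    (measurable_fieldRate (S := S) (B := B) (D := D) (lam := lam) (ν := ν) M)
    (fieldRate_nonneg hlam M) (fieldRate_le hlam M) hD1 hlam le_rfl (Nat.succ_pos N)
    (fun i : Fin (N + 1) => ν i) ht.1 K
  refine key.trans ?_
  have hin : ∀ s ∈ Ioc 0 t, ∫⁻ ω, ENNReal.ofReal (∑ i : Fin (N + 1), ((N + 1 : ℕ) : ℝ)⁻¹ *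
      |lam * (N + 1 : ℕ) * receiveProb D (queueLengths S D lam ω s) i
        - fieldRate S B D lam ν M s (queueLengths S D lam ω s i)|) ∂P
      ≤ ENNReal.ofReal c0 + ENNReal.ofReal (2 * lam * D ^ 2) * fluct S B D lam ν N M K s := by
    intro s hs
    have hsT : s ∈ Icc 0 T := ⟨hs.1.le, hs.2.trans ht.2⟩
    have hm : ∀ j, Measurable fun ω : SystemPath E (N + 1) =>
        ENNReal.ofReal |frac (cell K j) (queueLengths S D lam ω s)
          - fieldMean S B D lam ν M (cell K j) s| := fun j =>
      ENNReal.measurable_ofReal.comp (continuous_abs.measurable.comp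
        ((measurable_frac_queueLengths_apply (cell K j) s).sub_const _))
    calc _ ≤ ∫⁻ ω, (ENNReal.ofReal c0 + ENNReal.ofReal (2 * lam * D ^ 2) *
          ∑ j ∈ Finset.range (K + 1), ENNReal.ofReal |frac (cell K j) (queueLengths S D lam ω s)
            - fieldMean S B D lam ν M (cell K j) s|) ∂P := by
          refine lintegral_mono fun ω => ?_
          rw [← ENNReal.ofReal_sum_of_nonneg fun j _ => abs_nonneg _,
            ← ENNReal.ofReal_mul (by positivity), ← ENNReal.ofReal_add hc0'
              (mul_nonneg (by positivity) (Finset.sum_nonneg fun j _ => abs_nonneg _))]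
          refine ENNReal.ofReal_le_ofReal ?_
          refine (sum_abs_receiveProb_sub_le hD1 hD hlam (K := K) (queueLengths S D lam ω s)
            (a := fun k => fieldMean S B D lam ν M (Ici k) s)
            (b := fun j => fieldMean S B D lam ν M (cell K j) s)
            (fun k => fieldMean_nonneg _ _ _) (fun k => fieldMean_le_one _ _ _)
            (fun k hk => fieldMean_mono M (Ici_subset_Ici.2 hk) s)
            (fun k hk => fieldMean_Ici_eq_sum M hk s)).trans ?_
          refine add_le_add (add_le_add le_rfl ?_) le_rfl
          exact mul_le_mul_of_nonneg_left (hτ s hsT) (by positivity)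
      _ = _ := by
          rw [lintegral_add_left measurable_const,
            lintegral_const_mul _ (Finset.measurable_fun_sum _ fun j _ => hm j),
            lintegral_finsetSum _ fun j _ => hm j, lintegral_const, measure_univ, mul_one]
          rfl
  have hout : ∫⁻ s in Ioc 0 t, ∫⁻ ω, ENNReal.ofReal (∑ i : Fin (N + 1), ((N + 1 : ℕ) : ℝ)⁻¹ *
      |lam * (N + 1 : ℕ) * receiveProb D (queueLengths S D lam ω s) i
        - fieldRate S B D lam ν M s (queueLengths S D lam ω s i)|) ∂P
      ≤ ENNReal.ofReal (T * c0) + ENNReal.ofReal (2 * lam * D ^ 2) *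
        ∫⁻ s in Ioc 0 t, fluct S B D lam ν N M K s := by
    refine (setLIntegral_mono' measurableSet_Ioc hin).trans ?_
    rw [lintegral_add_left measurable_const, lintegral_const_mul' _ _ ENNReal.ofReal_ne_top]
    refine add_le_add ?_ le_rfl
    rw [setLIntegral_const, Real.volume_Ioc, sub_zero, ← ENNReal.ofReal_mul hc0', mul_comm T]
    exact ENNReal.ofReal_le_ofReal (mul_le_mul_of_nonneg_left ht.2 hc0')
  have hch : chaosConst D lam t ≤ chaosConst D lam T := by
    have := ht.2
    unfold chaosConst
    gcongr
  have hch0 : 0 ≤ chaosConst D lam T := by unfold chaosConst; positivity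
  calc _ ≤ (K + 1 : ℕ) * ENNReal.ofReal (chaosConst D lam T / √((N + 1 : ℕ) : ℝ))
        + 2 * (ENNReal.ofReal (T * c0) + ENNReal.ofReal (2 * lam * D ^ 2) *
          ∫⁻ s in Ioc 0 t, fluct S B D lam ν N M K s) := by
        refine add_le_add (mul_le_mul_right (ENNReal.ofReal_le_ofReal ?_) _)
          (mul_le_mul_right hout _)
        gcongr
    _ = _ := by
        have h1 : ENNReal.ofReal (driftError D lam T K τ N)
            = (K + 1 : ℕ) * ENNReal.ofReal (chaosConst D lam T / √((N + 1 : ℕ) : ℝ))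
              + 2 * ENNReal.ofReal (T * c0) := by
          rw [driftError, ENNReal.ofReal_add (by positivity) (by positivity),
            ENNReal.ofReal_mul (by positivity), ENNReal.ofReal_natCast, mul_assoc 2,
            ENNReal.ofReal_mul zero_le_two, ENNReal.ofReal_ofNat]
        have h2 : ENNReal.ofReal (4 * lam * D ^ 2) = 2 * ENNReal.ofReal (2 * lam * D ^ 2) := by
          rw [← ENNReal.ofReal_ofNat 2, ← ENNReal.ofReal_mul zero_le_two]
          congr 1; ring
        rw [h1, h2]; ring

/-- Both predictions integrate the same function with values in `[0, 1]`, against the average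
initial laws of the two systems. -/
theorem abs_meanValue_sub_le {ρ : Measure E} [IsProbabilityMeasure ρ]
    (N M : ℕ) (t : ℝ) (A : Set ℕ) {rate : ℝ → ℕ → ℝ} (hrate : ∀ k, Measurable fun t => rate t k) :
    |meanValue S (lam * D) rate B t (fun i : Fin (N + 1) => ν i) A
      - meanValue S (lam * D) rate B t (fun i : Fin (M + 1) => ν i) A|
      ≤ tvDist (averageLaw ν N) ρ + tvDist (averageLaw ν M) ρ := by
  have hm : Measurable fun e => queueProb S (lam * D) rate B t (queueIn S A) 0 e :=
    (measurable_queueProb S B hrate (measurable_queueIn A)).comp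
      (measurable_const.prodMk measurable_id)
  have h0 : ∀ e, 0 ≤ queueProb S (lam * D) rate B t (queueIn S A) 0 e := fun e =>
    queueProb_nonneg S B 0 e
  have h1 : ∀ e, queueProb S (lam * D) rate B t (queueIn S A) 0 e ≤ 1 := fun e =>
    queueProb_le_one S B hrate (measurable_queueIn A) (queueIn_le_one A) 0 e
  have hi : ∀ i, Integrable (fun e => queueProb S (lam * D) rate B t (queueIn S A) 0 e) (ν i) :=
    fun i => Integrable.of_bound hm.aestronglyMeasurable 1 (Eventually.of_forall fun e => by
      rw [Real.norm_eq_abs, abs_of_nonneg (h0 e)]; exact h1 e)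
  have h := abs_integral_sub_le_tvDist (μ := averageLaw ν N) (μ' := averageLaw ν M) (ν := ρ) hm h0 h1
  rwa [integral_averageLaw N hi, integral_averageLaw M hi] at h

/-- The comparison of two systems. -/
theorem fluct_add_fluct_le (hD1 : 1 ≤ D) (hlam : 0 < lam) {ρ : Measure E} [IsProbabilityMeasure ρ]
    {N M K : ℕ} (hDN : D ≤ N + 1) (hDM : D ≤ M + 1) {T t τ : ℝ} (ht : t ∈ Icc 0 T)
    (hτ : ∀ s ∈ Icc 0 T, fieldMean S B D lam ν M (Ici K) s ≤ τ) :
    fluct S B D lam ν N M K t + fluct S B D lam ν M M K t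
      ≤ (ENNReal.ofReal (driftError D lam T K τ N) + 3 * ENNReal.ofReal (driftError D lam T K τ M)
          + (K + 1 : ℕ) * ENNReal.ofReal (tvDist (averageLaw ν N) ρ + tvDist (averageLaw ν M) ρ))
        + ENNReal.ofReal (12 * lam * D ^ 2) *
          ∫⁻ s in Ioc 0 t, (fluct S B D lam ν N M K s + fluct S B D lam ν M M K s) := by
  set m : (n : ℕ) → Set ℕ → ℝ := fun n A =>
    meanValue S (lam * D) (fieldRate S B D lam ν M) B t (fun i : Fin (n + 1) => ν i) A with hm
  set G : ℕ → ENNReal := fun n => ∑ j ∈ Finset.range (K + 1), ∫⁻ ω, ENNReal.ofReal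
    |frac (cell K j) (queueLengths S D lam ω t) - m n (cell K j)|
      ∂(systemMeasure B (initLaw ν n)) with hG
  have hGN := sum_lintegral_abs_frac_sub_meanValue_le (S := S) (B := B) (ν := ν) hD1 hlam hDN ht hτ
  have hGM := sum_lintegral_abs_frac_sub_meanValue_le (S := S) (B := B) (ν := ν) hD1 hlam hDM ht hτ
  -- The expectation in system `M` of its own fractions is no further from the prediction than the
  -- fractions are on average. This closes the loop, since the reference rate is computed from that
  -- expectation.
  have hGM' : ∑ j ∈ Finset.range (K + 1), ENNReal.ofReal
      |m M (cell K j) - fieldMean S B D lam ν M (cell K j) t| ≤ G M := by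
    refine Finset.sum_le_sum fun j _ => ?_
    rw [abs_sub_comm]
    exact ofReal_abs_integral_sub_le (integrable_frac M _ t) _
  have htri : ∀ n (x : ℝ), (∀ j, |m n (cell K j) - m M (cell K j)| ≤ x) → 0 ≤ x →
      fluct S B D lam ν n M K t ≤ G n + (K + 1 : ℕ) * ENNReal.ofReal x + G M := by
    intro n x hx hx0
    calc _ ≤ ∑ j ∈ Finset.range (K + 1), (∫⁻ ω, ENNReal.ofReal
            |frac (cell K j) (queueLengths S D lam ω t) - m n (cell K j)|
              ∂(systemMeasure B (initLaw ν n)) + (ENNReal.ofReal x + ENNReal.ofReal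
            |m M (cell K j) - fieldMean S B D lam ν M (cell K j) t|)) := by
          refine Finset.sum_le_sum fun j _ => ?_
          calc _ ≤ ∫⁻ ω, (ENNReal.ofReal |frac (cell K j) (queueLengths S D lam ω t)
                - m n (cell K j)| + (ENNReal.ofReal x + ENNReal.ofReal
                |m M (cell K j) - fieldMean S B D lam ν M (cell K j) t|))
                ∂(systemMeasure B (initLaw ν n)) := by
                refine lintegral_mono fun ω => ?_
                rw [← ENNReal.ofReal_add hx0 (abs_nonneg _),
                  ← ENNReal.ofReal_add (abs_nonneg _) (by positivity)]
                refine ENNReal.ofReal_le_ofReal ?_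
                refine (abs_sub_le _ (m n (cell K j)) _).trans (add_le_add le_rfl ?_)
                exact (abs_sub_le _ (m M (cell K j)) _).trans (add_le_add (hx j) le_rfl)
            _ = _ := by
                rw [lintegral_add_right _ measurable_const, lintegral_const, measure_univ, mul_one]
      _ = G n + ((K + 1 : ℕ) * ENNReal.ofReal x + ∑ j ∈ Finset.range (K + 1), ENNReal.ofReal
            |m M (cell K j) - fieldMean S B D lam ν M (cell K j) t|) := by
          rw [Finset.sum_add_distrib, Finset.sum_add_distrib]
          simp [hG]
      _ ≤ _ := by
          rw [add_assoc]
          exact add_le_add le_rfl (add_le_add le_rfl hGM')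
  have h1 := htri N _ (fun j => abs_meanValue_sub_le (S := S) (B := B) (D := D) (ν := ν) (ρ := ρ)
    N M t (cell K j) (measurable_fieldRate M)) (add_nonneg (tvDist_nonneg _ _) (tvDist_nonneg _ _))
  -- With `N` replaced by `M` the initial laws agree. In total `G N` enters once and `G M` three
  -- times, hence the factors `3` and `12 = 3 * 4`.
  have h2 := htri M 0 (fun j => by simp) le_rfl
  rw [ENNReal.ofReal_zero, mul_zero, add_zero] at h2
  have h12 : ENNReal.ofReal (12 * lam * D ^ 2) = 3 * ENNReal.ofReal (4 * lam * D ^ 2) := by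
    rw [← ENNReal.ofReal_ofNat 3, ← ENNReal.ofReal_mul (by norm_num)]
    congr 1; ring
  calc _ ≤ (G N + (K + 1 : ℕ) * ENNReal.ofReal (tvDist (averageLaw ν N) ρ
        + tvDist (averageLaw ν M) ρ) + G M) + (G M + G M) := add_le_add h1 h2
    _ = G N + 3 * G M + (K + 1 : ℕ) * ENNReal.ofReal (tvDist (averageLaw ν N) ρ
        + tvDist (averageLaw ν M) ρ) := by ring
    _ ≤ (ENNReal.ofReal (driftError D lam T K τ N) + ENNReal.ofReal (4 * lam * D ^ 2) *
          ∫⁻ s in Ioc 0 t, fluct S B D lam ν N M K s)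
        + 3 * (ENNReal.ofReal (driftError D lam T K τ M) + ENNReal.ofReal (4 * lam * D ^ 2) *
          ∫⁻ s in Ioc 0 t, fluct S B D lam ν M M K s)
        + (K + 1 : ℕ) * ENNReal.ofReal (tvDist (averageLaw ν N) ρ
        + tvDist (averageLaw ν M) ρ) :=
        add_le_add (add_le_add hGN (mul_le_mul_right hGM _)) le_rfl
    _ ≤ (ENNReal.ofReal (driftError D lam T K τ N) + 3 * ENNReal.ofReal (driftError D lam T K τ M)
          + (K + 1 : ℕ) * ENNReal.ofReal (tvDist (averageLaw ν N) ρ + tvDist (averageLaw ν M) ρ))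
        + ENNReal.ofReal (12 * lam * D ^ 2) *
          ((∫⁻ s in Ioc 0 t, fluct S B D lam ν N M K s)
            + ∫⁻ s in Ioc 0 t, fluct S B D lam ν M M K s) := by
        rw [h12]
        have h3 : ENNReal.ofReal (4 * lam * D ^ 2) * ∫⁻ s in Ioc 0 t, fluct S B D lam ν N M K s
            ≤ 3 * (ENNReal.ofReal (4 * lam * D ^ 2) *
              ∫⁻ s in Ioc 0 t, fluct S B D lam ν N M K s) := by
          refine le_mul_of_one_le_left' ?_
          norm_num
        refine (add_le_add (add_le_add (add_le_add le_rfl h3) le_rfl) le_rfl).trans (le_of_eq ?_)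
        ring
    _ ≤ _ := add_le_add le_rfl (mul_le_mul_right (le_lintegral_add _ _) _)

end MeanFieldLimit

/-! ### Existence of the limiting rate. -/

section LimitRate

variable {E : Type*} [MeasurableSpace E] {S : ServiceDiscipline E} {B : Measure ℝ}
  [IsProbabilityMeasure B] {D : ℕ} {lam : ℝ} {ν : ℕ → Measure E}
  [∀ i, IsProbabilityMeasure (ν i)]

omit [∀ i, IsProbabilityMeasure (ν i)] in
theorem tendsto_driftError (D : ℕ) (lam T : ℝ) (K : ℕ) :
    Tendsto (driftError D lam T K 0) atTop (𝓝 0) := by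
  have h1 : Tendsto (fun N : ℕ => √((N + 1 : ℕ) : ℝ)) atTop atTop :=
    Real.tendsto_sqrt_atTop.comp (tendsto_natCast_atTop_atTop.comp (tendsto_add_atTop_nat 1))
  have h2 := (h1.const_div_atTop (chaosConst D lam T)).const_mul ((K + 1 : ℕ) : ℝ)
  have h3 := (((tendsto_add_atTop_iff_nat 1).2 (tendsto_rateError D)).const_mul lam).const_mul (2 * T)
  have h4 := h2.add h3
  have h5 : driftError D lam T K 0 = fun N : ℕ => ((K + 1 : ℕ) : ℝ) * (chaosConst D lam T /
      √((N + 1 : ℕ) : ℝ)) + 2 * T * (lam * rateError D (N + 1)) := by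
    funext N; simp [driftError]
  rw [h5]
  simpa using h4

omit [∀ i, IsProbabilityMeasure (ν i)] in
theorem driftError_eq (D : ℕ) (lam T : ℝ) (K : ℕ) (τ : ℝ) (N : ℕ) :
    driftError D lam T K τ N = driftError D lam T K 0 N + 8 * T * lam * D ^ 2 * τ := by
  simp only [driftError]; ring

omit [∀ i, IsProbabilityMeasure (ν i)] in
theorem driftError_nonneg (hlam : 0 < lam) {T τ : ℝ} (hT : 0 ≤ T) (hτ : 0 ≤ τ) (K N : ℕ) :
    0 ≤ driftError D lam T K τ N := by
  have h1 : 0 ≤ chaosConst D lam T := by unfold chaosConst; positivity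
  have h2 := rateError_nonneg D (N + 1)
  unfold driftError; positivity

/-- The fluctuations vanish as the sizes of both systems tend to infinity. -/
theorem exists_fluct_le (hB : B (Iic 0) = 0) (hD1 : 1 ≤ D) (hlam : 0 < lam) {ρ : Measure E}
    [IsProbabilityMeasure ρ] (htv : Tendsto (fun N => tvDist (averageLaw ν N) ρ) atTop (𝓝 0))
    {T t : ℝ} (ht : t ∈ Icc 0 T) (k : ℕ) {δ : ℝ} (hδ : 0 < δ) :
    ∃ K, k ≤ K ∧ ∃ N₀, ∀ N ≥ N₀, ∀ M ≥ N₀, fluct S B D lam ν N M K t ≤ ENNReal.ofReal δ := by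
  have hT : 0 ≤ T := ht.1.trans ht.2
  have hD0 : (1 : ℝ) ≤ D := by exact_mod_cast hD1
  set c : ℝ := 12 * lam * D ^ 2 with hc
  have hc0 : 0 < c := by positivity
  set g : ℝ := 2 * Real.exp (2 * c * t) with hg
  have hg0 : 0 < g := by positivity
  -- The tail bound `τ` has coefficient `8 * T * lam * D ^ 2` in `driftError`, which occurs once for
  -- `N` and three times for `M`.
  set C : ℝ := 32 * T * lam * D ^ 2 with hC
  have hC0 : 0 ≤ C := by positivity
  let b : ℕ → ℝ := fun K => (∫⁻ e, truncQueue S K e ∂ρ).toReal + D * (1 + lam * T) / K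
  have hb0 : ∀ K, 0 ≤ b K := fun K => add_nonneg ENNReal.toReal_nonneg (by positivity)
  have hb : Tendsto (fun K => C * b K) atTop (𝓝 0) := by
    have h1 := (ENNReal.tendsto_toReal ENNReal.zero_ne_top).comp
      (tendsto_lintegral_truncQueue (S := S) ρ)
    have h2 := h1.add (tendsto_const_div_atTop_nhds_zero_nat ((D : ℝ) * (1 + lam * T)))
    simpa using h2.const_mul C
  have hη : 0 < δ / (3 * g) := by positivity
  -- The Grönwall factor `g` does not involve `K`, so the tail can be made small by `K` first. For
  -- this `K` the remaining errors vanish as `N` and `M` grow, and each of the three parts gets a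
  -- third of `δ / g`.
  obtain ⟨K, hbK, hkK⟩ := ((hb.eventually_lt_const hη).and (eventually_ge_atTop (max k 1))).exists
  have hK1 : 1 ≤ K := (le_max_right k 1).trans hkK
  have hp : Tendsto (fun N => driftError D lam T K 0 N + ((K + 1 : ℕ) : ℝ) *
      tvDist (averageLaw ν N) ρ) atTop (𝓝 0) := by
    simpa using (tendsto_driftError D lam T K).add (htv.const_mul ((K + 1 : ℕ) : ℝ))
  have hq : Tendsto (fun M => 3 * driftError D lam T K 0 M + (C + ((K + 1 : ℕ) : ℝ)) *
      tvDist (averageLaw ν M) ρ) atTop (𝓝 0) := by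
    simpa using ((tendsto_driftError D lam T K).const_mul 3).add
      (htv.const_mul (C + ((K + 1 : ℕ) : ℝ)))
  obtain ⟨N₀, hN₀⟩ := eventually_atTop.1 (((hp.eventually_lt_const hη).and
    (hq.eventually_lt_const hη)).and (eventually_ge_atTop D))
  refine ⟨K, (le_max_left k 1).trans hkK, N₀, fun N hN M hM => ?_⟩
  obtain ⟨⟨hpN, -⟩, hDN⟩ := hN₀ N hN
  obtain ⟨⟨-, hqM⟩, hDM⟩ := hN₀ M hM
  have htN := tvDist_nonneg (averageLaw ν N) ρ
  have htM := tvDist_nonneg (averageLaw ν M) ρ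
  set τ : ℝ := b K + tvDist (averageLaw ν M) ρ with hτ
  have hτ0 : 0 ≤ τ := add_nonneg (hb0 K) htM
  have htail : ∀ s ∈ Icc 0 T, fieldMean S B D lam ν M (Ici K) s ≤ τ := fun s hs =>
    (fieldMean_Ici_le hB hlam (ρ := ρ) (by omega) hK1 hs).trans (le_of_eq (by
      simp only [hτ, b]; ring))
  have hdN := driftError_nonneg (D := D) hlam hT hτ0 K N
  have hdM := driftError_nonneg (D := D) hlam hT hτ0 K M
  set α : ℝ := driftError D lam T K τ N + 3 * driftError D lam T K τ M + ((K + 1 : ℕ) : ℝ) *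
    (tvDist (averageLaw ν N) ρ + tvDist (averageLaw ν M) ρ) with hα
  have hα0 : 0 ≤ α := by positivity
  have hαeq : ENNReal.ofReal (driftError D lam T K τ N)
      + 3 * ENNReal.ofReal (driftError D lam T K τ M)
      + (K + 1 : ℕ) * ENNReal.ofReal (tvDist (averageLaw ν N) ρ + tvDist (averageLaw ν M) ρ)
      = ENNReal.ofReal α := by
    have htNM := add_nonneg htN htM
    rw [hα]
    generalize tvDist (averageLaw ν N) ρ + tvDist (averageLaw ν M) ρ = v at htNM ⊢
    rw [ENNReal.ofReal_add (by positivity) (by positivity), ENNReal.ofReal_add hdN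
      (by positivity), ENNReal.ofReal_mul (by norm_num), ENNReal.ofReal_mul (by positivity),
      ENNReal.ofReal_natCast, ENNReal.ofReal_ofNat]
  -- The a priori bound needed for Grönwall comes from the `K + 1` cells of each of the two terms,
  -- as fractions differ by at most `1`.
  have hgr := le_of_le_add_lintegral (T := T) (α := ENNReal.ofReal α)
    (b := (K + 1 : ℕ) + (K + 1 : ℕ)) hc0 (by finiteness)
    (fun s => add_le_add (fluct_le (S := S) (B := B) (D := D) (lam := lam) (ν := ν) N M K s)
      (fluct_le (S := S) (B := B) (D := D) (lam := lam) (ν := ν) M M K s))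
    (fun s hs => (fluct_add_fluct_le hD1 hlam (ρ := ρ) (by omega) (by omega) hs htail).trans
      (add_le_add hαeq.le le_rfl)) t ht
  refine le_self_add.trans (hgr.trans ?_)
  rw [← ENNReal.ofReal_ofNat 2, ← ENNReal.ofReal_mul zero_le_two, ← ENNReal.ofReal_mul (by positivity)]
  refine ENNReal.ofReal_le_ofReal ?_
  have h1 : α = C * b K + (driftError D lam T K 0 N + ((K + 1 : ℕ) : ℝ) * tvDist (averageLaw ν N) ρ)
      + (3 * driftError D lam T K 0 M + (C + ((K + 1 : ℕ) : ℝ)) * tvDist (averageLaw ν M) ρ) := by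
    rw [hα, driftError_eq D lam T K τ N, driftError_eq D lam T K τ M, hτ, hC]; ring
  have h2 : α ≤ δ / g := by
    have : δ / g = δ / (3 * g) + δ / (3 * g) + δ / (3 * g) := by field_simp; norm_num
    rw [h1, this]; linarith
  calc 2 * α * Real.exp (2 * c * t) = α * g := by rw [hg]; ring
    _ ≤ δ / g * g := mul_le_mul_of_nonneg_right h2 hg0.le
    _ = δ := by field_simp

theorem lintegral_abs_frac_Ici_sub_le_fluct {N M k K : ℕ} (hk : k ≤ K) (t : ℝ) :
    ∫⁻ ω, ENNReal.ofReal |frac (Ici k) (queueLengths S D lam ω t)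
      - fieldMean S B D lam ν M (Ici k) t| ∂(systemMeasure B (initLaw ν N))
      ≤ fluct S B D lam ν N M K t := by
  have hm : ∀ j, Measurable fun ω : SystemPath E (N + 1) =>
      ENNReal.ofReal |frac (cell K j) (queueLengths S D lam ω t)
        - fieldMean S B D lam ν M (cell K j) t| := fun j =>
    ENNReal.measurable_ofReal.comp (continuous_abs.measurable.comp
      ((measurable_frac_queueLengths_apply (cell K j) t).sub_const _))
  rw [fluct, ← lintegral_finsetSum _ fun j _ => hm j]
  refine lintegral_mono fun ω => ?_
  rw [← ENNReal.ofReal_sum_of_nonneg fun j _ => abs_nonneg _]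
  refine ENNReal.ofReal_le_ofReal ?_
  rw [frac_Ici_eq_sum hk, fieldMean_Ici_eq_sum M hk, ← Finset.sum_sub_distrib]
  refine (Finset.abs_sum_le_sum_abs _ _).trans (Finset.sum_le_sum fun j _ => ?_)
  split_ifs
  · exact le_rfl
  · simp

/-- The expected fractions converge, and the random fractions converge to their limit. -/
theorem exists_tendsto_fieldMean (hB : B (Iic 0) = 0) (hD1 : 1 ≤ D) (hlam : 0 < lam) {ρ : Measure E}
    [IsProbabilityMeasure ρ] (htv : Tendsto (fun N => tvDist (averageLaw ν N) ρ) atTop (𝓝 0))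
    {T t : ℝ} (ht : t ∈ Icc 0 T) (k : ℕ) :
    ∃ a, Tendsto (fun N => fieldMean S B D lam ν N (Ici k) t) atTop (𝓝 a) ∧
      Tendsto (fun N => ∫⁻ ω, ENNReal.ofReal |frac (Ici k) (queueLengths S D lam ω t) - a|
        ∂(systemMeasure B (initLaw ν N))) atTop (𝓝 0) := by
  have hδ : ∀ δ : ℝ, 0 < δ → ∃ N₀, ∀ N ≥ N₀, ∀ M ≥ N₀, ∫⁻ ω, ENNReal.ofReal
      |frac (Ici k) (queueLengths S D lam ω t) - fieldMean S B D lam ν M (Ici k) t|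
        ∂(systemMeasure B (initLaw ν N)) ≤ ENNReal.ofReal δ := by
    intro δ hδ
    obtain ⟨K, hK, N₀, h⟩ := exists_fluct_le (S := S) (ν := ν) hB hD1 hlam htv ht k hδ
    exact ⟨N₀, fun N hN M hM => (lintegral_abs_frac_Ici_sub_le_fluct hK t).trans (h N hN M hM)⟩
  -- Since the mean of a deviation is at most its mean absolute value, the expected fractions of
  -- systems `N` and `M` are close once both are large.
  have hcauchy : CauchySeq fun N => fieldMean S B D lam ν N (Ici k) t := by
    rw [Metric.cauchySeq_iff]
    intro ε hε
    obtain ⟨N₀, h⟩ := hδ (ε / 2) (by positivity)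
    refine ⟨N₀, fun N hN M hM => ?_⟩
    have h1 := (ofReal_abs_integral_sub_le (integrable_frac (S := S) (B := B) (D := D) (lam := lam)
      (ν := ν) N (Ici k) t) (fieldMean S B D lam ν M (Ici k) t)).trans (h N hN M hM)
    have h2 := (ENNReal.ofReal_le_ofReal_iff (by positivity)).1 h1
    rw [Real.dist_eq]
    exact h2.trans_lt (by linarith)
  obtain ⟨a, ha⟩ := cauchySeq_tendsto_of_complete hcauchy
  refine ⟨a, ha, ?_⟩
  have h1 : Tendsto (fun N => ENNReal.ofReal |fieldMean S B D lam ν N (Ici k) t - a|) atTop (𝓝 0) := by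
    simpa using ENNReal.tendsto_ofReal ((ha.sub_const a).abs)
  have h2 : Tendsto (fun N => ∫⁻ ω, ENNReal.ofReal |frac (Ici k) (queueLengths S D lam ω t)
      - fieldMean S B D lam ν N (Ici k) t| ∂(systemMeasure B (initLaw ν N))) atTop (𝓝 0) := by
    rw [ENNReal.tendsto_nhds_zero]
    intro ε hε
    obtain ⟨δ, hδ0, hδε⟩ : ∃ δ : ℝ, 0 < δ ∧ ENNReal.ofReal δ ≤ ε := by
      rcases eq_or_ne ε ⊤ with rfl | hε'
      · exact ⟨1, one_pos, le_top⟩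
      · exact ⟨ε.toReal, ENNReal.toReal_pos hε.ne' hε', (ENNReal.ofReal_toReal hε').le⟩
    obtain ⟨N₀, h⟩ := hδ δ hδ0
    exact eventually_atTop.2 ⟨N₀, fun N hN => (h N hN N hN).trans hδε⟩
  have h3 := h2.add h1
  rw [add_zero] at h3
  refine tendsto_of_tendsto_of_tendsto_of_le_of_le tendsto_const_nhds h3 (fun _ => zero_le)
    fun N => ?_
  calc _ ≤ ∫⁻ ω, (ENNReal.ofReal |frac (Ici k) (queueLengths S D lam ω t)
        - fieldMean S B D lam ν N (Ici k) t|
        + ENNReal.ofReal |fieldMean S B D lam ν N (Ici k) t - a|)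
          ∂(systemMeasure B (initLaw ν N)) := by
        refine lintegral_mono fun ω => ?_
        rw [← ENNReal.ofReal_add (abs_nonneg _) (abs_nonneg _)]
        exact ENNReal.ofReal_le_ofReal (abs_sub_le _ _ _)
    _ = _ := by
        rw [lintegral_add_right _ measurable_const, lintegral_const, measure_univ, mul_one]

/-- The second moment of the deviation of the tagged rate from its limiting form. -/
theorem setIntegral_taggedRate_sub_sq_le (hD1 : 1 ≤ D) (hlam : 0 < lam) {N : ℕ} (hD : D ≤ N + 1)
    {t a b : ℝ} (ha : 0 ≤ a) (ha1 : a ≤ 1) (hb : 0 ≤ b) (hb1 : b ≤ 1) (k : ℕ) :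
    ∫ ω in {ω | queueLengths S D lam ω t 0 = k},
      (taggedRate lam D (queueLengths S D lam ω t) k - lam * jsqPoly D a b) ^ 2
        ∂(systemMeasure B (initLaw ν N))
      ≤ 2 * lam * D * (lam * rateError D (N + 1) + lam * D ^ 2 *
        ((∫⁻ ω, ENNReal.ofReal |frac (Ici k) (queueLengths S D lam ω t) - a|
          ∂(systemMeasure B (initLaw ν N))).toReal
        + (∫⁻ ω, ENNReal.ofReal |frac (Ici (k + 1)) (queueLengths S D lam ω t) - b|
          ∂(systemMeasure B (initLaw ν N))).toReal)) := by
  set P := systemMeasure B (initLaw ν N) with hP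
  have hr0 := rateError_nonneg D (N + 1)
  have hi : ∀ A (m : ℝ), Integrable (fun ω : SystemPath E (N + 1) =>
      |frac A (queueLengths S D lam ω t) - m|) P := fun A m =>
    ((integrable_frac N A t).sub (integrable_const m)).abs
  have hint : ∀ A (m : ℝ), (∫⁻ ω, ENNReal.ofReal |frac A (queueLengths S D lam ω t) - m| ∂P).toReal
      = ∫ ω, |frac A (queueLengths S D lam ω t) - m| ∂P := fun A m =>
    (integral_eq_lintegral_of_nonneg_ae (Eventually.of_forall fun ω => abs_nonneg _)
      (hi A m).aestronglyMeasurable).symm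
  rw [hint, hint]
  let G : SystemPath E (N + 1) → ℝ := fun ω => 2 * lam * D * (lam * rateError D (N + 1)
    + lam * D ^ 2 * (|frac (Ici k) (queueLengths S D lam ω t) - a|
      + |frac (Ici (k + 1)) (queueLengths S D lam ω t) - b|))
  have hGi : Integrable G P :=
    ((integrable_const _).add (((hi _ a).add (hi _ b)).const_mul _)).const_mul _
  have hG0 : ∀ ω, 0 ≤ G ω := fun ω => by positivity
  have hA : MeasurableSet {ω : SystemPath E (N + 1) | queueLengths S D lam ω t 0 = k} :=
    measurable_queueLengths_apply lam t 0 (measurableSet_singleton k)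
  calc _ ≤ ∫ ω in {ω | queueLengths S D lam ω t 0 = k}, G ω ∂P := by
        refine integral_mono_of_nonneg (Eventually.of_forall fun ω => sq_nonneg _)
          hGi.integrableOn ?_
        filter_upwards [ae_restrict_mem hA] with ω hω
        have hω' : queueLengths S D lam ω t 0 = k := hω
        have h1 := abs_mul_receiveProb_sub_le hD1 hD (queueLengths S D lam ω t) 0
        have h2 := abs_taggedRate_sub_le hD1 hlam hD (queueLengths S D lam ω t)
          (mul_nonneg hlam.le (jsqPoly_nonneg D ha hb))
          (mul_le_mul_of_nonneg_left (jsqPoly_le D ha ha1 hb hb1) hlam.le)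
        have h3 := taggedRate_eq lam hD1 hD (queueLengths S D lam ω t)
        rw [← frac_Ici, ← frac_Ici] at h1
        rw [hω'] at h1 h2 h3
        have h4 := abs_jsqPoly_sub_le D (frac_nonneg (Ici k) (queueLengths S D lam ω t))
          (frac_le_one _ _) (frac_nonneg (Ici (k + 1)) (queueLengths S D lam ω t))
          (frac_le_one _ _) ha ha1 hb hb1
        have h5 : |taggedRate lam D (queueLengths S D lam ω t) k - lam * jsqPoly D a b|
            ≤ lam * rateError D (N + 1) + lam * D ^ 2 *
              (|frac (Ici k) (queueLengths S D lam ω t) - a|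
                + |frac (Ici (k + 1)) (queueLengths S D lam ω t) - b|) := by
          rw [h3, mul_assoc, ← mul_sub, abs_mul, abs_of_pos hlam, mul_assoc lam, ← mul_add]
          exact mul_le_mul_of_nonneg_left ((abs_sub_le _ _ _).trans (add_le_add h1 h4)) hlam.le
        -- One factor of the square is bounded by `2 * lam * D`, so first-moment convergence of the
        -- fractions suffices.
        rw [← sq_abs, sq]
        exact mul_le_mul (h2.trans (le_of_eq (by ring))) h5 (abs_nonneg _) (by positivity)
    _ ≤ ∫ ω, G ω ∂P := setIntegral_le_integral hGi (Eventually.of_forall hG0)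
    _ = _ := by
        have hab : Integrable (fun ω : SystemPath E (N + 1) =>
            |frac (Ici k) (queueLengths S D lam ω t) - a|
              + |frac (Ici (k + 1)) (queueLengths S D lam ω t) - b|) P := (hi _ a).add (hi _ b)
        simp only [G]
        rw [integral_const_mul, integral_add (integrable_const _) (hab.const_mul _),
          integral_const_mul (lam * (D : ℝ) ^ 2), integral_add (hi _ a) (hi _ b)]
        simp

/-- Independent initial states with convergent average law have a limiting rate. -/
theorem exists_isLimitRate (hB : B (Iic 0) = 0) (hD1 : 1 ≤ D) (hlam : 0 < lam) {ρ : Measure E}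
    [IsProbabilityMeasure ρ] (htv : Tendsto (fun N => tvDist (averageLaw ν N) ρ) atTop (𝓝 0))
    (T : ℝ) : ∃ rate : ℝ → ℕ → ℝ, IsLimitRate S B D lam T (initLaw ν) (lam * D) rate := by
  classical
  -- Outside `[0, T]` the indicator forces the limit `0`, so `a` is a pointwise limit of measurable
  -- functions on the whole line and therefore measurable.
  have hex : ∀ (t : ℝ) (k : ℕ), ∃ a, Tendsto (fun N => (Icc 0 T).indicator
      (fieldMean S B D lam ν N (Ici k)) t) atTop (𝓝 a) ∧ (t ∈ Icc 0 T →
        Tendsto (fun N => ∫⁻ ω, ENNReal.ofReal |frac (Ici k) (queueLengths S D lam ω t) - a|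
        ∂(systemMeasure B (initLaw ν N))) atTop (𝓝 0)) := by
    intro t k
    by_cases ht : t ∈ Icc 0 T
    · obtain ⟨a, h1, h2⟩ := exists_tendsto_fieldMean (S := S) (ν := ν) hB hD1 hlam htv ht k
      refine ⟨a, ?_, fun _ => h2⟩
      simpa [ht] using h1
    · refine ⟨0, ?_, fun h => absurd h ht⟩
      simp [ht]
  choose a ha hfrac using hex
  have hind0 : ∀ N k t, 0 ≤ (Icc 0 T).indicator (fieldMean S B D lam ν N (Ici k)) t := fun N k t =>
    indicator_nonneg (fun s _ => fieldMean_nonneg N (Ici k) s) t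
  have hind1 : ∀ N k t, (Icc 0 T).indicator (fieldMean S B D lam ν N (Ici k)) t ≤ 1 :=
    fun N k t => indicator_le' (g := fun _ => 1) (fun s _ => fieldMean_le_one N (Ici k) s)
      (fun _ _ => zero_le_one) t
  have ha0 : ∀ t k, 0 ≤ a t k := fun t k => ge_of_tendsto' (ha t k) fun N => hind0 N k t
  have ha1 : ∀ t k, a t k ≤ 1 := fun t k => le_of_tendsto' (ha t k) fun N => hind1 N k t
  have ham : ∀ k, Measurable fun t => a t k := fun k =>
    measurable_of_tendsto_metrizable (fun N => (measurable_fieldMean N (Ici k)).indicator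
      measurableSet_Icc) (tendsto_pi_nhds.2 fun t => ha t k)
  refine ⟨fun t k => lam * jsqPoly D (a t k) (a t (k + 1)), ?_, ?_, ?_, ?_⟩
  · exact fun k => ((measurable_jsqPoly D).comp ((ham k).prodMk (ham (k + 1)))).const_mul lam
  · exact fun t k => mul_nonneg hlam.le (jsqPoly_nonneg D (ha0 _ _) (ha0 _ _))
  · exact fun t k => mul_le_mul_of_nonneg_left (jsqPoly_le D (ha0 _ _) (ha1 _ _) (ha0 _ _)
      (ha1 _ _)) hlam.le
  · intro t ht k
    have h1 := (ENNReal.tendsto_toReal ENNReal.zero_ne_top).comp (hfrac t k ht)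
    have h2 := (ENNReal.tendsto_toReal ENNReal.zero_ne_top).comp (hfrac t (k + 1) ht)
    have h3 := ((((tendsto_add_atTop_iff_nat 1).2 (tendsto_rateError D)).const_mul lam).add
      ((h1.add h2).const_mul (lam * D ^ 2))).const_mul (2 * lam * D)
    simp only [ENNReal.toReal_zero, add_zero, mul_zero] at h3
    refine tendsto_of_tendsto_of_tendsto_of_le_of_le' tendsto_const_nhds h3
      (Eventually.of_forall fun N => integral_nonneg fun ω => sq_nonneg _) ?_
    filter_upwards [eventually_ge_atTop D] with N hN
    exact setIntegral_taggedRate_sub_sq_le hD1 hlam (by omega) (ha0 _ _) (ha1 _ _) (ha0 _ _)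
      (ha1 _ _) k

end LimitRate

end LoadBalancing

open LoadBalancing in
theorem theorem3p2 {E : Type*} [MeasurableSpace E] (S : ServiceDiscipline E)
    (B : Measure ℝ) [IsProbabilityMeasure B] (hB : B (Iic 0) = 0)
    (D : ℕ) (hD : 1 ≤ D) (lam : ℝ) (hlam : 0 < lam) (T : ℝ) :
    -- the limiting rate exists for independent initial states with convergent average law
    (∀ (ν : ℕ → Measure E) (ρ : Measure E), (∀ i, IsProbabilityMeasure (ν i)) →
      IsProbabilityMeasure ρ →
      Tendsto (fun N : ℕ => tvDist
        ((((N + 1 : ℕ) : ENNReal)⁻¹) • ∑ i ∈ Finset.range (N + 1), ν i) ρ) atTop (𝓝 0) →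
      ∃ rate : ℝ → ℕ → ℝ, IsLimitRate S B D lam T
        (fun N => Measure.pi fun i : Fin (N + 1) => ν i) (lam * D) rate) ∧
    -- the tagged queue converges to the single queue with the limiting rate
    (∀ (μ : (N : ℕ) → Measure (Fin (N + 1) → E)) (ν : Measure E),
      (∀ N, IsProbabilityMeasure (μ N)) →
      (∀ N, (μ N).map (fun x => x 0) = ν) →
      ∀ (R : ℝ) (rate : ℝ → ℕ → ℝ), 0 < R → IsLimitRate S B D lam T μ R rate →
      ∀ t ∈ Icc 0 T, Tendsto
        (fun N => tvDist (taggedLaw S B D lam (μ N) t) (singleQueueLaw S B R rate ν t))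
        atTop (𝓝 0)) := by
  refine ⟨fun ν ρ hν hρ htv => exists_isLimitRate hB hD hlam htv T, ?_⟩
  intro μ ν hμ hν R rate hR h t ht
  exact tendsto_tvDist_taggedLaw B hB hR hD hlam hμ hν h ht
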